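/- **Setting.** Fix $k\ge 1$. Let $\sigma$ be a relational signature (all arities positive) without constants, let $C_1,C_2$ be sets of constant symbols and let $\sigma_1=\sigma\cup C_1$, $\sigma_2=\sigma\cup C_2$, $\sigma_3=\sigma\cup C_1\cup C_2$. Constants in $C_1\cap C_2$ are called shared. For a $\sigma_1$-structure $A$ and a $\sigma_2$-structure $B$, the parallel sum $A\oplus B$ is the $\sigma_3$-structure on the quotient of the disjoint union $A+B$ by the least equivalence relation identifying $c^A$ with $c^B$ for every shared $c$; a tuple is in $R^{A\oplus B}$ iff it is the image under the quotient map $\iota$ of a tuple in $R^A$ or in $R^B$, and $c^{A\oplus B}=\iota(c^A)$ for $c\in C_1$, $c^{A\oplus B}=\iota(c^B)$ for $c\in C_2$. For each $i$ let $\sigma_i^E$ be the two-sorted signature with sorts $\mathbf f,\mathbf s$, the constants of $\sigma_i$ in sort $\mathbf f$, the relation symbols of $\sigma$ on sort $\mathbf f$, a binary relation $I$ on sort $\mathbf f$ and a relation $e$ of arity $\langle\mathbf f,\mathbf s\rangle$. The standard model $\mathfrak t^E(A)$ of a $\sigma_i$-structure $A$ has sorts $A$ and $\mathcal P(A)$,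 with $I$ interpreted as equality and $e$ as membership. Let $\mathcal R_{nc}(\sigma_i^E)$ be the category of $\sigma_i^E$-structures and of those homomorphisms that send non-constant elements (elements interpreting no constant symbol) to non-constant elements. On it, $\mathbb E_k^{nc}$ is the comonad whose value at $A$ has as elements of sort $s$ the constant symbols of sort $s$ and the words $[a_1{:}s_1,\dots,a_n{:}s_n]$ of non-constant elements of $A$ with $1\le n\le k$ and $s_n=s$. Its counit $\varepsilon$ sends a word to its last letter and a constant symbol to its interpretation; a tuple is in a relation $R$ iff the words in it are pairwise comparable in the prefix order and the tuple of its images under $\varepsilon$ is in $R^A$; the comultiplication sends a word to the word of its non-empty prefixes. Coalgebra embeddings are the coalgebra morphisms with strong injective underlying homomorphism; paths are the coalgebras $(P,\pi)$ whose non-constant elements, ordered by $x\sqsubseteq y$ iff $\pi(x)$ is a prefix of $\pi(y)$, form a finite linear order. A coalgebra morphism $h$ is an open pathwise-embedding if $h\circ e$ is an embedding for every path embedding $e$, and every commutative square formed by $h$, two path embeddings into the domain and the codomain of $h$, and an embedding between these paths has a diagonal filler. A Kleisli law for $H\colon\mathcal C_1\times\mathcal C_2\to\mathcal C_3$ and comonads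 $\mathbb C_1,\mathbb C_2,\mathbb C_3$ is a natural transformation $\kappa\colon\mathbb C_3\circ H\to H\circ(\mathbb C_1\times\mathbb C_2)$ with $H(\varepsilon,\varepsilon)\circ\kappa=\varepsilon_H$ and $H(\delta,\delta)\circ\kappa=\kappa\circ\mathbb C_3\kappa\circ\delta_H$. Writing $F^{\mathbb C_3}$ for the cofree coalgebra functor, the lift $\widehat H(\alpha,\beta)$ to coalgebras $\alpha\colon A\to\mathbb C_1A$, $\beta\colon B\to\mathbb C_2B$ is the equaliser of $F^{\mathbb C_3}(\kappa)\circ\delta$ and $F^{\mathbb C_3}(H(\alpha,\beta))\colon F^{\mathbb C_3}(H(A,B))\to F^{\mathbb C_3}(H(\mathbb C_1A,\mathbb C_2B))$. The law is smooth if these equalisers exist and $\widehat H(f,g)$ is an open pathwise-embedding whenever $f$ and $g$ are. A binary operation $\mathrm{op}$ from pairs of a $\sigma_1$- and a $\sigma_2$-structure to $\sigma_3$-structures is MSO-$\mathbb E_k^{nc}$-smooth if there are a functor $H\colon\mathcal R_{nc}(\sigma_1^E)\times\mathcal R_{nc}(\sigma_2^E)\to\mathcal R_{nc}(\sigma_3^E)$,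 a smooth Kleisli law for $H$ and $\mathbb E_k^{nc}$, and for all structures $A,B$ a morphism $\theta\colon H(\mathfrak t^E(A),\mathfrak t^E(B))\to\mathfrak t^E(\mathrm{op}(A,B))$ such that $F^{\mathbb E_k^{nc}}(\theta)$ is an open pathwise-embedding. The twisted sum $A\bowtie B$ of $A\in\mathcal R_{nc}(\sigma_1^E)$ and $B\in\mathcal R_{nc}(\sigma_2^E)$ is the parallel sum on sort $\mathbf f$ (with $I$ treated like the relations of $\sigma$), has second sort $A_{\mathbf s}\times B_{\mathbf s}$, and $e=\{(\iota(a),(a',b')):e^A(a,a')\}\cup\{(\iota(b),(a',b')):e^B(b,b')\}$. For a word $w$ of $\mathbb E_k^{nc}(A\bowtie B)$ let $\mathrm{ex}_1(w)$ be the word obtained by keeping the letters $\iota(a)$ with $a\in A_{\mathbf f}$, replaced by $a$, and the letters $(a',b')$ of sort $\mathbf s$, replaced by $a'$; $\mathrm{ex}_2(w)$ is defined dually. Let $\kappa_{A,B}\colon\mathbb E_k^{nc}(A\bowtie B)\to\mathbb E_k^{nc}(A)\bowtie\mathbb E_k^{nc}(B)$ send constants to constants, a word $w$ of sort $\mathbf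 f$ to $\iota(\mathrm{ex}_1(w))$ if $\varepsilon(w)\in\iota(A_{\mathbf f})$ and to $\iota(\mathrm{ex}_2(w))$ otherwise, and a word $w$ of sort $\mathbf s$ to $(\mathrm{ex}_1(w),\mathrm{ex}_2(w))$. **Proposition.** 1. On the full subcategories of $\mathcal R_{nc}(\sigma_1^E)$ and $\mathcal R_{nc}(\sigma_2^E)$ of the structures in which no shared constant is interpreted by the same element as another constant (no condition if there are no shared constants), $\kappa$ is a well-defined natural transformation and a smooth Kleisli law $\mathbb E_k^{nc}\circ\bowtie\;\to\;\bowtie\circ(\mathbb E_k^{nc}\times\mathbb E_k^{nc})$. 2. For all $\sigma_1$-structures $A$ and $\sigma_2$-structures $B$, the map $\theta\colon\mathfrak t^E(A)\bowtie\mathfrak t^E(B)\to\mathfrak t^E(A\oplus B)$ that is the identity on sort $\mathbf f$ and $(M,M')\mapsto\iota(M)\cup\iota(M')$ on sort $\mathbf s$ is a morphism of $\mathcal R_{nc}(\sigma_3^E)$, and $F^{\mathbb E_k^{nc}}(\theta)$ is an open pathwise-embedding. 3. The operation $\oplus$, on all structures, is MSO-$\mathbb E_k^{nc}$-smooth. 4.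 If there are only finitely many shared constants, $\oplus$ preserves $\equiv_{\mathrm{MSO}_k}$: if $A\equiv_{\mathrm{MSO}_k}A'$ and $B\equiv_{\mathrm{MSO}_k}B'$, then $A\oplus B\equiv_{\mathrm{MSO}_k}A'\oplus B'$, where $\equiv_{\mathrm{MSO}_k}$ means satisfying the same monadic second-order sentences of quantifier rank at most $k$ (first-order and set quantifiers both counted). -/

import Mathlib

open CategoryTheory

universe u

/-! ## Many-sorted signatures, structures and the category of structures -/

/-- A many-sorted signature on a type `S` of sorts: relation symbols whose arity is a non-empty
tuple of sorts, and for every sort a set of constant symbols. -/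
structure MSig (S : Type) where
  Rel : Type u
  ar : Rel → ℕ
  ar_pos : ∀ R, 0 < ar R
  sort : ∀ R, Fin (ar R) → S
  Con : S → Type u

/-- A many-sorted `σ`-structure. The parameter `D` is a set of constant symbols: it is required
that a constant symbol in `D` is not interpreted by the same element as any other constant symbol.
For `D = ∅`, that is `D = fun _ => ∅`, nothing is required and one has all `σ`-structures. -/
structure MStr {S : Type} (σ : MSig.{u} S) (D : ∀ s, Set (σ.Con s)) where
  carrier : S → Type u
  con : ∀ s, σ.Con s → carrier s
  rel : ∀ R : σ.Rel, (∀ i, carrier (σ.sort R i)) → Prop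
  apart : ∀ s, ∀ c ∈ D s, ∀ d, con s c = con s d → c = d

namespace MStr

variable {S : Type} {σ : MSig.{u} S} {D : ∀ s, Set (σ.Con s)}

/-- An element is constant if it interprets a constant symbol. -/
def IsCon (A : MStr σ D) {s : S} (a : A.carrier s) : Prop := ∃ c, A.con s c = a

/-- The non-constant elements of sort `s`. -/
abbrev NC (A : MStr σ D) (s : S) : Type u := {a : A.carrier s // ¬ A.IsCon a}

/-- A letter `a : s` is a non-constant element together with its sort. -/
abbrev Letter (A : MStr σ D) : Type u := Σ s : S, A.NC s

/-- Homomorphisms which send non-constant elements to non-constant elements. -/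
@[ext]
structure Hom (A B : MStr σ D) where
  toFun : ∀ s, A.carrier s → B.carrier s
  map_con : ∀ s c, toFun s (A.con s c) = B.con s c
  map_rel : ∀ R x, A.rel R x → B.rel R (fun i => toFun _ (x i))
  map_nc : ∀ s a, ¬ A.IsCon a → ¬ B.IsCon (toFun s a)

/-- The category of `σ`-structures and of those homomorphisms that send non-constant elements to
non-constant elements. -/
instance : Category (MStr σ D) where
  Hom := Hom
  id A := ⟨fun _ a => a, fun _ _ => rfl, fun _ _ h => h, fun _ _ h => h⟩
  comp f g := ⟨fun s a => g.toFun s (f.toFun s a),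
    fun s c => by rw [f.map_con, g.map_con],
    fun R _ h => g.map_rel R _ (f.map_rel R _ h),
    fun s a h => g.map_nc s _ (f.map_nc s a h)⟩

@[ext]
theorem hom_ext {A B : MStr σ D} {f g : A ⟶ B} (h : ∀ s a, f.toFun s a = g.toFun s a) : f = g :=
  Hom.ext (funext fun s => funext fun a => h s a)

@[simp] theorem id_toFun (A : MStr σ D) (s : S) (a : A.carrier s) : Hom.toFun (𝟙 A) s a = a := rfl

@[simp] theorem comp_toFun {A B C : MStr σ D} (f : A ⟶ B) (g : B ⟶ C) (s : S) (a : A.carrier s) :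
    Hom.toFun (f ≫ g) s a = g.toFun s (f.toFun s a) := rfl

/-- Embeddings are the strong injective homomorphisms. -/
def IsEmb {A B : MStr σ D} (f : A ⟶ B) : Prop :=
  (∀ s, Function.Injective (f.toFun s)) ∧
    ∀ R x, B.rel R (fun i => f.toFun _ (x i)) → A.rel R x

/-- The action of a homomorphism on non-constant elements. -/
def Hom.onNC {A B : MStr σ D} (f : Hom A B) {s : S} (a : A.NC s) : B.NC s :=
  ⟨f.toFun s a.1, f.map_nc s a.1 a.2⟩

/-- The action of a homomorphism on letters. -/
def Hom.onLetter {A B : MStr σ D} (f : Hom A B) (x : A.Letter) : B.Letter :=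
  ⟨x.1, f.onNC x.2⟩

/-! ## The comonad of words of non-constants -/

/-- A word `[a₁ : s₁, …, aₙ : sₙ]` of non-constant letters with `1 ≤ n ≤ k` and `sₙ = s`, given by
its first `n - 1` letters and by its last letter `aₙ`. -/
@[ext]
structure Word (A : MStr σ D) (k : ℕ) (s : S) where
  init : List A.Letter
  last : A.NC s
  bound : init.length < k

namespace Word

variable {A B : MStr σ D} {k : ℕ} {s t : S}

/-- All the letters of a word. -/
def toList (w : A.Word k s) : List A.Letter := w.init ++ [⟨s, w.last⟩]

theorem length_toList (w : A.Word k s) : w.toList.length = w.init.length + 1 := by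
  simp [toList]

/-- Apply a homomorphism letter by letter. -/
def map (f : Hom A B) (w : A.Word k s) : B.Word k s :=
  ⟨w.init.map f.onLetter, f.onNC w.last, by simpa using w.bound⟩

theorem toList_map (f : Hom A B) (w : A.Word k s) :
    (w.map f).toList = w.toList.map f.onLetter := by
  simp [toList, map, Hom.onLetter]

end Word

/-- Two elements, each a constant symbol or a word, are comparable if one of them is a constant
symbol or they are words comparable in the prefix order. -/
def Comparable {A : MStr σ D} {k : ℕ} {s t : S} :
    σ.Con s ⊕ A.Word k s → σ.Con t ⊕ A.Word k t → Prop
  | Sum.inr v, Sum.inr w => v.toList <+: w.toList ∨ w.toList <+: v.toList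
  | _, _ => True

/-- The counit: a constant symbol goes to its interpretation, a word to its last letter. -/
def ekCounit (A : MStr σ D) (k : ℕ) (s : S) : σ.Con s ⊕ A.Word k s → A.carrier s
  | Sum.inl c => A.con s c
  | Sum.inr w => w.last.1

/-- The structure of words of length at most `k` in the non-constant elements, with the constant
symbols as additional elements. -/
def ek (k : ℕ) (A : MStr σ D) : MStr σ D where
  carrier s := σ.Con s ⊕ A.Word k s
  con _ c := Sum.inl c
  rel R x := (∀ i j, Comparable (x i) (x j)) ∧ A.rel R (fun i => A.ekCounit k _ (x i))
  apart _ _ _ _ h := Sum.inl_injective h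

theorem ek_not_isCon (k : ℕ) (A : MStr σ D) {s : S} (w : A.Word k s) :
    ¬ (A.ek k).IsCon (s := s) (Sum.inr w) := by
  rintro ⟨c, hc⟩
  exact Sum.inl_ne_inr hc

theorem ek_isCon_inl (k : ℕ) (A : MStr σ D) {s : S} (c : σ.Con s) :
    (A.ek k).IsCon (s := s) (Sum.inl c) := ⟨c, rfl⟩

/-- A word as a non-constant element of the structure of words. -/
def Word.nc {A : MStr σ D} {k : ℕ} {s : S} (w : A.Word k s) : (A.ek k).NC s :=
  ⟨Sum.inr w, ek_not_isCon k A w⟩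

/-- The prefix of length `i + 1` of a list of letters, as a letter. -/
def prefixLetter {A : MStr σ D} {k : ℕ} (L : List A.Letter) (i : ℕ) (h : i < L.length)
    (hL : L.length ≤ k) : (A.ek k).Letter :=
  ⟨(L[i]).1, Word.nc ⟨L.take i, (L[i]).2, by simp; omega⟩⟩

theorem prefixLetter_congr {A : MStr σ D} {k : ℕ} {L L' : List A.Letter} {i : ℕ}
    (h : i < L.length) (hL : L.length ≤ k) (h' : i < L'.length) (hL' : L'.length ≤ k)
    (he : L.take (i + 1) = L'.take (i + 1)) :
    prefixLetter L i h hL = prefixLetter L' i h' hL' := by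
  have h1 : L.take i = L'.take i := by
    have := congrArg (List.take i) he
    simpa [List.take_take] using this
  have h2 : L[i] = L'[i] := by
    have := congrArg (fun l => l[i]?) he
    simpa [List.getElem?_take, h, h'] using this
  unfold prefixLetter
  simp only [h1]
  rw! [h2]
  rfl

/-- The comultiplication on words: `[a₁, …, aₙ]` goes to `[[a₁], [a₁, a₂], …, [a₁, …, aₙ]]`. -/
def Word.dup {A : MStr σ D} {k : ℕ} {s : S} (w : A.Word k s) : (A.ek k).Word k s where
  init := List.ofFn fun i : Fin w.init.length =>
    prefixLetter w.init i.1 i.2 w.bound.le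
  last := w.nc
  bound := by simpa using w.bound

theorem prefixLetter_toList {A : MStr σ D} {k : ℕ} {s : S} (w : A.Word k s)
    (h : w.init.length < w.toList.length) (hL : w.toList.length ≤ k) :
    prefixLetter w.toList w.init.length h hL = ⟨s, w.nc⟩ := by
  have h1 : w.toList[w.init.length] = ⟨s, w.last⟩ := by simp [Word.toList]
  have h2 : w.toList.take w.init.length = w.init := by simp [Word.toList]
  unfold prefixLetter
  simp only [h2]
  rw! [h1]
  rfl

theorem prefixLetter_eq {A : MStr σ D} {k : ℕ} {s : S} (w : A.Word k s) {L : List A.Letter} {i : ℕ}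
    (h : i < L.length) (hL : L.length ≤ k) (hw : w.toList = L.take (i + 1)) :
    prefixLetter L i h hL = ⟨s, w.nc⟩ := by
  have hl : w.init.length = i := by
    have := congrArg List.length hw
    rw [Word.length_toList, List.length_take] at this
    omega
  subst hl
  rw [← prefixLetter_toList w (by simp [Word.length_toList])
    (by rw [Word.length_toList]; exact w.bound)]
  apply prefixLetter_congr
  rw [hw, List.take_take, min_self]

theorem Word.length_dup {A : MStr σ D} {k : ℕ} {s : S} (w : A.Word k s) :
    w.dup.toList.length = w.toList.length := by
  simp [Word.toList, Word.dup]

theorem Word.toList_le {A : MStr σ D} {k : ℕ} {s : S} (w : A.Word k s) :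
    w.toList.length ≤ k := by
  rw [Word.length_toList]; exact w.bound

theorem Word.getElem_dup {A : MStr σ D} {k : ℕ} {s : S} (w : A.Word k s) (i : ℕ)
    (h : i < w.dup.toList.length) :
    w.dup.toList[i] = prefixLetter w.toList i (w.length_dup ▸ h) w.toList_le := by
  have h' : i < w.init.length + 1 := by
    rw [length_dup, length_toList] at h; exact h
  by_cases hi : i < w.init.length
  · have : w.dup.toList[i] = prefixLetter w.init i hi w.bound.le := by
      simp [Word.toList, Word.dup, hi]
    rw [this]
    apply prefixLetter_congr
    simp [Word.toList, List.take_append_of_le_length (show i + 1 ≤ w.init.length from hi)]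
  · obtain rfl : i = w.init.length := by omega
    rw [prefixLetter_toList]
    simp [Word.toList, Word.dup]

theorem Word.take_dup {A : MStr σ D} {k : ℕ} {s t : S} (v : A.Word k s) (w : A.Word k t)
    (h : v.toList <+: w.toList) : v.dup.toList <+: w.dup.toList := by
  rw [List.prefix_iff_getElem]
  refine ⟨by rw [length_dup, length_dup]; exact h.length_le, fun i hi => ?_⟩
  rw [getElem_dup, getElem_dup]
  apply prefixLetter_congr
  rw [length_dup] at hi
  obtain ⟨l, hl⟩ := h
  rw [← hl, List.take_append_of_le_length hi]

theorem Word.toList_inj {A : MStr σ D} {k : ℕ} {s : S} {v w : A.Word k s}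
    (h : v.toList = w.toList) : v = w := by
  unfold Word.toList at h
  have := List.append_inj' h rfl
  apply Word.ext this.1
  simpa using this.2

theorem Comparable.map {A B : MStr σ D} {k : ℕ} (f : Hom A B) {s t : S}
    (a : σ.Con s ⊕ A.Word k s) (b : σ.Con t ⊕ A.Word k t) (h : Comparable a b) :
    Comparable (Sum.map id (Word.map f) a) (Sum.map id (Word.map f) b) := by
  rcases a with a | a <;> rcases b with b | b <;> try trivial
  simp only [Comparable, Sum.map_inr, Word.toList_map]
  exact Or.imp (fun h => h.map _) (fun h => h.map _) h

theorem Comparable.dup {A : MStr σ D} {k : ℕ} {s t : S}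
    (a : σ.Con s ⊕ A.Word k s) (b : σ.Con t ⊕ A.Word k t) (h : Comparable a b) :
    Comparable (Sum.map id Word.dup a) (Sum.map id Word.dup b) := by
  rcases a with a | a <;> rcases b with b | b <;> try trivial
  exact Or.imp (fun h => Word.take_dup _ _ h) (fun h => Word.take_dup _ _ h) h

/-- The action of the comonad on homomorphisms: apply `f` to every letter. -/
def ekMap (k : ℕ) {A B : MStr σ D} (f : A ⟶ B) : A.ek k ⟶ B.ek k where
  toFun _ x := Sum.map id (Word.map f) x
  map_con _ _ := rfl
  map_rel R x h := by
    refine ⟨fun i j => (h.1 i j).map f, ?_⟩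
    have he : ∀ s (a : σ.Con s ⊕ A.Word k s),
        B.ekCounit k s (Sum.map id (Word.map f) a) = f.toFun s (A.ekCounit k s a) := by
      rintro s (a | a)
      · exact (f.map_con _ _).symm
      · rfl
    exact (congrArg (B.rel R) (funext fun i => he _ (x i))).mpr (f.map_rel R _ h.2)
  map_nc s a h := by
    rcases a with a | a
    · exact absurd (ek_isCon_inl k A a) h
    · exact ek_not_isCon k B _

/-- The counit. -/
def ekε (k : ℕ) (A : MStr σ D) : A.ek k ⟶ A where
  toFun s x := A.ekCounit k s x
  map_con _ _ := rfl
  map_rel _ _ h := h.2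
  map_nc s a h := by
    rcases a with a | a
    · exact absurd (ek_isCon_inl k A a) h
    · exact a.last.2

/-- The comultiplication. -/
def ekδ (k : ℕ) (A : MStr σ D) : A.ek k ⟶ (A.ek k).ek k where
  toFun _ x := Sum.map id Word.dup x
  map_con _ _ := rfl
  map_rel R x h := by
    refine ⟨fun i j => (h.1 i j).dup, ?_⟩
    have he : ∀ s (a : σ.Con s ⊕ A.Word k s),
        (A.ek k).ekCounit k s (Sum.map id Word.dup a) = a := by
      rintro s (a | a) <;> rfl
    exact (congrArg ((A.ek k).rel R) (funext fun i => he _ (x i))).mpr h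
  map_nc s a h := by
    rcases a with a | a
    · exact absurd (ek_isCon_inl k A a) h
    · exact ek_not_isCon k (A.ek k) _

theorem onLetter_prefixLetter {k : ℕ} {A B : MStr σ D} (f : A ⟶ B) (L : List A.Letter) (i : ℕ)
    (h : i < L.length) (hL : L.length ≤ k) :
    Hom.onLetter (ekMap k f) (prefixLetter L i h hL) =
      prefixLetter (L.map f.onLetter) i (by simpa using h) (by simpa using hL) := by
  symm
  apply prefixLetter_eq (Word.map f ⟨L.take i, (L[i]).2, by simp; omega⟩)
  rw [Word.toList_map]
  simp [Word.toList]

theorem onLetter_prefixLetter_ε {k : ℕ} {A : MStr σ D} (L : List A.Letter) (i : ℕ)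
    (h : i < L.length) (hL : L.length ≤ k) :
    Hom.onLetter (ekε k A) (prefixLetter L i h hL) = L[i] := rfl

theorem onLetter_prefixLetter_δ {k : ℕ} {A : MStr σ D} {s : S} (w : A.Word k s) (i : ℕ)
    (h : i < w.toList.length) (hL : w.toList.length ≤ k) :
    Hom.onLetter (ekδ k A) (prefixLetter w.toList i h hL) =
      prefixLetter w.dup.toList i (by rwa [Word.length_dup]) (by rwa [Word.length_dup]) := by
  symm
  have hl : (Word.toList (⟨w.toList.take i, (w.toList[i]).2, by simp; omega⟩ :
      A.Word k _)) = w.toList.take (i + 1) := by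
    rw [← List.take_append_getElem h]; rfl
  apply prefixLetter_eq (Word.dup ⟨w.toList.take i, (w.toList[i]).2, by simp; omega⟩)
  apply List.ext_getElem
  · rw [Word.length_dup, hl]
    simp [Word.length_dup]
  · intro j h1 h2
    rw [List.getElem_take, Word.getElem_dup, Word.getElem_dup]
    apply prefixLetter_congr
    rw [hl, List.take_take]
    congr 1
    simp at h2
    omega

variable (σ D) in
/-- The comonad of words of length at most `k` without constant letters, on the category of
`σ`-structures and of homomorphisms that send non-constant elements to non-constant elements. -/
def Ek (k : ℕ) : Comonad (MStr σ D) where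
  obj A := A.ek k
  map f := ekMap k f
  map_id A := by
    ext s a
    rcases a with a | a
    · rfl
    · refine congrArg Sum.inr (Word.toList_inj ?_)
      rw [Word.toList_map]
      exact List.map_id _
  map_comp f g := by
    ext s a
    rcases a with a | a
    · rfl
    · refine congrArg Sum.inr (Word.toList_inj ?_)
      rw [Word.toList_map, Word.toList_map, Word.toList_map, List.map_map]
      rfl
  ε :=
    { app := fun A => ekε k A
      naturality := fun A B f => by
        ext s a
        rcases a with a | a
        · exact (f.map_con _ _).symm
        · rfl }
  δ :=
    { app := fun A => ekδ k A
      naturality := fun A B f => by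
        ext s a
        rcases a with a | a
        · rfl
        · refine congrArg Sum.inr (Word.toList_inj ?_)
          apply List.ext_getElem
          · rw [Word.length_dup, Word.toList_map, Word.toList_map, List.length_map,
              List.length_map, Word.length_dup]
          · intro i h1 h2
            simp only [Word.getElem_dup, Word.toList_map, List.getElem_map]
            exact (onLetter_prefixLetter f _ _ _ _).symm }
  coassoc A := by
    ext s a
    rcases a with a | a
    · rfl
    · refine congrArg Sum.inr (Word.toList_inj ?_)
      apply List.ext_getElem
      · rw [Word.length_dup, Word.toList_map, List.length_map]
      · intro i h1 h2
        simp only [Word.getElem_dup, Word.toList_map, List.getElem_map]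
        exact onLetter_prefixLetter_δ _ _ _ _
  left_counit A := by
    ext s a
    rcases a with a | a <;> rfl
  right_counit A := by
    ext s a
    rcases a with a | a
    · rfl
    · refine congrArg Sum.inr (Word.toList_inj ?_)
      apply List.ext_getElem
      · rw [Word.toList_map, List.length_map, Word.length_dup]
      · intro i h1 h2
        simp only [Word.getElem_dup, Word.toList_map, List.getElem_map]
        rfl

end MStr

/-! ## Open pathwise-embeddings, Kleisli laws and smoothness -/

section Abstract

universe v₁ v₂ v₃ u₁ u₂ u₃ w₁ w₂ w₃

/-- A class of embeddings and a class of paths on a category. -/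
structure PathData (E : Type u₁) [Category.{v₁} E] where
  emb : MorphismProperty E
  path : ObjectProperty E

/-- `f` is an open pathwise-embedding: its composite with every path embedding is an embedding,
and every commutative square of path embeddings over `f` has a diagonal filler. -/
def PathData.IsOpenPathwiseEmb {E : Type u₁} [Category.{v₁} E] (p : PathData E) {X Y : E}
    (f : X ⟶ Y) : Prop :=
  (∀ ⦃P : E⦄ (e : P ⟶ X), p.path P → p.emb e → p.emb (e ≫ f)) ∧
    ∀ ⦃P Q : E⦄ (h : P ⟶ Q) (e : P ⟶ X) (g : Q ⟶ Y), p.path P → p.path Q →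
      p.emb h → p.emb e → p.emb g → e ≫ f = h ≫ g → ∃ d : Q ⟶ X, h ≫ d = e ∧ d ≫ f = g

variable {C₁ : Type u₁} [Category.{v₁} C₁] {C₂ : Type u₂} [Category.{v₂} C₂]
  {C₃ : Type u₃} [Category.{v₃} C₃]

/-- A natural transformation of the type of a Kleisli law for the binary operation `H`. -/
abbrev KleisliTrans (G₁ : Comonad C₁) (G₂ : Comonad C₂) (G₃ : Comonad C₃) (H : C₁ × C₂ ⥤ C₃) :=
  H ⋙ G₃.toFunctor ⟶ (G₁.toFunctor.prod G₂.toFunctor) ⋙ H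

variable {G₁ : Comonad C₁} {G₂ : Comonad C₂} {G₃ : Comonad C₃} {H : C₁ × C₂ ⥤ C₃}

/-- The component of `κ` at the pair `(A, B)`. -/
abbrev KleisliTrans.at (κ : KleisliTrans G₁ G₂ G₃ H) (A : C₁) (B : C₂) :
    G₃.obj (H.obj (A, B)) ⟶ H.obj (G₁.obj A, G₂.obj B) := κ.app (A, B)

/-- The two axioms of Kleisli laws: compatibility with counits and comultiplications. -/
structure KleisliTrans.IsKleisliLaw (κ : KleisliTrans G₁ G₂ G₃ H) : Prop where
  counit : ∀ A B, κ.at A B ≫ H.map (Prod.mkHom (G₁.ε.app A) (G₂.ε.app B)) =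
    G₃.ε.app (H.obj (A, B))
  comult : ∀ A B, κ.at A B ≫ H.map (Prod.mkHom (G₁.δ.app A) (G₂.δ.app B)) =
    G₃.δ.app (H.obj (A, B)) ≫ G₃.map (κ.at A B) ≫ κ.at (G₁.obj A) (G₂.obj B)

/-- The comultiplication, as a morphism of cofree coalgebras. -/
def cofreeComult (G : Comonad C₃) (X : C₃) : G.cofree.obj X ⟶ G.cofree.obj (G.obj X) :=
  Comonad.Coalgebra.Hom.mk (A := G.cofree.obj X) (B := G.cofree.obj (G.obj X)) (G.δ.app X)
    (G.coassoc X)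

/-- The first of the two parallel morphisms whose equaliser is the lift of `H` to coalgebras. -/
def KleisliTrans.liftLeft (κ : KleisliTrans G₁ G₂ G₃ H) (α : G₁.Coalgebra) (β : G₂.Coalgebra) :
    G₃.cofree.obj (H.obj (α.A, β.A)) ⟶ G₃.cofree.obj (H.obj (G₁.obj α.A, G₂.obj β.A)) :=
  cofreeComult G₃ (H.obj (α.A, β.A)) ≫ G₃.cofree.map (κ.at α.A β.A)

/-- The second of the two parallel morphisms whose equaliser is the lift of `H` to coalgebras. -/
def KleisliTrans.liftRight (_ : KleisliTrans G₁ G₂ G₃ H) (α : G₁.Coalgebra) (β : G₂.Coalgebra) :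
    G₃.cofree.obj (H.obj (α.A, β.A)) ⟶ G₃.cofree.obj (H.obj (G₁.obj α.A, G₂.obj β.A)) :=
  G₃.cofree.map (H.map (Prod.mkHom α.a β.a))

/-- `κ` is a smooth Kleisli law: it is a Kleisli law, the equalisers that define the lift of `H` to
categories of coalgebras exist, and the lift sends pairs of open pathwise-embeddings to open
pathwise-embeddings. Here `s` and `t` are the lift of `H` at `(α, β)` and `(α', β')`, and `l` is
the lift of `H` at `(f, g)`. -/
structure KleisliTrans.IsSmooth (κ : KleisliTrans G₁ G₂ G₃ H) (p₁ : PathData G₁.Coalgebra)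
    (p₂ : PathData G₂.Coalgebra) (p₃ : PathData G₃.Coalgebra) : Prop where
  isKleisliLaw : κ.IsKleisliLaw
  hasEqualizer : ∀ α β, Limits.HasEqualizer (κ.liftLeft α β) (κ.liftRight α β)
  smooth : ∀ {α α' : G₁.Coalgebra} {β β' : G₂.Coalgebra} (f : α ⟶ α') (g : β ⟶ β'),
    p₁.IsOpenPathwiseEmb f → p₂.IsOpenPathwiseEmb g →
    ∀ (s : Limits.Fork (κ.liftLeft α β) (κ.liftRight α β))
      (t : Limits.Fork (κ.liftLeft α' β') (κ.liftRight α' β')),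
      Nonempty (Limits.IsLimit s) → Nonempty (Limits.IsLimit t) →
      ∀ l : s.pt ⟶ t.pt, l ≫ t.ι = s.ι ≫ G₃.cofree.map (H.map (Prod.mkHom f.f g.f)) →
        p₃.IsOpenPathwiseEmb l

/-- The binary operation `op` is `(G₁, G₂, G₃)`-smooth relative to the translations `tr₁`, `tr₂`,
`tr₃`. The translations are functors on discrete categories and `θ` is a natural transformation
between functors on a discrete category, that is, they are just families. -/
def IsSmoothRelativeTo {X₁ : Type w₁} {X₂ : Type w₂} {X₃ : Type w₃} (op : X₁ → X₂ → X₃)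
    (tr₁ : X₁ → C₁) (tr₂ : X₂ → C₂) (tr₃ : X₃ → C₃)
    (G₁ : Comonad C₁) (G₂ : Comonad C₂) (G₃ : Comonad C₃) (p₁ : PathData G₁.Coalgebra)
    (p₂ : PathData G₂.Coalgebra) (p₃ : PathData G₃.Coalgebra) : Prop :=
  ∃ (H : C₁ × C₂ ⥤ C₃) (θ : ∀ a b, H.obj (tr₁ a, tr₂ b) ⟶ tr₃ (op a b))
    (κ : KleisliTrans G₁ G₂ G₃ H),
    κ.IsSmooth p₁ p₂ p₃ ∧ ∀ a b, p₃.IsOpenPathwiseEmb (G₃.cofree.map (θ a b))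

end Abstract

namespace MStr

variable {S : Type} {σ : MSig.{u} S} {D : ∀ s, Set (σ.Con s)}

/-- The order on the non-constant elements of a coalgebra: `x ⊑ y` if the word assigned to `x` is
a prefix of the word assigned to `y`. -/
def coalgLE {k : ℕ} (P : (Ek σ D k).Coalgebra) (x y : P.A.Letter) : Prop :=
  ∃ (v : P.A.Word k x.1) (w : P.A.Word k y.1),
    P.a.toFun x.1 x.2.1 = Sum.inr v ∧ P.a.toFun y.1 y.2.1 = Sum.inr w ∧ v.toList <+: w.toList

/-- Embeddings of coalgebras are the coalgebra morphisms whose underlying homomorphism is strong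
and injective. Paths are the coalgebras for which the partial order on the non-constant elements is
a finite linear order. -/
def ekPathData (σ : MSig.{u} S) (D : ∀ s, Set (σ.Con s)) (k : ℕ) :
    PathData (Ek σ D k).Coalgebra where
  emb _ _ f := IsEmb f.f
  path P := Finite P.A.Letter ∧ ∀ x y : P.A.Letter, coalgLE P x y ∨ coalgLE P y x

end MStr

/-! ## Single-sorted structures and monadic second-order logic -/

/-- A relational signature without constants. -/
structure RSig where
  Rel : Type u
  ar : Rel → ℕ
  ar_pos : ∀ R, 0 < ar R

/-- A structure for the extension of the relational signature `L` by a set `C` of constants. -/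
structure Str (L : RSig.{u}) (C : Type u) where
  carrier : Type u
  con : C → carrier
  rel : ∀ R : L.Rel, (Fin (L.ar R) → carrier) → Prop

/-- Formulas of monadic second-order logic with `n` free first-order variables and `m` free set
variables. Terms are variables and constants. -/
inductive MSO (L : RSig.{u}) (C : Type u) : ℕ → ℕ → Type u
  | falsum {n m : ℕ} : MSO L C n m
  | eq {n m : ℕ} (t t' : Fin n ⊕ C) : MSO L C n m
  | mem {n m : ℕ} (t : Fin n ⊕ C) (X : Fin m) : MSO L C n m
  | rel {n m : ℕ} (R : L.Rel) (t : Fin (L.ar R) → Fin n ⊕ C) : MSO L C n m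
  | neg {n m : ℕ} (φ : MSO L C n m) : MSO L C n m
  | and {n m : ℕ} (φ ψ : MSO L C n m) : MSO L C n m
  | ex {n m : ℕ} (φ : MSO L C (n + 1) m) : MSO L C n m
  | exSet {n m : ℕ} (φ : MSO L C n (m + 1)) : MSO L C n m

namespace MSO

variable {L : RSig.{u}} {C : Type u}

/-- The quantifier rank, counting first-order and set quantifiers. -/
def rank : ∀ {n m : ℕ}, MSO L C n m → ℕ
  | _, _, falsum => 0
  | _, _, eq _ _ => 0
  | _, _, mem _ _ => 0
  | _, _, rel _ _ => 0
  | _, _, neg φ => φ.rank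
  | _, _, and φ ψ => max φ.rank ψ.rank
  | _, _, ex φ => φ.rank + 1
  | _, _, exSet φ => φ.rank + 1

/-- Satisfaction, for an assignment `v` of the first-order variables and `V` of the set variables;
the variable bound by a quantifier has index `0` in its scope. -/
def Sat (A : Str L C) :
    ∀ {n m : ℕ}, MSO L C n m → (Fin n → A.carrier) → (Fin m → Set A.carrier) → Prop
  | _, _, falsum, _, _ => False
  | _, _, eq t t', v, _ => Sum.elim v A.con t = Sum.elim v A.con t'
  | _, _, mem t X, v, V => Sum.elim v A.con t ∈ V X
  | _, _, rel R t, v, _ => A.rel R (fun i => Sum.elim v A.con (t i))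
  | _, _, neg φ, v, V => ¬ Sat A φ v V
  | _, _, and φ ψ, v, V => Sat A φ v V ∧ Sat A ψ v V
  | n, _, ex φ, v, V => ∃ a, Sat A φ (Fin.cons a v : Fin (n + 1) → A.carrier) V
  | _, m, exSet φ, v, V => ∃ M, Sat A φ v (Fin.cons M V : Fin (m + 1) → Set A.carrier)

end MSO

/-- `A` and `B` satisfy the same sentences of monadic second-order logic of rank at most `k`. -/
def MSOEquiv {L : RSig.{u}} {C : Type u} (k : ℕ) (A B : Str L C) : Prop :=
  ∀ φ : MSO L C 0 0, φ.rank ≤ k → (φ.Sat A Fin.elim0 Fin.elim0 ↔ φ.Sat B Fin.elim0 Fin.elim0)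

/-! ## The two-sorted translation -/

/-- The sort of first-order elements and the sort of sets. -/
inductive Sort2
  | fst
  | snd

/-- The relation symbols of the two-sorted signature: the given ones, equality on the first sort,
and membership. -/
inductive ERel (L : RSig.{u}) : Type u
  | base (R : L.Rel)
  | eq
  | mem

/-- The two-sorted signature for monadic second-order logic on the extension of `L` by the
constants `C`. -/
abbrev RSig.E (L : RSig.{u}) (C : Type u) : MSig.{u} Sort2 where
  Rel := ERel L
  ar
    | .base R => L.ar R
    | .eq => 2
    | .mem => 2
  ar_pos
    | .base R => L.ar_pos R
    | .eq => two_pos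
    | .mem => two_pos
  sort
    | .base _ => fun _ => .fst
    | .eq => fun _ => .fst
    | .mem => ![.fst, .snd]
  Con
    | .fst => C
    | .snd => PEmpty

/-- The standard two-sorted model: the second sort is the powerset of the first one. -/
def Str.E {L : RSig.{u}} {C : Type u} (A : Str L C) : MStr (L.E C) (fun _ => ∅) where
  carrier
    | .fst => A.carrier
    | .snd => Set A.carrier
  con
    | .fst => A.con
    | .snd => PEmpty.elim
  rel
    | .base R => fun x => A.rel R x
    | .eq => fun x => x 0 = x 1
    | .mem => fun x => (show A.carrier from x 0) ∈ (show Set A.carrier from x 1)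
  apart _ _ h := h.elim

/-- `op` is smooth for monadic second-order logic and the comonads of words without constants:
it is smooth relative to the two-sorted translations. -/
def IsMSOEkSmooth (k : ℕ) {L₁ L₂ L₃ : RSig.{u}} {C₁ C₂ C₃ : Type u}
    (op : Str L₁ C₁ → Str L₂ C₂ → Str L₃ C₃) : Prop :=
  IsSmoothRelativeTo op Str.E Str.E Str.E
    (MStr.Ek (L₁.E C₁) (fun _ => ∅) k) (MStr.Ek (L₂.E C₂) (fun _ => ∅) k)
    (MStr.Ek (L₃.E C₃) (fun _ => ∅) k)
    (MStr.ekPathData _ _ k) (MStr.ekPathData _ _ k) (MStr.ekPathData _ _ k)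

/-! ## Gluing along shared constants and the parallel sum -/

section Glue

variable {N : Type u} {C₁ C₂ : Set N} {X Y : Type u} (c₁ : C₁ → X) (c₂ : C₂ → Y)

/-- The pairs of interpretations of a shared constant. -/
inductive GlueRel : X ⊕ Y → X ⊕ Y → Prop
  | glue (c : N) (h₁ : c ∈ C₁) (h₂ : c ∈ C₂) : GlueRel (Sum.inl (c₁ ⟨c, h₁⟩)) (Sum.inr (c₂ ⟨c, h₂⟩))

/-- The quotient of the disjoint union of `X` and `Y` by the least equivalence relation that
identifies the two interpretations of every shared constant. -/
def Glue : Type u := Quot (GlueRel c₁ c₂)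

namespace Glue

variable {c₁ c₂}

/-- The map from the first component into the quotient. -/
def inc₁ (a : X) : Glue c₁ c₂ := Quot.mk _ (Sum.inl a)

/-- The map from the second component into the quotient. -/
def inc₂ (b : Y) : Glue c₁ c₂ := Quot.mk _ (Sum.inr b)

theorem glue (c : N) (h₁ : c ∈ C₁) (h₂ : c ∈ C₂) :
    (inc₁ (c₁ ⟨c, h₁⟩) : Glue c₁ c₂) = inc₂ (c₂ ⟨c, h₂⟩) := Quot.sound (.glue c h₁ h₂)

theorem exists_inc (x : Glue c₁ c₂) : (∃ a, inc₁ a = x) ∨ ∃ b, inc₂ b = x := by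
  obtain ⟨a | b, rfl⟩ := Quot.exists_rep x
  · exact Or.inl ⟨a, rfl⟩
  · exact Or.inr ⟨b, rfl⟩

variable (c₁ c₂) in
open Classical in
/-- The interpretation of constants in the quotient. -/
noncomputable def con (c : ↥(C₁ ∪ C₂)) : Glue c₁ c₂ :=
  if h : c.1 ∈ C₁ then inc₁ (c₁ ⟨c, h⟩) else inc₂ (c₂ ⟨c, c.2.resolve_left h⟩)

theorem con_left (c : N) (h : c ∈ C₁) : con c₁ c₂ ⟨c, Or.inl h⟩ = inc₁ (c₁ ⟨c, h⟩) := by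
  simp [con, h]

theorem con_right (c : N) (h : c ∈ C₂) : con c₁ c₂ ⟨c, Or.inr h⟩ = inc₂ (c₂ ⟨c, h⟩) := by
  by_cases h' : c ∈ C₁
  · rw [← glue c h' h, ← con_left c h']
  · simp [con, h']

theorem isCon_inc₁ {a : X} : (∃ c, con c₁ c₂ c = inc₁ a) ↔ ∃ c, c₁ c = a := by
  constructor
  · let p : Glue c₁ c₂ → Prop := Quot.lift
      (Sum.elim (fun a => ∃ c, c₁ c = a) (fun b => ∃ c, c₂ c = b)) (by
        rintro _ _ ⟨c, h₁, h₂⟩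
        exact propext ⟨fun _ => ⟨_, rfl⟩, fun _ => ⟨_, rfl⟩⟩)
    rintro ⟨⟨c, hc | hc⟩, h⟩
    · have : p (inc₁ a) := by rw [← h, con_left c hc]; exact ⟨_, rfl⟩
      exact this
    · have : p (inc₁ a) := by rw [← h, con_right c hc]; exact ⟨_, rfl⟩
      exact this
  · rintro ⟨c, rfl⟩
    exact ⟨_, con_left c.1 c.2⟩

theorem isCon_inc₂ {b : Y} : (∃ c, con c₁ c₂ c = inc₂ b) ↔ ∃ c, c₂ c = b := by
  constructor
  · let p : Glue c₁ c₂ → Prop := Quot.lift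
      (Sum.elim (fun a => ∃ c, c₁ c = a) (fun b => ∃ c, c₂ c = b)) (by
        rintro _ _ ⟨c, h₁, h₂⟩
        exact propext ⟨fun _ => ⟨_, rfl⟩, fun _ => ⟨_, rfl⟩⟩)
    rintro ⟨⟨c, hc | hc⟩, h⟩
    · have : p (inc₂ b) := by rw [← h, con_left c hc]; exact ⟨_, rfl⟩
      exact this
    · have : p (inc₂ b) := by rw [← h, con_right c hc]; exact ⟨_, rfl⟩
      exact this
  · rintro ⟨c, rfl⟩
    exact ⟨_, con_right c.1 c.2⟩

/-- The map between quotients that is induced by maps preserving the constants. -/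
def map {X' Y' : Type u} {c₁' : C₁ → X'} {c₂' : C₂ → Y'} (f : X → X') (g : Y → Y')
    (hf : ∀ c, f (c₁ c) = c₁' c) (hg : ∀ c, g (c₂ c) = c₂' c) : Glue c₁ c₂ → Glue c₁' c₂' :=
  Quot.map (Sum.map f g) (by
    rintro _ _ ⟨c, h₁, h₂⟩
    simp only [Sum.map_inl, Sum.map_inr, hf, hg]
    exact .glue c h₁ h₂)

end Glue

end Glue

/-- The parallel sum: the disjoint union with shared constants glued. A tuple is related if it is
the image of a related tuple of one of the two components. -/
noncomputable def oplus {L : RSig.{u}} {N : Type u} {C₁ C₂ : Set N} (A : Str L C₁) (B : Str L C₂) :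
    Str L ↥(C₁ ∪ C₂) where
  carrier := Glue A.con B.con
  con := Glue.con A.con B.con
  rel R x := (∃ a, A.rel R a ∧ ∀ i, Glue.inc₁ (a i) = x i) ∨
    ∃ b, B.rel R b ∧ ∀ i, Glue.inc₂ (b i) = x i

/-! ## The twisted sum -/

namespace TwistedSum

variable {L : RSig.{u}} {N : Type u} {C₁ C₂ : Set N}
  {D₁ : ∀ s, Set ((L.E C₁).Con s)} {D₂ : ∀ s, Set ((L.E C₂).Con s)}

/-- The twisted sum of two structures: the parallel sum on the first sort, the product on the
second sort. -/
noncomputable def obj (A : MStr (L.E C₁) D₁) (B : MStr (L.E C₂) D₂) :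
    MStr (L.E ↥(C₁ ∪ C₂)) (fun _ => ∅) where
  carrier
    | .fst => Glue (C₁ := C₁) (C₂ := C₂) (A.con .fst) (B.con .fst)
    | .snd => A.carrier .snd × B.carrier .snd
  con
    | .fst => Glue.con (C₁ := C₁) (C₂ := C₂) (A.con .fst) (B.con .fst)
    | .snd => PEmpty.elim
  rel
    | .base R => fun x => (∃ a, A.rel (.base R) a ∧ ∀ i, Glue.inc₁ (a i) = x i) ∨
        ∃ b, B.rel (.base R) b ∧ ∀ i, Glue.inc₂ (b i) = x i
    | .eq => fun x => (∃ a, A.rel .eq a ∧ ∀ i, Glue.inc₁ (a i) = x i) ∨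
        ∃ b, B.rel .eq b ∧ ∀ i, Glue.inc₂ (b i) = x i
    | .mem => fun x => (∃ a, A.rel .mem a ∧ Glue.inc₁ (a 0) = x 0 ∧ a 1 = (x 1).1) ∨
        ∃ b, B.rel .mem b ∧ Glue.inc₂ (b 0) = x 0 ∧ b 1 = (x 1).2
  apart _ _ h := h.elim

/-- The action of the twisted sum on elements. -/
def mapFun {A A' : MStr (L.E C₁) D₁} {B B' : MStr (L.E C₂) D₂} (f : A ⟶ A') (g : B ⟶ B') :
    ∀ s, (obj A B).carrier s → (obj A' B').carrier s
  | .fst => Glue.map (f.toFun .fst) (g.toFun .fst) (f.map_con .fst) (g.map_con .fst)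
  | .snd => Prod.map (f.toFun .snd) (g.toFun .snd)

variable (L C₁ C₂ D₁ D₂) in
/-- The twisted sum, as a functor. -/
noncomputable def functor :
    MStr (L.E C₁) D₁ × MStr (L.E C₂) D₂ ⥤ MStr (L.E ↥(C₁ ∪ C₂)) (fun _ => ∅) where
  obj P := obj P.1 P.2
  map {P Q} f :=
    { toFun := mapFun f.1 f.2
      map_con := by
        rintro (_ | _) c
        · obtain ⟨c, hc | hc⟩ := c
          · refine (congrArg _ (Glue.con_left c hc)).trans
              (Eq.trans ?_ (Glue.con_left c hc).symm)
            exact congrArg Glue.inc₁ (f.1.map_con .fst ⟨c, hc⟩)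
          · refine (congrArg _ (Glue.con_right c hc)).trans
              (Eq.trans ?_ (Glue.con_right c hc).symm)
            exact congrArg Glue.inc₂ (f.2.map_con .fst ⟨c, hc⟩)
        · exact c.elim
      map_rel := by
        rintro (R | _ | _) x
        · rintro (⟨a, ha, hx⟩ | ⟨b, hb, hx⟩)
          · exact Or.inl ⟨_, f.1.map_rel _ a ha, fun i =>
              congrArg (mapFun f.1 f.2 .fst) (hx i)⟩
          · exact Or.inr ⟨_, f.2.map_rel _ b hb, fun i =>
              congrArg (mapFun f.1 f.2 .fst) (hx i)⟩
        · rintro (⟨a, ha, hx⟩ | ⟨b, hb, hx⟩)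
          · exact Or.inl ⟨_, f.1.map_rel _ a ha, fun i =>
              congrArg (mapFun f.1 f.2 .fst) (hx i)⟩
          · exact Or.inr ⟨_, f.2.map_rel _ b hb, fun i =>
              congrArg (mapFun f.1 f.2 .fst) (hx i)⟩
        · rintro (⟨a, ha, h₀, h₁⟩ | ⟨b, hb, h₀, h₁⟩)
          · exact Or.inl ⟨_, f.1.map_rel _ a ha,
              congrArg (mapFun f.1 f.2 .fst) h₀, congrArg (f.1.toFun .snd) h₁⟩
          · exact Or.inr ⟨_, f.2.map_rel _ b hb,
              congrArg (mapFun f.1 f.2 .fst) h₀, congrArg (f.2.toFun .snd) h₁⟩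
      map_nc := by
        rintro (_ | _) x hx
        · obtain ⟨a, rfl⟩ | ⟨b, rfl⟩ := Glue.exists_inc x
          · exact fun h => f.1.map_nc .fst a (fun h' => hx (Glue.isCon_inc₁.mpr h'))
              (Glue.isCon_inc₁.mp h)
          · exact fun h => f.2.map_nc .fst b (fun h' => hx (Glue.isCon_inc₂.mpr h'))
              (Glue.isCon_inc₂.mp h)
        · exact fun ⟨c, _⟩ => c.elim }
  map_id P := by
    ext (_ | _) x
    · obtain ⟨a, rfl⟩ | ⟨b, rfl⟩ := Glue.exists_inc x <;> rfl
    · rfl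
  map_comp f g := by
    ext (_ | _) x
    · obtain ⟨a, rfl⟩ | ⟨b, rfl⟩ := Glue.exists_inc x <;> rfl
    · rfl

/-! The Kleisli law of the twisted sum. -/

variable {A : MStr (L.E C₁) D₁} {B : MStr (L.E C₂) D₂}

variable (A B) in
/-- The map from the first sort of `A` into the twisted sum. -/
def incA (a : A.carrier .fst) : (obj A B).carrier .fst :=
  (Glue.inc₁ a : Glue (C₁ := C₁) (C₂ := C₂) (A.con .fst) (B.con .fst))

variable (A B) in
/-- The map from the first sort of `B` into the twisted sum. -/
def incB (b : B.carrier .fst) : (obj A B).carrier .fst :=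
  (Glue.inc₂ b : Glue (C₁ := C₁) (C₂ := C₂) (A.con .fst) (B.con .fst))

theorem exists_inc (x : (obj A B).carrier .fst) : (∃ a, incA A B a = x) ∨ ∃ b, incB A B b = x :=
  Glue.exists_inc (C₁ := C₁) (C₂ := C₂) (c₁ := A.con .fst) (c₂ := B.con .fst) x

theorem isCon_incA {a : A.carrier .fst} : (obj A B).IsCon (incA A B a) ↔ A.IsCon a :=
  Glue.isCon_inc₁ (C₁ := C₁) (C₂ := C₂) (c₁ := A.con .fst) (c₂ := B.con .fst)

theorem isCon_incB {b : B.carrier .fst} : (obj A B).IsCon (incB A B b) ↔ B.IsCon b :=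
  Glue.isCon_inc₂ (C₁ := C₁) (C₂ := C₂) (c₁ := A.con .fst) (c₂ := B.con .fst)

/-- A non-constant element `x` of the first sort of the twisted sum which comes from `A`, as an
element of `A`. -/
noncomputable def left (x : (obj A B).NC .fst) (h : ∃ a, incA A B a = x.1) : A.NC .fst :=
  ⟨h.choose, fun hc => x.2 (h.choose_spec ▸ isCon_incA.mpr hc)⟩

/-- A non-constant element `x` of the first sort of the twisted sum which comes from `B`, as an
element of `B`. -/
noncomputable def right (x : (obj A B).NC .fst) (h : ∃ b, incB A B b = x.1) : B.NC .fst :=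
  ⟨h.choose, fun hc => x.2 (h.choose_spec ▸ isCon_incB.mpr hc)⟩

/-- The first component of an element of the second sort of the twisted sum. -/
def fstSet (x : (obj A B).NC .snd) : A.NC .snd := ⟨x.1.1, fun ⟨c, _⟩ => c.elim⟩

/-- The second component of an element of the second sort of the twisted sum. -/
def sndSet (x : (obj A B).NC .snd) : B.NC .snd := ⟨x.1.2, fun ⟨c, _⟩ => c.elim⟩

open Classical in
/-- The letter of `A` that is extracted from a letter of the twisted sum, if there is one. -/
noncomputable def extLetter₁ : (obj A B).Letter → Option A.Letter
  | ⟨.fst, x⟩ => if h : ∃ a, incA A B a = x.1 then some ⟨.fst, left x h⟩ else none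
  | ⟨.snd, x⟩ => some ⟨.snd, fstSet x⟩

open Classical in
/-- The letter of `B` that is extracted from a letter of the twisted sum, if there is one. -/
noncomputable def extLetter₂ : (obj A B).Letter → Option B.Letter
  | ⟨.fst, x⟩ => if h : ∃ b, incB A B b = x.1 then some ⟨.fst, right x h⟩ else none
  | ⟨.snd, x⟩ => some ⟨.snd, sndSet x⟩

variable {k : ℕ}

/-- The word extracted from `w`, which lists all the extracted letters; the last letter of `w`
is extracted to `a`. -/
noncomputable def ext₁ {s : Sort2} (w : (obj A B).Word k s) (a : A.NC s) : A.Word k s :=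
  ⟨w.init.filterMap extLetter₁, a, (List.length_filterMap_le _ _).trans_lt w.bound⟩

/-- The word extracted from `w`, which lists all the extracted letters; the last letter of `w`
is extracted to `b`. -/
noncomputable def ext₂ {s : Sort2} (w : (obj A B).Word k s) (b : B.NC s) : B.Word k s :=
  ⟨w.init.filterMap extLetter₂, b, (List.length_filterMap_le _ _).trans_lt w.bound⟩

theorem toList_ext₁ {s : Sort2} (w : (obj A B).Word k s) (a : A.NC s)
    (h : extLetter₁ ⟨s, w.last⟩ = some ⟨s, a⟩) :
    (ext₁ w a).toList = w.toList.filterMap extLetter₁ := by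
  simp [MStr.Word.toList, ext₁, List.filterMap_append, h]

theorem toList_ext₂ {s : Sort2} (w : (obj A B).Word k s) (b : B.NC s)
    (h : extLetter₂ ⟨s, w.last⟩ = some ⟨s, b⟩) :
    (ext₂ w b).toList = w.toList.filterMap extLetter₂ := by
  simp [MStr.Word.toList, ext₂, List.filterMap_append, h]

open Classical in
variable (A B k) in
/-- The Kleisli law on elements. A constant goes to the constant. On the first sort, a word goes to
the word extracted from it in that component from which its last letter comes; on the second
sort, it goes to the pair of the two extracted words. -/
noncomputable def kappa : ∀ s, ((obj A B).ek k).carrier s → (obj (A.ek k) (B.ek k)).carrier s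
  | .fst, Sum.inl c => (obj (A.ek k) (B.ek k)).con .fst c
  | .fst, Sum.inr w =>
    if h : ∃ a, incA A B a = w.last.1 then incA _ _ (ext₁ w (left w.last h)).nc.1
    else incB _ _ (ext₂ w (right w.last ((exists_inc w.last.1).resolve_left h))).nc.1
  | .snd, Sum.inl c => c.elim
  | .snd, Sum.inr w => ((ext₁ w (fstSet w.last)).nc.1, (ext₂ w (sndSet w.last)).nc.1)

/-- The comparison map from the twisted sum of the standard models to the standard model of the
parallel sum, on elements: the identity on the first sort, and `(M, M') ↦ inc₁ M ∪ inc₂ M'` on the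
second sort. -/
def theta (A : Str L C₁) (B : Str L C₂) :
    ∀ s, (obj A.E B.E).carrier s → (oplus A B).E.carrier s
  | .fst, x => x
  | .snd, x => (Glue.inc₁ '' (show Set A.carrier from x.1) ∪
      Glue.inc₂ '' (show Set B.carrier from x.2) : Set (Glue A.con B.con))

variable (C₁ C₂) in
/-- The shared constants, as constant symbols of the first two-sorted signature. -/
def shared₁ : ∀ s, Set ((L.E C₁).Con s)
  | .fst => {c : C₁ | c.1 ∈ C₂}
  | .snd => ∅

variable (C₁ C₂) in
/-- The shared constants, as constant symbols of the second two-sorted signature. -/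
def shared₂ : ∀ s, Set ((L.E C₂).Con s)
  | .fst => {c : C₂ | c.1 ∈ C₁}
  | .snd => ∅

end TwistedSum

/-!
The twisted sum enters the argument only through a few properties, collected in the structure
`SumLike`: non-constant elements of `H (A, B)` are those of the components on the first sort and
pairs of them on the second, and a tuple is related exactly if it matches, entry by entry, a related
tuple of one component. Extracting from a word the letters that have a component in `A`, or in `B`,
then defines the Kleisli law `SumLike.kappa` for any such functor. Two non-constant elements with the
same components are equal (`SumLike.nc_ext`), so naturality and the Kleisli law can be verified
componentwise, where they say that extraction commutes with mapping words (`map_extWord`) and with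
the formation of words of prefixes (`dup_extWord`).

Smoothness. The elements on which two morphisms of coalgebras agree form a subcoalgebra; hence
equalisers exist and their inclusions are embeddings (`hasEqualizer_coalg`, `isEmb_fork_ι`). By
transposition, a morphism from a path `Q` to the lift of `H` at `(α, β)` is a homomorphism
`t : Q.A ⟶ H (α.A, β.A)` which commutes with the words assigned to elements (`isLift_iff`), and it
is an embedding exactly if `t` is strong, because morphisms from paths are always injective
(`injective_of_path`, `isEmb_iff_isStrong`). The components of the values of `t` form
subcoalgebras of `α` and `β` which are again paths, as comparability of words survives extraction
(`Extracts.path`), and `t` factors through the value of `H` at them (`IsLift.exists_factor`). So the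
two properties of the open pathwise-embeddings `f` and `g` apply to these path embeddings, and `H`
carries the resulting embeddings and diagonals to what is required of the lift of `H` at `(f, g)`
(`SumLike.isSmooth_kappa`). This uses that `H` preserves embeddings (`SumLike.isEmb_map`).

If shared constants are interpreted by elements which interpret no other constant, gluing
identifies just the two interpretations of each shared constant, and the twisted sum is `SumLike`
(`TwistedSum.sumLike`). Without this condition, constants can be identified in the sum of `A` and
`B` although they are not in the sum of the structures of words, where distinct constants are distinct
elements; then the law need not preserve relations. The remedy is the
saturated sum `SatSum.functor`, where constants are never identified; instead, constants linked by
the equality symbol may replace each other in relations. On standard models, where that symbol is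
equality, linked constants are exactly those identified in the parallel sum, so the
saturated sum still maps to the standard model of the parallel sum by a strong surjective
homomorphism. The cofree functor sends strong surjective homomorphisms to open
pathwise-embeddings (`isOpenPathwiseEmb_cofree_map`): preimages of the new elements can be chosen
arbitrarily.

Preservation of equivalence for monadic second-order logic holds by a decomposition in the style
of Feferman and Vaught: satisfaction of a formula in the parallel sum is a finite Boolean
combination of satisfaction of formulas of no larger rank in the components (`MSO.dec_sat`). A set
quantifier over the sum is a pair of set quantifiers, an element quantifier is a disjunction. For
atomic formulas the difficulty is that elements are glued; whether the values of two terms are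
identified depends on the equalities between these terms and the shared constants in the components,
which are finitely many atoms (`MSO.gval_eq_iff`).
-/

open MStr

/-! ### Embeddings of many-sorted structures -/

namespace MStr

variable {S : Type} {σ : MSig.{u} S} {D : ∀ s, Set (σ.Con s)} {k : ℕ}

theorem toFun_congr {A B : MStr σ D} {f g : A ⟶ B} (h : f = g) (s : S) (a : A.carrier s) :
    f.toFun s a = g.toFun s a := by rw [h]

theorem isCon_toFun {A B : MStr σ D} (f : A ⟶ B) {s : S} (a : A.carrier s) :
    B.IsCon (f.toFun s a) ↔ A.IsCon a := by
  constructor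
  · intro h
    by_contra h'
    exact f.map_nc s a h' h
  · rintro ⟨c, rfl⟩
    exact ⟨c, (f.map_con s c).symm⟩

theorem IsEmb.comp {X Y Z : MStr σ D} {f : X ⟶ Y} {g : Y ⟶ Z} (hf : IsEmb f) (hg : IsEmb g) :
    IsEmb (f ≫ g) :=
  ⟨fun s => (hg.1 s).comp (hf.1 s), fun R _ h => hf.2 R _ (hg.2 R _ h)⟩

theorem IsEmb.of_comp {X Y Z : MStr σ D} {f : X ⟶ Y} {g : Y ⟶ Z} (h : IsEmb (f ≫ g)) : IsEmb f :=
  ⟨fun s => Function.Injective.of_comp (h.1 s), fun R _ hx => h.2 R _ (g.map_rel R _ hx)⟩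

theorem IsEmb.cancel {X Y Z : MStr σ D} {m : Y ⟶ Z} (hm : IsEmb m) {f g : X ⟶ Y}
    (h : f ≫ m = g ≫ m) : f = g := by
  ext s a
  exact hm.1 s (toFun_congr h s a)

theorem isEmb_of_inv {X Y : MStr σ D} {f : X ⟶ Y} {g : Y ⟶ X} (h : f ≫ g = 𝟙 X) : IsEmb f :=
  IsEmb.of_comp (g := g) (h ▸ ⟨fun _ _ _ h => h, fun _ _ h => h⟩)

/-- A homomorphism whose values lie in the image of an embedding factors through it. -/
theorem IsEmb.exists_factor {X Y Z : MStr σ D} {m : Y ⟶ Z} (hm : IsEmb m) (t : X ⟶ Z)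
    (h : ∀ s x, ∃ y, m.toFun s y = t.toFun s x) : ∃ t' : X ⟶ Y, t' ≫ m = t := by
  choose r hr using h
  refine ⟨⟨r, fun s c => hm.1 s ?_, fun R x hx => hm.2 R _ ?_, fun s a ha hc => ?_⟩, ?_⟩
  · rw [hr, t.map_con, m.map_con]
  · simp only [hr]
    exact t.map_rel R x hx
  · rw [← isCon_toFun m, hr, isCon_toFun t] at hc
    exact ha hc
  · ext s a
    exact hr s a

theorem Hom.onNC_injective {A B : MStr σ D} {f : A ⟶ B} (h : ∀ s, Function.Injective (f.toFun s))
    (s : S) : Function.Injective (Hom.onNC f (s := s)) :=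
  fun _ _ hab => Subtype.ext (h s (congrArg Subtype.val hab))

theorem Hom.onLetter_injective {A B : MStr σ D} {f : A ⟶ B}
    (h : ∀ s, Function.Injective (f.toFun s)) : Function.Injective (Hom.onLetter f) := by
  rintro ⟨s, a⟩ ⟨t, b⟩ hab
  obtain rfl : s = t := congrArg Sigma.fst hab
  have : Hom.onNC f a = Hom.onNC f b := by simpa [Hom.onLetter] using hab
  rw [Hom.onNC_injective h s this]

theorem Word.map_injective {A B : MStr σ D} {f : A ⟶ B}
    (h : ∀ s, Function.Injective (f.toFun s)) (s : S) :
    Function.Injective (Word.map (k := k) (s := s) f) := by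
  intro v w hvw
  apply Word.toList_inj
  have := congrArg Word.toList hvw
  rw [Word.toList_map, Word.toList_map] at this
  exact List.map_injective_iff.mpr (Hom.onLetter_injective h) this

theorem Comparable.of_map {A B : MStr σ D} {f : A ⟶ B}
    (hf : ∀ s, Function.Injective (f.toFun s)) {s t : S}
    (a : σ.Con s ⊕ A.Word k s) (b : σ.Con t ⊕ A.Word k t)
    (h : Comparable (Sum.map id (Word.map f) a) (Sum.map id (Word.map f) b)) : Comparable a b := by
  rcases a with a | a <;> rcases b with b | b <;> try trivial
  simp only [Comparable, Sum.map_inr, Word.toList_map] at h ⊢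
  exact Or.imp ((List.prefix_map_iff_of_injective (Hom.onLetter_injective hf)).mp)
    ((List.prefix_map_iff_of_injective (Hom.onLetter_injective hf)).mp) h

theorem ekCounit_map {A B : MStr σ D} (f : A ⟶ B) (s : S) (a : σ.Con s ⊕ A.Word k s) :
    B.ekCounit k s (Sum.map id (Word.map f) a) = f.toFun s (A.ekCounit k s a) := by
  rcases a with a | a
  · exact (f.map_con _ _).symm
  · rfl

/-- The comonad of words preserves embeddings. -/
theorem IsEmb.ek_map {A B : MStr σ D} {f : A ⟶ B} (hf : IsEmb f) :
    IsEmb ((Ek σ D k).map f) := by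
  refine ⟨fun s => ?_, fun R x h => ⟨fun i j => Comparable.of_map hf.1 _ _ (h.1 i j), ?_⟩⟩
  · rintro (a | a) (b | b) hab
    · exact congrArg Sum.inl (Sum.inl_injective hab)
    · exact absurd hab Sum.inl_ne_inr
    · exact absurd hab Sum.inr_ne_inl
    · exact congrArg Sum.inr (Word.map_injective hf.1 s (Sum.inr_injective hab))
  · apply hf.2
    have h2 := h.2
    exact (congrArg (B.rel R) (funext fun i => ekCounit_map f _ (x i))).mp h2

theorem Word.exists_map_eq {A B : MStr σ D} {f : A ⟶ B} {s : S} (w : B.Word k s)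
    (h : ∀ y ∈ w.toList, ∃ x, Hom.onLetter f x = y) : ∃ v : A.Word k s, v.map f = w := by
  have hl : w.toList ∈ Set.range (List.map (Hom.onLetter f)) := by
    rw [Set.range_list_map]
    exact h
  obtain ⟨l, hl⟩ := hl
  obtain ⟨⟨t, x⟩, hx⟩ := h ⟨s, w.last⟩ (by simp [Word.toList])
  obtain rfl : t = s := congrArg Sigma.fst hx
  have hx' : Hom.onNC f x = w.last := by simpa [Hom.onLetter] using hx
  have hne : l ≠ [] := by
    rintro rfl
    simp [Word.toList] at hl
  have hd : l.dropLast.map (Hom.onLetter f) = w.init := by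
    have := congrArg List.dropLast hl
    rwa [← List.map_dropLast, Word.toList, List.dropLast_concat] at this
  have hb := w.bound
  rw [← hd, List.length_map] at hb
  exact ⟨⟨l.dropLast, x, hb⟩, Word.ext hd hx'⟩

/-! ### Coalgebras of the comonad of words -/

section Coalgebra

variable (P Q : (Ek σ D k).Coalgebra)

theorem counit_apply (s : S) (x : P.A.carrier s) : P.A.ekCounit k s (P.a.toFun s x) = x :=
  toFun_congr P.counit s x

theorem coalg_con (s : S) (c : σ.Con s) : P.a.toFun s (P.A.con s c) = Sum.inl c :=
  P.a.map_con s c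

theorem coalg_con_injective (s : S) : Function.Injective (P.A.con s) := fun c d h =>
  Sum.inl_injective ((coalg_con P s c).symm.trans ((congrArg _ h).trans (coalg_con P s d)))

theorem exists_word {s : S} (x : P.A.NC s) :
    ∃ w : P.A.Word k s, P.a.toFun s x.1 = Sum.inr w := by
  rcases h : P.a.toFun s x.1 with c | w
  · refine absurd ⟨c, ?_⟩ x.2
    have := counit_apply P s x.1
    rw [h] at this
    exact this
  · exact ⟨w, rfl⟩

/-- The word assigned to a non-constant element of a coalgebra. -/
noncomputable def word {s : S} (x : P.A.NC s) : P.A.Word k s := (exists_word P x).choose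

theorem a_eq_word {s : S} (x : P.A.NC s) : P.a.toFun s x.1 = Sum.inr (word P x) :=
  (exists_word P x).choose_spec

theorem word_eq {s : S} {x : P.A.NC s} {w : P.A.Word k s} (h : P.a.toFun s x.1 = Sum.inr w) :
    word P x = w := Sum.inr_injective ((a_eq_word P x).symm.trans h)

theorem word_last {s : S} (x : P.A.NC s) : (word P x).last = x := by
  have := counit_apply P s x.1
  rw [a_eq_word] at this
  exact Subtype.ext this

variable {P Q}

theorem word_hom (f : P ⟶ Q) {s : S} (x : P.A.NC s) :
    word Q (Hom.onNC f.f x) = (word P x).map f.f := by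
  apply word_eq
  have := toFun_congr f.h s x.1
  refine this.symm.trans ?_
  exact congrArg (Sum.map id (Word.map f.f)) (a_eq_word P x)

theorem coalgLE_iff (x y : P.A.Letter) :
    coalgLE P x y ↔ (word P x.2).toList <+: (word P y.2).toList := by
  constructor
  · rintro ⟨v, w, hv, hw, h⟩
    rwa [word_eq P hv, word_eq P hw]
  · exact fun h => ⟨_, _, a_eq_word P x.2, a_eq_word P y.2, h⟩

/-- Words determine their elements, as an element is the last letter of its word. -/
theorem letter_eq_of_word_eq {x y : P.A.Letter}
    (h : (word P x.2).toList = (word P y.2).toList) : x = y := by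
  have := congrArg List.getLast? h
  simpa [Word.toList, word_last] using this

/-- In a path, the comparability condition on related tuples of words is void. -/
theorem comparable_of_path (hP : (ekPathData σ D k).path P) {s t : S} (x : P.A.carrier s)
    (y : P.A.carrier t) :
    Comparable (show σ.Con s ⊕ P.A.Word k s from P.a.toFun s x) (P.a.toFun t y) := by
  by_cases hx : P.A.IsCon x
  · obtain ⟨c, rfl⟩ := hx
    rw [coalg_con P s c]
    trivial
  by_cases hy : P.A.IsCon y
  · obtain ⟨c, rfl⟩ := hy
    rw [coalg_con P t c, a_eq_word P ⟨x, hx⟩]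
    trivial
  rw [a_eq_word P ⟨x, hx⟩, a_eq_word P ⟨y, hy⟩]
  have := hP.2 ⟨s, x, hx⟩ ⟨t, y, hy⟩
  rwa [coalgLE_iff, coalgLE_iff] at this

/-- Every coalgebra morphism from a path is injective: comparable words with the same image have
the same length. -/
theorem injective_of_path (hP : (ekPathData σ D k).path P) (f : P ⟶ Q) (s : S) :
    Function.Injective (f.f.toFun s) := by
  intro x y h
  by_cases hx : P.A.IsCon x
  · have hy : P.A.IsCon y := by rwa [← isCon_toFun f.f, ← h, isCon_toFun f.f]
    obtain ⟨c, rfl⟩ := hx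
    obtain ⟨d, rfl⟩ := hy
    rw [f.f.map_con, f.f.map_con] at h
    rw [coalg_con_injective Q s h]
  · have hy : ¬ P.A.IsCon y := by rwa [← isCon_toFun f.f, ← h, isCon_toFun f.f]
    have hw : (word P ⟨x, hx⟩).map f.f = (word P ⟨y, hy⟩).map f.f := by
      rw [← word_hom, ← word_hom]
      congr 1
      exact Subtype.ext h
    have hl := congrArg (fun w => w.toList.length) hw
    simp only [Word.toList_map, List.length_map] at hl
    have : (word P ⟨x, hx⟩).toList = (word P ⟨y, hy⟩).toList := by
      have := hP.2 ⟨s, x, hx⟩ ⟨s, y, hy⟩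
      rw [coalgLE_iff, coalgLE_iff] at this
      rcases this with h' | h'
      · exact h'.eq_of_length hl
      · exact (h'.eq_of_length hl.symm).symm
    have := letter_eq_of_word_eq (x := ⟨s, x, hx⟩) (y := ⟨s, y, hy⟩) this
    simpa using this

/-! ### Transposition along the cofree coalgebra adjunction -/

/-- A homomorphism is strong if it reflects all the relations. -/
def IsStrong {A B : MStr σ D} (f : A ⟶ B) : Prop :=
  ∀ R x, B.rel R (fun i => f.toFun _ (x i)) → A.rel R x

theorem IsStrong.comp {X Y Z : MStr σ D} {f : X ⟶ Y} {g : Y ⟶ Z} (hf : IsStrong f)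
    (hg : IsStrong g) : IsStrong (f ≫ g) := fun R _ h => hf R _ (hg R _ h)

theorem IsStrong.of_comp {X Y Z : MStr σ D} {f : X ⟶ Y} {g : Y ⟶ Z} (h : IsStrong (f ≫ g)) :
    IsStrong f := fun R _ hx => h R _ (g.map_rel R _ hx)

/-- The coalgebra morphism into a cofree coalgebra that corresponds to a homomorphism. -/
def toCofree {X : MStr σ D} (t : P.A ⟶ X) : P ⟶ (Ek σ D k).cofree.obj X :=
  (Ek σ D k).adj.homEquiv P X t

/-- The homomorphism that corresponds to a coalgebra morphism into a cofree coalgebra. -/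
def ofCofree {X : MStr σ D} (e : P ⟶ (Ek σ D k).cofree.obj X) : P.A ⟶ X :=
  ((Ek σ D k).adj.homEquiv P X).symm e

theorem toCofree_f {X : MStr σ D} (t : P.A ⟶ X) : (toCofree t).f = P.a ≫ (Ek σ D k).map t := by
  simp [toCofree, Comonad.adj]
  rfl

theorem ofCofree_eq {X : MStr σ D} (e : P ⟶ (Ek σ D k).cofree.obj X) :
    ofCofree e = e.f ≫ (Ek σ D k).ε.app X := by
  simp [ofCofree, Comonad.adj]
  rfl

@[simp] theorem ofCofree_toCofree {X : MStr σ D} (t : P.A ⟶ X) :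
    ofCofree (toCofree (k := k) t) = t := Equiv.symm_apply_apply _ _

@[simp] theorem toCofree_ofCofree {X : MStr σ D} (e : P ⟶ (Ek σ D k).cofree.obj X) :
    toCofree (ofCofree e) = e := Equiv.apply_symm_apply _ _

theorem ofCofree_injective {X : MStr σ D} {e e' : P ⟶ (Ek σ D k).cofree.obj X}
    (h : ofCofree e = ofCofree e') : e = e' := Equiv.injective _ h

theorem ofCofree_comp_map {X Y : MStr σ D} (e : P ⟶ (Ek σ D k).cofree.obj X) (f : X ⟶ Y) :
    ofCofree (e ≫ (Ek σ D k).cofree.map f) = ofCofree e ≫ f :=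
  Adjunction.homEquiv_naturality_right_symm _ _ _

theorem ofCofree_comp (h : P ⟶ Q) {X : MStr σ D} (e : Q ⟶ (Ek σ D k).cofree.obj X) :
    ofCofree (h ≫ e) = h.f ≫ ofCofree e :=
  Adjunction.homEquiv_naturality_left_symm _ _ _

/-- A morphism from a path to a cofree coalgebra is an embedding exactly if the corresponding
homomorphism is strong. -/
theorem isEmb_iff_isStrong (hP : (ekPathData σ D k).path P) {X : MStr σ D}
    (e : P ⟶ (Ek σ D k).cofree.obj X) : IsEmb e.f ↔ IsStrong (ofCofree e) := by
  constructor
  · intro he R x hx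
    apply he.2
    have he' : e.f = P.a ≫ (Ek σ D k).map (ofCofree e) := by rw [← toCofree_f, toCofree_ofCofree]
    rw [he']
    refine ⟨fun i j => ?_, ?_⟩
    · exact (comparable_of_path hP (x i) (x j)).map (ofCofree e)
    · refine (congrArg (X.rel R) (funext fun i => ?_)).mpr hx
      rw [← counit_apply P _ (x i)]
      exact (ekCounit_map (ofCofree e) _ _).trans (by rw [counit_apply])
  · intro he
    refine ⟨injective_of_path hP e, fun R x hx => he R x ?_⟩
    rw [ofCofree_eq]
    exact hx.2

/-- The cofree functor sends strong surjective homomorphisms to open pathwise-embeddings. -/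
theorem isOpenPathwiseEmb_cofree_map {X Y : MStr σ D} (f : X ⟶ Y) (hs : IsStrong f)
    (hf : ∀ s, Function.Surjective (f.toFun s)) :
    (ekPathData σ D k).IsOpenPathwiseEmb ((Ek σ D k).cofree.map f) := by
  constructor
  · intro P e hP he
    have he' := (isEmb_iff_isStrong hP e).mp he
    refine (isEmb_iff_isStrong hP _).mpr ?_
    rw [ofCofree_comp_map]
    exact he'.comp hs
  · intro P Q h e g hP hQ hh he hg hc
    have hc' : ofCofree e ≫ f = h.f ≫ ofCofree g := by
      rw [← ofCofree_comp_map, hc, ofCofree_comp]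
    -- choose preimages, along `e` on the image of `h` and by the interpretations of constants
    have hex : ∀ s (q : Q.A.carrier s), ∃ x : X.carrier s, f.toFun s x = (ofCofree g).toFun s q ∧
        (∀ p, h.f.toFun s p = q → x = (ofCofree e).toFun s p) ∧
        ∀ c, q = Q.A.con s c → x = X.con s c := by
      intro s q
      by_cases hp : ∃ p, h.f.toFun s p = q
      · obtain ⟨p, rfl⟩ := hp
        refine ⟨(ofCofree e).toFun s p, toFun_congr hc' s p, fun p' hp' => ?_, fun c hcq => ?_⟩
        · rw [hh.1 s hp']
        · rw [← h.f.map_con] at hcq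
          rw [hh.1 s hcq, (ofCofree e).map_con]
      · obtain ⟨x, hx⟩ := hf s ((ofCofree g).toFun s q)
        refine ⟨x, hx, fun p h' => absurd ⟨p, h'⟩ hp, ?_⟩
        rintro c rfl
        exact absurd ⟨P.A.con s c, h.f.map_con s c⟩ hp
    choose d hd hd1 hd2 using hex
    let d' : Q.A ⟶ X := ⟨d, fun s c => hd2 s _ c rfl, fun R x hx => hs R _ (by
      simp only [hd]
      exact (ofCofree g).map_rel R x hx), fun s a ha hc => by
        rw [← isCon_toFun f, hd, isCon_toFun (ofCofree g)] at hc
        exact ha hc⟩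
    refine ⟨toCofree d', ofCofree_injective ?_, ofCofree_injective ?_⟩
    · rw [ofCofree_comp, ofCofree_toCofree]
      ext s p
      exact hd1 s _ p rfl
    · rw [ofCofree_comp_map, ofCofree_toCofree]
      ext s q
      exact hd s q

end Coalgebra

/-! ### Subcoalgebras and equalisers -/

section Sub

/-- The substructure of `A` on the constant elements and a set `T` of non-constant elements. -/
def subStr (A : MStr σ D) (T : Set A.Letter) : MStr σ D where
  carrier s := {a : A.carrier s // ∀ h : ¬ A.IsCon a, (⟨s, a, h⟩ : A.Letter) ∈ T}
  con s c := ⟨A.con s c, fun h => absurd ⟨c, rfl⟩ h⟩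
  rel R x := A.rel R (fun i => (x i).1)
  apart s c hc d h := A.apart s c hc d (congrArg Subtype.val h)

/-- The inclusion of a substructure. -/
def subι (A : MStr σ D) (T : Set A.Letter) : A.subStr T ⟶ A where
  toFun _ a := a.1
  map_con _ _ := rfl
  map_rel _ _ h := h
  map_nc _ _ h := fun ⟨c, hc⟩ => h ⟨c, Subtype.ext hc⟩

theorem isEmb_subι (A : MStr σ D) (T : Set A.Letter) : IsEmb (A.subι T) :=
  ⟨fun _ => Subtype.val_injective, fun _ _ h => h⟩

theorem onLetter_subι_mem {A : MStr σ D} {T : Set A.Letter} (x : (A.subStr T).Letter) :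
    Hom.onLetter (A.subι T) x ∈ T := x.2.1.2 _

theorem exists_onLetter_subι {A : MStr σ D} {T : Set A.Letter} {y : A.Letter} (h : y ∈ T) :
    ∃ x, Hom.onLetter (A.subι T) x = y :=
  ⟨⟨y.1, ⟨y.2.1, fun _ => h⟩, fun ⟨c, hc⟩ => y.2.2 ⟨c, congrArg Subtype.val hc⟩⟩, rfl⟩

variable (P : (Ek σ D k).Coalgebra)

/-- A set of non-constant elements that contains all the letters of the words assigned to its
elements. -/
def IsDown (T : Set P.A.Letter) : Prop := ∀ x ∈ T, ∀ y ∈ (word P x.2).toList, y ∈ T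

variable {P} {T : Set P.A.Letter}

/-- The coalgebra structure restricts to subsets that are closed under letters of words. -/
theorem exists_sub_a (hT : IsDown P T) :
    ∃ a : P.A.subStr T ⟶ (Ek σ D k).obj (P.A.subStr T),
      a ≫ (Ek σ D k).map (P.A.subι T) = P.A.subι T ≫ P.a := by
  apply (isEmb_subι P.A T).ek_map.exists_factor
  intro s x
  by_cases hx : P.A.IsCon x.1
  · obtain ⟨c, hc⟩ := hx
    refine ⟨Sum.inl c, ?_⟩
    show _ = P.a.toFun s x.1
    rw [← hc]
    exact (coalg_con P s c).symm
  · obtain ⟨v, hv⟩ := Word.exists_map_eq (f := P.A.subι T) (word P ⟨x.1, hx⟩) (fun y hy =>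
      exists_onLetter_subι (hT _ (x.2 hx) y hy))
    refine ⟨Sum.inr v, ?_⟩
    show _ = P.a.toFun s (⟨x.1, hx⟩ : P.A.NC s).1
    rw [a_eq_word, ← hv]
    rfl

/-- The subcoalgebra on a set of non-constant elements that is closed under letters of words. -/
noncomputable def sub (hT : IsDown P T) : (Ek σ D k).Coalgebra where
  A := P.A.subStr T
  a := (exists_sub_a hT).choose
  counit := by
    apply (isEmb_subι P.A T).cancel
    have h2 : (Ek σ D k).map (P.A.subι T) ≫ (Ek σ D k).ε.app P.A =
      (Ek σ D k).ε.app (P.A.subStr T) ≫ P.A.subι T := (Ek σ D k).ε.naturality (P.A.subι T)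
    rw [Category.assoc, ← h2, ← Category.assoc, (exists_sub_a hT).choose_spec, Category.assoc,
      P.counit, Category.comp_id, Category.id_comp]
  coassoc := by
    -- both sides agree after composition with the embedding `Ek (Ek ι)`, by coassociativity of `P`
    apply ((isEmb_subι P.A T).ek_map (k := k)).ek_map (k := k).cancel
    have h2 : (Ek σ D k).δ.app (P.A.subStr T) ≫ (Ek σ D k).map ((Ek σ D k).map (P.A.subι T)) =
      (Ek σ D k).map (P.A.subι T) ≫ (Ek σ D k).δ.app P.A :=
        ((Ek σ D k).δ.naturality (P.A.subι T)).symm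
    have h := (exists_sub_a hT).choose_spec
    generalize (exists_sub_a hT).choose = a at h
    have h4 := congrArg (P.A.subι T ≫ ·) P.coassoc
    rw [← Category.assoc, ← h, ← Category.assoc, ← h, Category.assoc, Category.assoc, ← h2,
      ← Functor.map_comp, ← h, Functor.map_comp] at h4
    exact (Category.assoc _ _ _).trans (h4.trans (Category.assoc _ _ _).symm)

/-- The inclusion of a subcoalgebra. -/
noncomputable def subHom (hT : IsDown P T) : sub hT ⟶ P where
  f := P.A.subι T
  h := (exists_sub_a hT).choose_spec

theorem isEmb_subHom (hT : IsDown P T) : IsEmb (subHom hT).f := isEmb_subι P.A T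

/-- Coalgebra morphisms factor through embeddings as soon as the underlying homomorphisms do. -/
theorem exists_coalg_factor {P Q Z : (Ek σ D k).Coalgebra} {m : P ⟶ Q} (hm : IsEmb m.f) (t : Z ⟶ Q)
    (h : ∀ s x, ∃ y, m.f.toFun s y = t.f.toFun s x) : ∃ t' : Z ⟶ P, t' ≫ m = t := by
  obtain ⟨t', ht'⟩ := hm.exists_factor t.f h
  refine ⟨⟨t', ?_⟩, Comonad.Coalgebra.Hom.ext ht'⟩
  apply (hm.ek_map (k := k)).cancel
  have e1 : (Ek σ D k).map t' ≫ (Ek σ D k).map m.f = (Ek σ D k).map t.f := by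
    rw [← Functor.map_comp, ht']
  have e2 : P.a ≫ (Ek σ D k).map m.f = m.f ≫ Q.a := m.h
  have e3 : Z.a ≫ (Ek σ D k).map t.f = t.f ≫ Q.a := t.h
  show (Z.a ≫ (Ek σ D k).map t') ≫ (Ek σ D k).map m.f = (t' ≫ P.a) ≫ (Ek σ D k).map m.f
  rw [Category.assoc, e1, Category.assoc, e2, e3, ← Category.assoc, ht']

theorem exists_sub_factor {Z : (Ek σ D k).Coalgebra} (hT : IsDown P T) (t : Z ⟶ P)
    (h : ∀ x, Hom.onLetter t.f x ∈ T) : ∃ t' : Z ⟶ sub hT, t' ≫ subHom hT = t := by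
  apply exists_coalg_factor (isEmb_subHom hT)
  intro s x
  by_cases hx : Z.A.IsCon x
  · obtain ⟨c, rfl⟩ := hx
    exact ⟨(sub hT).A.con s c, ((subHom hT).f.map_con s c).trans (t.f.map_con s c).symm⟩
  · exact ⟨⟨t.f.toFun s x, fun _ => h ⟨s, x, hx⟩⟩, rfl⟩

/-- A subcoalgebra on a finite chain is a path. -/
theorem path_sub (hT : IsDown P T) (hf : T.Finite)
    (hl : ∀ x ∈ T, ∀ y ∈ T, coalgLE P x y ∨ coalgLE P y x) :
    (ekPathData σ D k).path (sub hT) := by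
  have hi := Hom.onLetter_injective (isEmb_subHom hT).1
  have key : ∀ x y : (sub hT).A.Letter, coalgLE (sub hT) x y ↔
      coalgLE P (Hom.onLetter (subHom hT).f x) (Hom.onLetter (subHom hT).f y) := by
    intro x y
    rw [coalgLE_iff, coalgLE_iff]
    simp only [Hom.onLetter, word_hom, Word.toList_map]
    exact (List.prefix_map_iff_of_injective hi).symm
  constructor
  · have := hf.to_subtype
    exact Finite.of_injective
      (fun x => (⟨Hom.onLetter (subHom hT).f x, onLetter_subι_mem x⟩ : T))
      (fun x y h => hi (congrArg Subtype.val h))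
  · intro x y
    rw [key, key]
    exact hl _ (onLetter_subι_mem x) _ (onLetter_subι_mem y)

variable {Q : (Ek σ D k).Coalgebra} (u v : P ⟶ Q)

/-- The non-constant elements on which two coalgebra morphisms agree. -/
def eqSet : Set P.A.Letter := {x | Hom.onLetter u.f x = Hom.onLetter v.f x}

/-- If two morphisms agree on an element, they agree on the letters of its word, since they map that
word to the same word. -/
theorem isDown_eqSet : IsDown P (eqSet u v) := by
  intro x hx y hy
  have h : Hom.onNC u.f x.2 = Hom.onNC v.f x.2 := by
    have hx' : Hom.onLetter u.f x = Hom.onLetter v.f x := hx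
    simpa [Hom.onLetter] using hx'
  have hw := word_hom u x.2
  rw [h, word_hom v x.2] at hw
  have := congrArg Word.toList hw
  rw [Word.toList_map, Word.toList_map] at this
  exact (List.map_inj_left.mp this y hy).symm

/-- The equaliser of two coalgebra morphisms is the subcoalgebra of the elements on which they
agree. -/
noncomputable def eqFork : Limits.Fork u v :=
  Limits.Fork.ofι (subHom (isDown_eqSet u v)) (by
    ext s x
    by_cases hx : (sub (isDown_eqSet u v)).A.IsCon x
    · obtain ⟨c, rfl⟩ := hx
      rw [Hom.map_con, Hom.map_con]
    · have := onLetter_subι_mem (T := eqSet u v) ⟨s, x, hx⟩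
      simp only [eqSet, Set.mem_ofPred_eq, Hom.onLetter, Sigma.mk.injEq, heq_eq_eq,
        true_and] at this
      exact congrArg Subtype.val this)

theorem isEmb_eqFork_ι : IsEmb (eqFork u v).ι.f := isEmb_subHom (isDown_eqSet u v)

theorem exists_eqFork_lift (s : Limits.Fork u v) : ∃ l : s.pt ⟶ (eqFork u v).pt,
    l ≫ (eqFork u v).ι = s.ι := by
  apply exists_sub_factor (isDown_eqSet u v)
  intro x
  have h := toFun_congr (congrArg Comonad.Coalgebra.Hom.f s.condition) x.1 x.2.1
  show Hom.onLetter u.f _ = Hom.onLetter v.f _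
  simp only [Hom.onLetter, Sigma.mk.injEq, heq_eq_eq, true_and]
  exact Subtype.ext h

theorem hasEqualizer_coalg : Limits.HasEqualizer u v := by
  refine ⟨⟨eqFork u v, Limits.Fork.IsLimit.mk _ (fun s => (exists_eqFork_lift u v s).choose)
    (fun s => (exists_eqFork_lift u v s).choose_spec) (fun s m hm => ?_)⟩⟩
  apply Comonad.Coalgebra.Hom.ext
  apply (isEmb_eqFork_ι u v).cancel
  exact congrArg Comonad.Coalgebra.Hom.f
    (hm.trans (exists_eqFork_lift u v s).choose_spec.symm)

/-- An equaliser is a retract of the subcoalgebra of the elements on which the morphisms agree, hence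
its inclusion is an embedding. -/
theorem isEmb_fork_ι {u v : P ⟶ Q} (s : Limits.Fork u v) (hs : Nonempty (Limits.IsLimit s)) :
    IsEmb s.ι.f := by
  obtain ⟨hs⟩ := hs
  obtain ⟨l, hl⟩ := exists_eqFork_lift u v s
  have h : l ≫ Limits.Fork.IsLimit.lift hs (eqFork u v).ι (eqFork u v).condition = 𝟙 s.pt := by
    apply Limits.Fork.IsLimit.hom_ext hs
    rw [Category.assoc, Limits.Fork.IsLimit.lift_ι', hl, Category.id_comp]
  have h1 : IsEmb l.f := isEmb_of_inv (congrArg Comonad.Coalgebra.Hom.f h)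
  rw [← hl]
  exact h1.comp (isEmb_eqFork_ι u v)

end Sub

end MStr

/-! ### Extraction of words along partial maps of letters -/

namespace MStr

section Extract

variable {S : Type} {σ τ : MSig.{u} S} {D : ∀ s, Set (σ.Con s)} {E : ∀ s, Set (τ.Con s)} {k : ℕ}

/-- Partial maps from the non-constant elements of `X` to those of `Y`. -/
abbrev PMap (X : MStr σ D) (Y : MStr τ E) : Type u := ∀ s, X.NC s → Option (Y.NC s)

variable {X X' : MStr σ D} {Y Y' : MStr τ E}

/-- The partial map of letters given by a partial map of non-constant elements. -/
def extLetter (p : PMap X Y) (x : X.Letter) : Option Y.Letter := (p x.1 x.2).map (Sigma.mk x.1)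

/-- The word that is obtained from `w` by extracting letters along `p`, with the last letter
replaced by `a`. -/
def extWord (p : PMap X Y) {s : S} (w : X.Word k s) (a : Y.NC s) : Y.Word k s :=
  ⟨w.init.filterMap (extLetter p), a, (List.length_filterMap_le _ _).trans_lt w.bound⟩

theorem toList_extWord (p : PMap X Y) {s : S} (w : X.Word k s) (a : Y.NC s)
    (h : p s w.last = some a) : (extWord p w a).toList = w.toList.filterMap (extLetter p) := by
  simp [Word.toList, extWord, List.filterMap_append, extLetter, h]

theorem extLetter_onLetter {p : PMap X Y} {p' : PMap X' Y'} {f : X ⟶ X'} {g : Y ⟶ Y'}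
    (h : ∀ s x, p' s (Hom.onNC f x) = (p s x).map (Hom.onNC g)) (x : X.Letter) :
    extLetter p' (Hom.onLetter f x) = (extLetter p x).map (Hom.onLetter g) := by
  obtain ⟨s, x⟩ := x
  simp only [extLetter, Hom.onLetter, h, Option.map_map]
  rfl

theorem map_extWord {p : PMap X Y} {p' : PMap X' Y'} {f : X ⟶ X'} {g : Y ⟶ Y'}
    (h : ∀ s x, p' s (Hom.onNC f x) = (p s x).map (Hom.onNC g)) {s : S} (w : X.Word k s)
    (a : Y.NC s) : (extWord p w a).map g = extWord p' (w.map f) (Hom.onNC g a) := by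
  refine Word.ext ?_ rfl
  simp only [Word.map, extWord, List.map_filterMap, List.filterMap_map]
  congr 1
  funext x
  exact (extLetter_onLetter h x).symm

/-- The non-empty prefixes of a list of letters, as letters. -/
def prefixLetters (L : List X.Letter) (hL : L.length ≤ k) : List (X.ek k).Letter :=
  List.ofFn fun i : Fin L.length => prefixLetter L i.1 i.2 hL

theorem prefixLetters_concat (L : List X.Letter) (x : X.Letter) (hL : (L ++ [x]).length ≤ k)
    (hL' : L.length < k) :
    prefixLetters (L ++ [x]) hL =
      prefixLetters L hL'.le ++ [⟨x.1, Word.nc ⟨L, x.2, hL'⟩⟩] := by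
  apply List.ext_getElem
  · simp [prefixLetters]
  · intro i h1 h2
    have h1' : i < L.length + 1 := by simpa [prefixLetters] using h1
    by_cases hi : i < L.length
    · rw [List.getElem_append_left (by simpa [prefixLetters] using hi)]
      simp only [prefixLetters, List.getElem_ofFn]
      apply prefixLetter_congr
      rw [List.take_append_of_le_length hi]
    · obtain rfl : i = L.length := by omega
      rw [List.getElem_append_right (by simp [prefixLetters])]
      simp only [prefixLetters, List.getElem_ofFn]
      have := prefixLetter_eq (k := k) ⟨L, x.2, hL'⟩ (L := L ++ [x]) (i := L.length) (by simp) hL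
        (by simp [Word.toList])
      rw [this]
      simp

/-- Let `κ` act on words as extraction along `p`. Then extracting letters from a list and forming
prefixes can be interchanged: a prefix whose last letter has no component is dropped, and the
other prefixes are extracted. -/
theorem filterMap_prefixLetters {Z : MStr σ D} (p : PMap X Y) (q : PMap Z (Y.ek k))
    (κ : X.ek k ⟶ Z)
    (h : ∀ s (w : X.Word k s), q s (Hom.onNC κ w.nc) =
      (p s w.last).map fun a => (extWord p w a).nc)
    (L : List X.Letter) (hL : L.length ≤ k) (hL' : (L.filterMap (extLetter p)).length ≤ k) :
    (prefixLetters L hL).filterMap (fun x => extLetter q (Hom.onLetter κ x)) =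
      prefixLetters (L.filterMap (extLetter p)) hL' := by
  induction L using List.reverseRecOn with
  | nil => rfl
  | append_singleton L x ih =>
    have hlt : L.length < k := by simpa using hL
    have hlt' := (List.length_filterMap_le (extLetter p) L).trans_lt hlt
    rw [prefixLetters_concat L x hL hlt, List.filterMap_append, ih hlt.le hlt'.le]
    have hx : extLetter q (Hom.onLetter κ ⟨x.1, Word.nc ⟨L, x.2, hlt⟩⟩) =
        ((p x.1 x.2).map fun a => (extWord p (⟨L, x.2, hlt⟩ : X.Word k x.1) a).nc).map
          (Sigma.mk x.1) := congrArg (Option.map (Sigma.mk x.1)) (h x.1 ⟨L, x.2, hlt⟩)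
    rw [List.filterMap_cons, hx]
    rcases hp : p x.1 x.2 with _ | a
    · simp [hp, extLetter]
    · have hp' : (L ++ [x]).filterMap (extLetter p) = L.filterMap (extLetter p) ++ [⟨x.1, a⟩] := by
        simp [extLetter, hp]
      have : ∀ (M : List Y.Letter) (hM : M.length ≤ k),
          M = L.filterMap (extLetter p) ++ [⟨x.1, a⟩] →
          prefixLetters M hM = prefixLetters (L.filterMap (extLetter p)) hlt'.le ++
            [⟨x.1, Word.nc ⟨L.filterMap (extLetter p), a, hlt'⟩⟩] := by
        rintro _ hM rfl
        exact prefixLetters_concat _ ⟨x.1, a⟩ hM hlt'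
      rw [this _ hL' hp']
      rfl

/-- Extraction commutes with the formation of words of prefixes. -/
theorem dup_extWord {Z : MStr σ D} (p : PMap X Y) (q : PMap Z (Y.ek k)) (κ : X.ek k ⟶ Z)
    (h : ∀ s (w : X.Word k s), q s (Hom.onNC κ w.nc) =
      (p s w.last).map fun a => (extWord p w a).nc) {s : S} (w : X.Word k s) (a : Y.NC s) :
    (extWord p w a).dup = extWord q (w.dup.map κ) (extWord p w a).nc := by
  refine Word.ext ?_ rfl
  have := filterMap_prefixLetters p q κ h w.init w.bound.le (extWord p w a).bound.le
  simp only [extWord, Word.map, List.filterMap_map]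
  exact this.symm

theorem Comparable.extWord (p : PMap X Y) {s t : S} (v : X.Word k s) (w : X.Word k t)
    (a : Y.NC s) (b : Y.NC t) (ha : p s v.last = some a) (hb : p t w.last = some b)
    (h : Comparable (Sum.inr v) (Sum.inr w)) :
    Comparable (Sum.inr (MStr.extWord p v a)) (Sum.inr (MStr.extWord p w b)) := by
  simp only [Comparable, toList_extWord p _ _ ha, toList_extWord p _ _ hb] at h ⊢
  exact h.imp (fun h => h.filterMap _) (fun h => h.filterMap _)

variable {Q : (Ek σ D k).Coalgebra} {P : (Ek τ E k).Coalgebra}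

/-- The non-constant elements extracted from the values of a homomorphism. -/
def supp (p : PMap X P.A) (t : Q.A ⟶ X) : Set P.A.Letter :=
  {y | ∃ x, extLetter p (Hom.onLetter t x) = some y}

/-- The words of extracted elements are the words extracted from the words of `Q`. -/
def Extracts (p : PMap X P.A) (t : Q.A ⟶ X) : Prop :=
  ∀ s (x : Q.A.NC s) a, p s (Hom.onNC t x) = some a →
    word P a = extWord p ((word Q x).map t) a

theorem Extracts.toList {p : PMap X P.A} {t : Q.A ⟶ X} (h : Extracts p t) {x : Q.A.Letter}
    {y : P.A.Letter} (hy : extLetter p (Hom.onLetter t x) = some y) :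
    (word P y.2).toList =
      (word Q x.2).toList.filterMap (fun x => extLetter p (Hom.onLetter t x)) := by
  obtain ⟨s, x⟩ := x
  obtain ⟨a, ha, rfl⟩ : ∃ a : P.A.NC s, p s (Hom.onNC t x) = some a ∧ Sigma.mk s a = y :=
    Option.map_eq_some_iff.mp hy
  have hl : ((word Q x).map t).last = Hom.onNC t x := congrArg (Hom.onNC t) (word_last Q x)
  refine (congrArg Word.toList (h s x a ha)).trans ?_
  rw [toList_extWord p _ _ (hl ▸ ha), Word.toList_map, List.filterMap_map]
  rfl

theorem Extracts.isDown {p : PMap X P.A} {t : Q.A ⟶ X} (h : Extracts p t) :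
    IsDown P (supp p t) := by
  rintro y ⟨x, hx⟩ z hz
  rw [h.toList hx, List.mem_filterMap] at hz
  obtain ⟨x', _, hx'⟩ := hz
  exact ⟨x', hx'⟩

/-- The elements extracted from a path form a path: their words are extracted from comparable words.
-/
theorem Extracts.path {p : PMap X P.A} {t : Q.A ⟶ X} (h : Extracts p t)
    (hQ : (ekPathData σ D k).path Q) : (ekPathData τ E k).path (sub h.isDown) := by
  apply path_sub h.isDown
  · have := hQ.1
    refine ((Set.finite_range fun x => extLetter p (Hom.onLetter t x)).preimage
      (Option.some_injective _).injOn).subset ?_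
    rintro y ⟨x, hx⟩
    exact ⟨x, hx⟩
  · rintro y ⟨x, hx⟩ y' ⟨x', hx'⟩
    rw [coalgLE_iff, coalgLE_iff, h.toList hx, h.toList hx']
    have := hQ.2 x x'
    rw [coalgLE_iff, coalgLE_iff] at this
    exact this.imp (fun h => h.filterMap _) (fun h => h.filterMap _)

end Extract

end MStr

/-! ### Functors that are sums on the first sort and products on the second sort -/

/-- The sum on the first sort and the product on the second sort. -/
def SortSum (X Y : Sort2 → Type u) : Sort2 → Type u
  | .fst => X .fst ⊕ Y .fst
  | .snd => X .snd × Y .snd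

namespace SortSum

variable {X Y X' Y' X'' Y'' : Sort2 → Type u}

/-- The action on functions at a given sort. -/
def map : ∀ {s : Sort2}, (X s → X' s) → (Y s → Y' s) → SortSum X Y s → SortSum X' Y' s
  | .fst => Sum.map
  | .snd => Prod.map

/-- The first component of an element, if it has one. -/
def pr₁ : ∀ {s : Sort2}, SortSum X Y s → Option (X s)
  | .fst, .inl a => some a
  | .fst, .inr _ => none
  | .snd, (a, _) => some a

/-- The second component of an element, if it has one. -/
def pr₂ : ∀ {s : Sort2}, SortSum X Y s → Option (Y s)
  | .fst, .inl _ => none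
  | .fst, .inr b => some b
  | .snd, (_, b) => some b

theorem pr₁_map {s : Sort2} (f : X s → X' s) (g : Y s → Y' s) (z : SortSum X Y s) :
    pr₁ (map f g z) = (pr₁ z).map f := by
  rcases s with _ | _
  · rcases z with a | b <;> rfl
  · rfl

theorem pr₂_map {s : Sort2} (f : X s → X' s) (g : Y s → Y' s) (z : SortSum X Y s) :
    pr₂ (map f g z) = (pr₂ z).map g := by
  rcases s with _ | _
  · rcases z with a | b <;> rfl
  · rfl

theorem ext {s : Sort2} {z z' : SortSum X Y s} (h₁ : pr₁ z = pr₁ z') (h₂ : pr₂ z = pr₂ z') :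
    z = z' := by
  rcases s with _ | _
  · rcases z with a | b <;> rcases z' with a' | b'
    · exact congrArg Sum.inl (Option.some_injective _ h₁)
    · cases h₁
    · cases h₁
    · exact congrArg Sum.inr (Option.some_injective _ h₂)
  · exact Prod.ext (Option.some_injective _ h₁) (Option.some_injective _ h₂)

theorem exists_map_eq {s : Sort2} {f : X s → X' s} {g : Y s → Y' s} (z : SortSum X' Y' s)
    (h₁ : ∀ a, pr₁ z = some a → ∃ a', f a' = a) (h₂ : ∀ b, pr₂ z = some b → ∃ b', g b' = b) :
    ∃ z', map f g z' = z := by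
  rcases s with _ | _
  · rcases z with a | b
    · obtain ⟨a', rfl⟩ := h₁ a rfl
      exact ⟨.inl a', rfl⟩
    · obtain ⟨b', rfl⟩ := h₂ b rfl
      exact ⟨.inr b', rfl⟩
  · obtain ⟨a', h₁⟩ := h₁ _ rfl
    obtain ⟨b', h₂⟩ := h₂ _ rfl
    exact ⟨(a', b'), Prod.ext h₁ h₂⟩

theorem map_injective {s : Sort2} {f : X s → X' s} {g : Y s → Y' s} (hf : Function.Injective f)
    (hg : Function.Injective g) : Function.Injective (map f g) := by
  rcases s with _ | _
  · exact hf.sumMap hg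
  · exact hf.prodMap hg

end SortSum

/-- A description of the values of a functor `H` which makes `H` behave like a twisted sum.
Non-constant elements of `H (A, B)` are those of `A` and of `B` on the first sort, and pairs of
them on the second sort. A tuple is related in `H (A, B)` if it matches a related tuple of `A` or
of `B`. A non-constant element matches just its components; which constants match each other is
controlled by the relations `conMatch₁` and `conMatch₂` on constant symbols. These relations may
depend on `A` and `B`, but the comonad has to preserve and embeddings have to reflect them; embeddings
also have to reflect the equality of the interpretations of constants in `H (A, B)`. -/
structure SumLike {L : RSig.{u}} {C₁ C₂ C₃ : Type u} {D₁ : ∀ s, Set ((L.E C₁).Con s)}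
    {D₂ : ∀ s, Set ((L.E C₂).Con s)} {D₃ : ∀ s, Set ((L.E C₃).Con s)}
    (H : MStr (L.E C₁) D₁ × MStr (L.E C₂) D₂ ⥤ MStr (L.E C₃) D₃) where
  split : ∀ A B s, (H.obj (A, B)).NC s ≃ SortSum A.NC B.NC s
  split_map : ∀ {A A' B B'} (f : A ⟶ A') (g : B ⟶ B') s x,
    split A' B' s (Hom.onNC (H.map (Prod.mkHom f g)) x) =
      SortSum.map (Hom.onNC f) (Hom.onNC g) (split A B s x)
  match₁ : ∀ A B s, (H.obj (A, B)).carrier s → A.carrier s → Prop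
  match₂ : ∀ A B s, (H.obj (A, B)).carrier s → B.carrier s → Prop
  rel_iff : ∀ A B R x, (H.obj (A, B)).rel R x ↔
    (∃ a, A.rel R a ∧ ∀ i, match₁ A B _ (x i) (a i)) ∨
      ∃ b, B.rel R b ∧ ∀ i, match₂ A B _ (x i) (b i)
  match₁_nc : ∀ A B s (x : (H.obj (A, B)).NC s) a, match₁ A B s x.1 a ↔
    ∃ a', SortSum.pr₁ (split A B s x) = some a' ∧ a'.1 = a
  match₂_nc : ∀ A B s (x : (H.obj (A, B)).NC s) b, match₂ A B s x.1 b ↔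
    ∃ b', SortSum.pr₂ (split A B s x) = some b' ∧ b'.1 = b
  conMatch₁ : MStr (L.E C₁) D₁ → MStr (L.E C₂) D₂ → ∀ s, (L.E C₃).Con s → (L.E C₁).Con s → Prop
  conMatch₂ : MStr (L.E C₁) D₁ → MStr (L.E C₂) D₂ → ∀ s, (L.E C₃).Con s → (L.E C₂).Con s → Prop
  match₁_con : ∀ A B s c a, match₁ A B s ((H.obj (A, B)).con s c) a ↔
    ∃ c', A.con s c' = a ∧ conMatch₁ A B s c c'
  match₂_con : ∀ A B s c b, match₂ A B s ((H.obj (A, B)).con s c) b ↔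
    ∃ c', B.con s c' = b ∧ conMatch₂ A B s c c'
  conMatch₁_ek : ∀ k A B s c c', conMatch₁ A B s c c' → conMatch₁ (A.ek k) (B.ek k) s c c'
  conMatch₂_ek : ∀ k A B s c c', conMatch₂ A B s c c' → conMatch₂ (A.ek k) (B.ek k) s c c'
  conMatch₁_emb : ∀ {A A' B B'} (f : A ⟶ A') (g : B ⟶ B'), IsEmb f → IsEmb g →
    ∀ s c c', conMatch₁ A' B' s c c' → conMatch₁ A B s c c'
  conMatch₂_emb : ∀ {A A' B B'} (f : A ⟶ A') (g : B ⟶ B'), IsEmb f → IsEmb g →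
    ∀ s c c', conMatch₂ A' B' s c c' → conMatch₂ A B s c c'
  con_emb : ∀ {A A' B B'} (f : A ⟶ A') (g : B ⟶ B'), IsEmb f → IsEmb g →
    ∀ s c d, (H.obj (A', B')).con s c = (H.obj (A', B')).con s d →
      (H.obj (A, B)).con s c = (H.obj (A, B)).con s d

namespace SumLike

variable {L : RSig.{u}} {C₁ C₂ C₃ : Type u} {D₁ : ∀ s, Set ((L.E C₁).Con s)}
    {D₂ : ∀ s, Set ((L.E C₂).Con s)} {D₃ : ∀ s, Set ((L.E C₃).Con s)}
    {H : MStr (L.E C₁) D₁ × MStr (L.E C₂) D₂ ⥤ MStr (L.E C₃) D₃} (h : SumLike H)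
    {A A' : MStr (L.E C₁) D₁} {B B' : MStr (L.E C₂) D₂} {k : ℕ}

/-- The first component of non-constant elements. -/
def ext₁ (A : MStr (L.E C₁) D₁) (B : MStr (L.E C₂) D₂) : PMap (H.obj (A, B)) A :=
  fun s x => SortSum.pr₁ (h.split A B s x)

/-- The second component of non-constant elements. -/
def ext₂ (A : MStr (L.E C₁) D₁) (B : MStr (L.E C₂) D₂) : PMap (H.obj (A, B)) B :=
  fun s x => SortSum.pr₂ (h.split A B s x)

theorem ext₁_map (f : A ⟶ A') (g : B ⟶ B') (s : Sort2) (x : (H.obj (A, B)).NC s) :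
    h.ext₁ A' B' s (Hom.onNC (H.map (Prod.mkHom f g)) x) =
      (h.ext₁ A B s x).map (Hom.onNC f) := by
  simp only [ext₁, h.split_map, SortSum.pr₁_map]

theorem ext₂_map (f : A ⟶ A') (g : B ⟶ B') (s : Sort2) (x : (H.obj (A, B)).NC s) :
    h.ext₂ A' B' s (Hom.onNC (H.map (Prod.mkHom f g)) x) =
      (h.ext₂ A B s x).map (Hom.onNC g) := by
  simp only [ext₂, h.split_map, SortSum.pr₂_map]

theorem nc_ext {s : Sort2} {x y : (H.obj (A, B)).NC s} (h₁ : h.ext₁ A B s x = h.ext₁ A B s y)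
    (h₂ : h.ext₂ A B s x = h.ext₂ A B s y) : x = y :=
  (h.split A B s).injective (SortSum.ext h₁ h₂)

/-- If the image of `x` matches an element, that element is the image of a match of `x`, provided that
the two homomorphisms are embeddings. -/
theorem match₁_reflect {f : A ⟶ A'} {g : B ⟶ B'} (hf : IsEmb f) (hg : IsEmb g) {s : Sort2}
    (x : (H.obj (A, B)).carrier s) (a' : A'.carrier s)
    (hx : h.match₁ A' B' s ((H.map (Prod.mkHom f g)).toFun s x) a') :
    ∃ a, f.toFun s a = a' ∧ h.match₁ A B s x a := by
  by_cases hc : (H.obj (A, B)).IsCon x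
  · obtain ⟨c, rfl⟩ := hc
    rw [Hom.map_con, h.match₁_con] at hx
    obtain ⟨c', rfl, hc'⟩ := hx
    exact ⟨A.con s c', f.map_con s c', (h.match₁_con A B s c _).mpr
      ⟨c', rfl, h.conMatch₁_emb f g hf hg s c c' hc'⟩⟩
  · have hx' := (h.match₁_nc A' B' s (Hom.onNC (H.map (Prod.mkHom f g)) ⟨x, hc⟩) a').mp hx
    obtain ⟨b, hb, rfl⟩ := hx'
    rw [h.split_map, SortSum.pr₁_map, Option.map_eq_some_iff] at hb
    obtain ⟨a, ha, rfl⟩ := hb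
    exact ⟨a.1, rfl, (h.match₁_nc A B s ⟨x, hc⟩ a.1).mpr ⟨a, ha, rfl⟩⟩

theorem match₂_reflect {f : A ⟶ A'} {g : B ⟶ B'} (hf : IsEmb f) (hg : IsEmb g) {s : Sort2}
    (x : (H.obj (A, B)).carrier s) (b' : B'.carrier s)
    (hx : h.match₂ A' B' s ((H.map (Prod.mkHom f g)).toFun s x) b') :
    ∃ b, g.toFun s b = b' ∧ h.match₂ A B s x b := by
  by_cases hc : (H.obj (A, B)).IsCon x
  · obtain ⟨c, rfl⟩ := hc
    rw [Hom.map_con, h.match₂_con] at hx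
    obtain ⟨c', rfl, hc'⟩ := hx
    exact ⟨B.con s c', g.map_con s c', (h.match₂_con A B s c _).mpr
      ⟨c', rfl, h.conMatch₂_emb f g hf hg s c c' hc'⟩⟩
  · have hx' := (h.match₂_nc A' B' s (Hom.onNC (H.map (Prod.mkHom f g)) ⟨x, hc⟩) b').mp hx
    obtain ⟨a, ha, rfl⟩ := hx'
    rw [h.split_map, SortSum.pr₂_map, Option.map_eq_some_iff] at ha
    obtain ⟨b, hb, rfl⟩ := ha
    exact ⟨b.1, rfl, (h.match₂_nc A B s ⟨x, hc⟩ b.1).mpr ⟨b, hb, rfl⟩⟩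

theorem isEmb_map (h : SumLike H) {f : A ⟶ A'} {g : B ⟶ B'} (hf : IsEmb f) (hg : IsEmb g) :
    IsEmb (H.map (Prod.mkHom f g)) := by
  refine ⟨fun s x y hxy => ?_, fun R x hx => ?_⟩
  · by_cases hx : (H.obj (A, B)).IsCon x
    · have hy : (H.obj (A, B)).IsCon y := by
        rwa [← isCon_toFun (H.map (Prod.mkHom f g)), ← hxy, isCon_toFun]
      obtain ⟨c, rfl⟩ := hx
      obtain ⟨d, rfl⟩ := hy
      rw [Hom.map_con, Hom.map_con] at hxy
      exact h.con_emb f g hf hg s c d hxy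
    · have hy : ¬ (H.obj (A, B)).IsCon y := by
        rwa [← isCon_toFun (H.map (Prod.mkHom f g)), ← hxy, isCon_toFun]
      have he : Hom.onNC (H.map (Prod.mkHom f g)) ⟨x, hx⟩ =
          Hom.onNC (H.map (Prod.mkHom f g)) ⟨y, hy⟩ := Subtype.ext hxy
      have he' := congrArg (h.split A' B' s) he
      rw [h.split_map, h.split_map] at he'
      have := (h.split A B s).injective (SortSum.map_injective (Hom.onNC_injective hf.1 s)
        (Hom.onNC_injective hg.1 s) he')
      exact congrArg Subtype.val this
  · rw [h.rel_iff] at hx ⊢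
    rcases hx with ⟨a', ha', hx⟩ | ⟨b', hb', hx⟩
    · left
      choose a ha hm using fun i => h.match₁_reflect hf hg (x i) (a' i) (hx i)
      exact ⟨a, hf.2 R a ((congrArg (A'.rel R) (funext ha)).mpr ha'), hm⟩
    · right
      choose b hb hm using fun i => h.match₂_reflect hf hg (x i) (b' i) (hx i)
      exact ⟨b, hg.2 R b ((congrArg (B'.rel R) (funext hb)).mpr hb'), hm⟩

theorem exists_map_eq (f : A ⟶ A') (g : B ⟶ B') {s : Sort2} (x : (H.obj (A', B')).NC s)
    (h₁ : ∀ a, h.ext₁ A' B' s x = some a → ∃ a', Hom.onNC f a' = a)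
    (h₂ : ∀ b, h.ext₂ A' B' s x = some b → ∃ b', Hom.onNC g b' = b) :
    ∃ y, Hom.onNC (H.map (Prod.mkHom f g)) y = x := by
  obtain ⟨z, hz⟩ := SortSum.exists_map_eq _ h₁ h₂
  refine ⟨(h.split A B s).symm z, (h.split A' B' s).injective ?_⟩
  rw [h.split_map, Equiv.apply_symm_apply, hz]

/-! ### The Kleisli law -/

/-- The Kleisli law on words: the component of the last letter in `A` is replaced by the word extracted
from `w` along the first components, and dually for `B`. -/
def kappaWord {s : Sort2} (w : (H.obj (A, B)).Word k s) : (H.obj (A.ek k, B.ek k)).NC s :=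
  (h.split (A.ek k) (B.ek k) s).symm (SortSum.map (fun a => (extWord (h.ext₁ A B) w a).nc)
    (fun b => (extWord (h.ext₂ A B) w b).nc) (h.split A B s w.last))

theorem ext₁_kappaWord {s : Sort2} (w : (H.obj (A, B)).Word k s) :
    h.ext₁ (A.ek k) (B.ek k) s (h.kappaWord w) =
      (h.ext₁ A B s w.last).map fun a => (extWord (h.ext₁ A B) w a).nc := by
  simp only [ext₁, kappaWord, Equiv.apply_symm_apply, SortSum.pr₁_map]

theorem ext₂_kappaWord {s : Sort2} (w : (H.obj (A, B)).Word k s) :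
    h.ext₂ (A.ek k) (B.ek k) s (h.kappaWord w) =
      (h.ext₂ A B s w.last).map fun b => (extWord (h.ext₂ A B) w b).nc := by
  simp only [ext₂, kappaWord, Equiv.apply_symm_apply, SortSum.pr₂_map]

variable (A B k) in
/-- The Kleisli law on elements. -/
def kappaFun (s : Sort2) (x : (L.E C₃).Con s ⊕ (H.obj (A, B)).Word k s) :
    (H.obj (A.ek k, B.ek k)).carrier s :=
  Sum.elim ((H.obj (A.ek k, B.ek k)).con s) (fun w => (h.kappaWord w).1) x

/-- A match of the counit of `x` lifts to a match of the value of the Kleisli law at `x`. -/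
theorem kappa_match₁ {s : Sort2} (x : (L.E C₃).Con s ⊕ (H.obj (A, B)).Word k s) (a : A.carrier s)
    (hx : h.match₁ A B s ((H.obj (A, B)).ekCounit k s x) a) :
    (∃ c c', x = Sum.inl c ∧ a = A.con s c' ∧
      h.match₁ (A.ek k) (B.ek k) s (h.kappaFun A B k s x) (Sum.inl c')) ∨
    ∃ w a', x = Sum.inr w ∧ a = a'.1 ∧ h.ext₁ A B s w.last = some a' ∧
      h.match₁ (A.ek k) (B.ek k) s (h.kappaFun A B k s x)
        (Sum.inr (extWord (h.ext₁ A B) w a')) := by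
  rcases x with c | w
  · obtain ⟨c', hc, hm⟩ := (h.match₁_con A B s c a).mp hx
    exact Or.inl ⟨c, c', rfl, hc.symm, (h.match₁_con _ _ s c _).mpr
      ⟨c', rfl, h.conMatch₁_ek k A B s c c' hm⟩⟩
  · obtain ⟨a', ha', rfl⟩ := (h.match₁_nc A B s w.last a).mp hx
    refine Or.inr ⟨w, a', rfl, rfl, ha', (h.match₁_nc _ _ s (h.kappaWord w) _).mpr
      ⟨(extWord (h.ext₁ A B) w a').nc, ?_, rfl⟩⟩
    exact (h.ext₁_kappaWord w).trans (congrArg _ ha')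

theorem kappa_match₂ {s : Sort2} (x : (L.E C₃).Con s ⊕ (H.obj (A, B)).Word k s) (b : B.carrier s)
    (hx : h.match₂ A B s ((H.obj (A, B)).ekCounit k s x) b) :
    (∃ c c', x = Sum.inl c ∧ b = B.con s c' ∧
      h.match₂ (A.ek k) (B.ek k) s (h.kappaFun A B k s x) (Sum.inl c')) ∨
    ∃ w b', x = Sum.inr w ∧ b = b'.1 ∧ h.ext₂ A B s w.last = some b' ∧
      h.match₂ (A.ek k) (B.ek k) s (h.kappaFun A B k s x)
        (Sum.inr (extWord (h.ext₂ A B) w b')) := by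
  rcases x with c | w
  · obtain ⟨c', hc, hm⟩ := (h.match₂_con A B s c b).mp hx
    exact Or.inl ⟨c, c', rfl, hc.symm, (h.match₂_con _ _ s c _).mpr
      ⟨c', rfl, h.conMatch₂_ek k A B s c c' hm⟩⟩
  · obtain ⟨b', hb', rfl⟩ := (h.match₂_nc A B s w.last b).mp hx
    refine Or.inr ⟨w, b', rfl, rfl, hb', (h.match₂_nc _ _ s (h.kappaWord w) _).mpr
      ⟨(extWord (h.ext₂ A B) w b').nc, ?_, rfl⟩⟩
    exact (h.ext₂_kappaWord w).trans (congrArg _ hb')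

/-- Matches of the counits of pairwise comparable words lift to pairwise comparable words. -/
theorem kappa_lift₁ {n : ℕ} {s : Fin n → Sort2}
    (x : ∀ i, (L.E C₃).Con (s i) ⊕ (H.obj (A, B)).Word k (s i))
    (hc : ∀ i j, Comparable (x i) (x j)) (a : ∀ i, A.carrier (s i))
    (hx : ∀ i, h.match₁ A B _ ((H.obj (A, B)).ekCounit k _ (x i)) (a i)) :
    ∃ z : ∀ i, (L.E C₁).Con (s i) ⊕ A.Word k (s i), (∀ i j, Comparable (z i) (z j)) ∧
      (∀ i, A.ekCounit k _ (z i) = a i) ∧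
      ∀ i, h.match₁ (A.ek k) (B.ek k) _ (h.kappaFun A B k _ (x i)) (z i) := by
  have hz : ∀ i, ∃ z : (L.E C₁).Con (s i) ⊕ A.Word k (s i), A.ekCounit k _ z = a i ∧
      h.match₁ (A.ek k) (B.ek k) _ (h.kappaFun A B k _ (x i)) z ∧
      ((∃ c, z = Sum.inl c) ∨ ∃ w a', x i = Sum.inr w ∧ h.ext₁ A B _ w.last = some a' ∧
        z = Sum.inr (extWord (h.ext₁ A B) w a')) := by
    intro i
    rcases h.kappa_match₁ (x i) (a i) (hx i) with ⟨c, c', _, ha, hm⟩ | ⟨w, a', hw, ha, he, hm⟩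
    · exact ⟨Sum.inl c', ha.symm, hm, Or.inl ⟨c', rfl⟩⟩
    · exact ⟨Sum.inr (extWord (h.ext₁ A B) w a'), ha.symm, hm, Or.inr ⟨w, a', hw, he, rfl⟩⟩
  choose z hz hm hz' using hz
  refine ⟨z, fun i j => ?_, hz, hm⟩
  rcases hz' i with ⟨c, hc⟩ | ⟨v, a₁, hv, ha₁, hzi⟩
  · rw [hc]
    trivial
  rcases hz' j with ⟨c, hc⟩ | ⟨w, a₂, hw, ha₂, hzj⟩
  · rw [hc, hzi]
    trivial
  rw [hzi, hzj]
  have := hc i j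
  rw [hv, hw] at this
  exact this.extWord _ _ _ _ _ ha₁ ha₂

theorem kappa_lift₂ {n : ℕ} {s : Fin n → Sort2}
    (x : ∀ i, (L.E C₃).Con (s i) ⊕ (H.obj (A, B)).Word k (s i))
    (hc : ∀ i j, Comparable (x i) (x j)) (b : ∀ i, B.carrier (s i))
    (hx : ∀ i, h.match₂ A B _ ((H.obj (A, B)).ekCounit k _ (x i)) (b i)) :
    ∃ z : ∀ i, (L.E C₂).Con (s i) ⊕ B.Word k (s i), (∀ i j, Comparable (z i) (z j)) ∧
      (∀ i, B.ekCounit k _ (z i) = b i) ∧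
      ∀ i, h.match₂ (A.ek k) (B.ek k) _ (h.kappaFun A B k _ (x i)) (z i) := by
  have hz : ∀ i, ∃ z : (L.E C₂).Con (s i) ⊕ B.Word k (s i), B.ekCounit k _ z = b i ∧
      h.match₂ (A.ek k) (B.ek k) _ (h.kappaFun A B k _ (x i)) z ∧
      ((∃ c, z = Sum.inl c) ∨ ∃ w b', x i = Sum.inr w ∧ h.ext₂ A B _ w.last = some b' ∧
        z = Sum.inr (extWord (h.ext₂ A B) w b')) := by
    intro i
    rcases h.kappa_match₂ (x i) (b i) (hx i) with ⟨c, c', _, hb, hm⟩ | ⟨w, b', hw, hb, he, hm⟩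
    · exact ⟨Sum.inl c', hb.symm, hm, Or.inl ⟨c', rfl⟩⟩
    · exact ⟨Sum.inr (extWord (h.ext₂ A B) w b'), hb.symm, hm, Or.inr ⟨w, b', hw, he, rfl⟩⟩
  choose z hz hm hz' using hz
  refine ⟨z, fun i j => ?_, hz, hm⟩
  rcases hz' i with ⟨c, hc⟩ | ⟨v, b₁, hv, hb₁, hzi⟩
  · rw [hc]
    trivial
  rcases hz' j with ⟨c, hc⟩ | ⟨w, b₂, hw, hb₂, hzj⟩
  · rw [hc, hzi]
    trivial
  rw [hzi, hzj]
  have := hc i j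
  rw [hv, hw] at this
  exact this.extWord _ _ _ _ _ hb₁ hb₂

variable (A B k) in
/-- The component of the Kleisli law at `(A, B)`. -/
def kappaHom : (Ek (L.E C₃) D₃ k).obj (H.obj (A, B)) ⟶
    H.obj ((Ek (L.E C₁) D₁ k).obj A, (Ek (L.E C₂) D₂ k).obj B) where
  toFun s x := h.kappaFun A B k s x
  map_con _ _ := rfl
  map_rel R x hx := by
    obtain ⟨hc, hr⟩ := hx
    refine (h.rel_iff _ _ R _).mpr ?_
    rcases (h.rel_iff A B R _).mp hr with ⟨a, ha, hm⟩ | ⟨b, hb, hm⟩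
    · obtain ⟨z, hz, hza, hzm⟩ := h.kappa_lift₁ x hc a hm
      exact Or.inl ⟨z, ⟨hz, (congrArg (A.rel R) (funext hza)).mpr ha⟩, hzm⟩
    · obtain ⟨z, hz, hzb, hzm⟩ := h.kappa_lift₂ x hc b hm
      exact Or.inr ⟨z, ⟨hz, (congrArg (B.rel R) (funext hzb)).mpr hb⟩, hzm⟩
  map_nc s x hx := by
    rcases x with c | w
    · exact absurd (ek_isCon_inl k _ c) hx
    · exact (h.kappaWord w).2

end SumLike

theorem option_map_map_congr {α β β' γ : Type*} (o : Option α) {f : α → β} {g : β → γ}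
    {f' : α → β'} {g' : β' → γ} (h : ∀ a, g (f a) = g' (f' a)) :
    (o.map f).map g = (o.map f').map g' := by
  cases o with
  | none => rfl
  | some a => exact congrArg some (h a)

theorem option_map_map_id {α β : Type*} (o : Option α) {f : α → β} {g : β → α}
    (h : ∀ a, g (f a) = a) : (o.map f).map g = o := by
  cases o with
  | none => rfl
  | some a => exact congrArg some (h a)

namespace MStr

/-- Homomorphisms out of a structure of words are determined by their values at words. -/
theorem ek_hom_ext {S : Type} {σ : MSig.{u} S} {D : ∀ s, Set (σ.Con s)} {k : ℕ} {X Y : MStr σ D}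
    {f g : (Ek σ D k).obj X ⟶ Y}
    (h : ∀ s (w : X.Word k s), Hom.onNC f w.nc = Hom.onNC g w.nc) : f = g := by
  ext s x
  rcases x with c | w
  · exact (f.map_con s c).trans (g.map_con s c).symm
  · exact congrArg Subtype.val (h s w)

end MStr

namespace SumLike

variable {L : RSig.{u}} {C₁ C₂ C₃ : Type u} {D₁ : ∀ s, Set ((L.E C₁).Con s)}
    {D₂ : ∀ s, Set ((L.E C₂).Con s)} {D₃ : ∀ s, Set ((L.E C₃).Con s)}
    {H : MStr (L.E C₁) D₁ × MStr (L.E C₂) D₂ ⥤ MStr (L.E C₃) D₃} (h : SumLike H)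
    {A A' : MStr (L.E C₁) D₁} {B B' : MStr (L.E C₂) D₂} {k : ℕ}

theorem kappa_naturality (f : A ⟶ A') (g : B ⟶ B') :
    (Ek (L.E C₃) D₃ k).map (H.map (Prod.mkHom f g)) ≫ h.kappaHom A' B' k =
      h.kappaHom A B k ≫ H.map (Prod.mkHom ((Ek (L.E C₁) D₁ k).map f)
        ((Ek (L.E C₂) D₂ k).map g)) := by
  apply ek_hom_ext
  intro s w
  change h.kappaWord (w.map (H.map (Prod.mkHom f g))) =
    Hom.onNC (H.map (Prod.mkHom ((Ek (L.E C₁) D₁ k).map f) ((Ek (L.E C₂) D₂ k).map g)))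
      (h.kappaWord w)
  apply h.nc_ext
  · refine (h.ext₁_kappaWord _).trans (Eq.trans ?_ (h.ext₁_map _ _ s _).symm)
    refine Eq.trans ?_ (congrArg (Option.map _) (h.ext₁_kappaWord w)).symm
    have : (w.map (H.map (Prod.mkHom f g))).last = Hom.onNC (H.map (Prod.mkHom f g)) w.last := rfl
    rw [this, h.ext₁_map]
    exact option_map_map_congr _ fun a => congrArg Word.nc (map_extWord (h.ext₁_map f g) w a).symm
  · refine (h.ext₂_kappaWord _).trans (Eq.trans ?_ (h.ext₂_map _ _ s _).symm)
    refine Eq.trans ?_ (congrArg (Option.map _) (h.ext₂_kappaWord w)).symm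
    have : (w.map (H.map (Prod.mkHom f g))).last = Hom.onNC (H.map (Prod.mkHom f g)) w.last := rfl
    rw [this, h.ext₂_map]
    exact option_map_map_congr _ fun a => congrArg Word.nc (map_extWord (h.ext₂_map f g) w a).symm

variable (k) in
/-- The Kleisli law. -/
def kappa : KleisliTrans (Ek (L.E C₁) D₁ k) (Ek (L.E C₂) D₂ k) (Ek (L.E C₃) D₃ k) H where
  app P := h.kappaHom P.1 P.2 k
  naturality _ _ f := h.kappa_naturality f.1 f.2

theorem isKleisliLaw_kappa : (h.kappa k).IsKleisliLaw where
  counit A B := by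
    apply ek_hom_ext
    intro s w
    change Hom.onNC (H.map (Prod.mkHom ((Ek (L.E C₁) D₁ k).ε.app A) ((Ek (L.E C₂) D₂ k).ε.app B)))
      (h.kappaWord w) = w.last
    apply h.nc_ext
    · refine (h.ext₁_map _ _ s _).trans ((congrArg (Option.map _) (h.ext₁_kappaWord w)).trans ?_)
      exact option_map_map_id _ fun _ => rfl
    · refine (h.ext₂_map _ _ s _).trans ((congrArg (Option.map _) (h.ext₂_kappaWord w)).trans ?_)
      exact option_map_map_id _ fun _ => rfl
  comult A B := by
    apply ek_hom_ext
    intro s w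
    change Hom.onNC (H.map (Prod.mkHom ((Ek (L.E C₁) D₁ k).δ.app A) ((Ek (L.E C₂) D₂ k).δ.app B)))
      (h.kappaWord w) = h.kappaWord (w.dup.map (h.kappaHom A B k))
    apply h.nc_ext
    · refine (h.ext₁_map _ _ s _).trans ((congrArg (Option.map _) (h.ext₁_kappaWord w)).trans ?_)
      refine Eq.trans ?_ (h.ext₁_kappaWord _).symm
      refine Eq.trans ?_ (congrArg (Option.map _) (h.ext₁_kappaWord w)).symm
      exact option_map_map_congr _ fun a => congrArg Word.nc (dup_extWord (h.ext₁ A B)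
        (h.ext₁ (A.ek k) (B.ek k)) (h.kappaHom A B k) (fun s w => h.ext₁_kappaWord w) w a)
    · refine (h.ext₂_map _ _ s _).trans ((congrArg (Option.map _) (h.ext₂_kappaWord w)).trans ?_)
      refine Eq.trans ?_ (h.ext₂_kappaWord _).symm
      refine Eq.trans ?_ (congrArg (Option.map _) (h.ext₂_kappaWord w)).symm
      exact option_map_map_congr _ fun a => congrArg Word.nc (dup_extWord (h.ext₂ A B)
        (h.ext₂ (A.ek k) (B.ek k)) (h.kappaHom A B k) (fun s w => h.ext₂_kappaWord w) w a)

end SumLike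

/-! ### Smoothness -/

theorem MStr.ofCofree_cofreeComult {S : Type} {σ : MSig.{u} S} {D : ∀ s, Set (σ.Con s)} {k : ℕ}
    {P : (Ek σ D k).Coalgebra} {X : MStr σ D} (e : P ⟶ (Ek σ D k).cofree.obj X) :
    ofCofree (e ≫ cofreeComult (Ek σ D k) X) = e.f := by
  rw [ofCofree_eq]
  ext s x
  exact toFun_congr ((Ek σ D k).left_counit X) s (e.f.toFun s x)

namespace SumLike

variable {L : RSig.{u}} {C₁ C₂ C₃ : Type u} {D₁ : ∀ s, Set ((L.E C₁).Con s)}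
    {D₂ : ∀ s, Set ((L.E C₂).Con s)} {D₃ : ∀ s, Set ((L.E C₃).Con s)}
    {H : MStr (L.E C₁) D₁ × MStr (L.E C₂) D₂ ⥤ MStr (L.E C₃) D₃} (h : SumLike H)
    {k : ℕ} {Q : (Ek (L.E C₃) D₃ k).Coalgebra} {α α' : (Ek (L.E C₁) D₁ k).Coalgebra}
    {β β' : (Ek (L.E C₂) D₂ k).Coalgebra}

/-- The homomorphisms that correspond to the coalgebra morphisms from `Q` to the lift of `H` at
`(α, β)`. -/
def IsLift (α : (Ek (L.E C₁) D₁ k).Coalgebra) (β : (Ek (L.E C₂) D₂ k).Coalgebra)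
    (t : Q.A ⟶ H.obj (α.A, β.A)) : Prop :=
  Q.a ≫ (Ek (L.E C₃) D₃ k).map t ≫ h.kappaHom α.A β.A k = t ≫ H.map (Prod.mkHom α.a β.a)

theorem isLift_iff (e : Q ⟶ (Ek (L.E C₃) D₃ k).cofree.obj (H.obj (α.A, β.A))) :
    h.IsLift α β (ofCofree e) ↔
      e ≫ (h.kappa k).liftLeft α β = e ≫ (h.kappa k).liftRight α β := by
  have h1 : ofCofree (e ≫ (h.kappa k).liftLeft α β) =
      Q.a ≫ (Ek (L.E C₃) D₃ k).map (ofCofree e) ≫ h.kappaHom α.A β.A k := by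
    rw [KleisliTrans.liftLeft, ← Category.assoc, ofCofree_comp_map, ← Category.assoc]
    congr 1
    rw [← toCofree_f, toCofree_ofCofree, ofCofree_cofreeComult]
  have h2 : ofCofree (e ≫ (h.kappa k).liftRight α β) =
      ofCofree e ≫ H.map (Prod.mkHom α.a β.a) := ofCofree_comp_map _ _
  rw [IsLift, ← h1, ← h2]
  exact ⟨fun h => ofCofree_injective h, fun h => congrArg _ h⟩

variable {h}

theorem IsLift.comp_map {t : Q.A ⟶ H.obj (α.A, β.A)} (ht : h.IsLift α β t) (f : α ⟶ α')
    (g : β ⟶ β') : h.IsLift α' β' (t ≫ H.map (Prod.mkHom f.f g.f)) := by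
  have e1 : Prod.mkHom f.f g.f ≫ Prod.mkHom α'.a β'.a = Prod.mkHom α.a β.a ≫
      Prod.mkHom ((Ek (L.E C₁) D₁ k).map f.f) ((Ek (L.E C₂) D₂ k).map g.f) :=
    Prod.ext f.h.symm g.h.symm
  rw [IsLift, Functor.map_comp, Category.assoc, h.kappa_naturality, Category.assoc,
    ← H.map_comp, e1, H.map_comp, ← Category.assoc t, ← ht]
  simp only [Category.assoc]

/-- The lifting condition can be checked after composition with an embedding. -/
theorem IsLift.of_comp_map {t : Q.A ⟶ H.obj (α.A, β.A)} {f : α ⟶ α'} {g : β ⟶ β'}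
    (hf : IsEmb f.f) (hg : IsEmb g.f) (ht : h.IsLift α' β' (t ≫ H.map (Prod.mkHom f.f g.f))) :
    h.IsLift α β t := by
  have e1 : Prod.mkHom f.f g.f ≫ Prod.mkHom α'.a β'.a = Prod.mkHom α.a β.a ≫
      Prod.mkHom ((Ek (L.E C₁) D₁ k).map f.f) ((Ek (L.E C₂) D₂ k).map g.f) :=
    Prod.ext f.h.symm g.h.symm
  apply (h.isEmb_map (hf.ek_map (k := k)) (hg.ek_map (k := k))).cancel
  rw [IsLift, Functor.map_comp, Category.assoc, h.kappa_naturality, Category.assoc,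
    ← H.map_comp, e1, H.map_comp] at ht
  simp only [Category.assoc] at ht ⊢
  exact ht

/-- For a lift `t`, the word of a component of `t x` consists of the components of the letters in the
image of the word of `x`. -/
theorem IsLift.extracts₁ {t : Q.A ⟶ H.obj (α.A, β.A)} (ht : h.IsLift α β t) :
    Extracts (h.ext₁ α.A β.A) t := by
  intro s x a ha
  have hx : Hom.onNC (H.map (Prod.mkHom α.a β.a)) (Hom.onNC t x) =
      h.kappaWord ((word Q x).map t) := by
    apply Subtype.ext
    refine (toFun_congr ht s x.1).symm.trans ?_
    show h.kappaFun α.A β.A k s (Sum.map id (Word.map t) (Q.a.toFun s x.1)) = _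
    rw [a_eq_word Q x]
    rfl
  have h1 := (h.ext₁_map α.a β.a s (Hom.onNC t x)).symm.trans
    ((congrArg (h.ext₁ _ _ s) hx).trans (h.ext₁_kappaWord _))
  have hl : ((word Q x).map t).last = Hom.onNC t x := congrArg (Hom.onNC t) (word_last Q x)
  rw [hl, ha] at h1
  exact word_eq α (congrArg Subtype.val (Option.some_injective _ h1))

theorem IsLift.extracts₂ {t : Q.A ⟶ H.obj (α.A, β.A)} (ht : h.IsLift α β t) :
    Extracts (h.ext₂ α.A β.A) t := by
  intro s x a ha
  have hx : Hom.onNC (H.map (Prod.mkHom α.a β.a)) (Hom.onNC t x) =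
      h.kappaWord ((word Q x).map t) := by
    apply Subtype.ext
    refine (toFun_congr ht s x.1).symm.trans ?_
    show h.kappaFun α.A β.A k s (Sum.map id (Word.map t) (Q.a.toFun s x.1)) = _
    rw [a_eq_word Q x]
    rfl
  have h1 := (h.ext₂_map α.a β.a s (Hom.onNC t x)).symm.trans
    ((congrArg (h.ext₂ _ _ s) hx).trans (h.ext₂_kappaWord _))
  have hl : ((word Q x).map t).last = Hom.onNC t x := congrArg (Hom.onNC t) (word_last Q x)
  rw [hl, ha] at h1
  exact word_eq β (congrArg Subtype.val (Option.some_injective _ h1))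

/-- The subcoalgebra of the first components of the values of `t`. -/
noncomputable abbrev IsLift.sub₁ {t : Q.A ⟶ H.obj (α.A, β.A)} (ht : h.IsLift α β t) :
    (Ek (L.E C₁) D₁ k).Coalgebra := sub ht.extracts₁.isDown

/-- The subcoalgebra of the second components of the values of `t`. -/
noncomputable abbrev IsLift.sub₂ {t : Q.A ⟶ H.obj (α.A, β.A)} (ht : h.IsLift α β t) :
    (Ek (L.E C₂) D₂ k).Coalgebra := sub ht.extracts₂.isDown

/-- The inclusion of the subcoalgebra of first components. -/
noncomputable abbrev IsLift.inc₁ {t : Q.A ⟶ H.obj (α.A, β.A)} (ht : h.IsLift α β t) :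
    ht.sub₁ ⟶ α := subHom ht.extracts₁.isDown

/-- The inclusion of the subcoalgebra of second components. -/
noncomputable abbrev IsLift.inc₂ {t : Q.A ⟶ H.obj (α.A, β.A)} (ht : h.IsLift α β t) :
    ht.sub₂ ⟶ β := subHom ht.extracts₂.isDown

theorem IsLift.isEmb_inc {t : Q.A ⟶ H.obj (α.A, β.A)} (ht : h.IsLift α β t) :
    IsEmb (H.map (Prod.mkHom ht.inc₁.f ht.inc₂.f)) :=
  h.isEmb_map (isEmb_subHom _) (isEmb_subHom _)

/-- A lift factors through its subcoalgebras of components. -/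
theorem IsLift.exists_factor {t : Q.A ⟶ H.obj (α.A, β.A)} (ht : h.IsLift α β t) :
    ∃ t' : Q.A ⟶ H.obj (ht.sub₁.A, ht.sub₂.A),
      t' ≫ H.map (Prod.mkHom ht.inc₁.f ht.inc₂.f) = t ∧ h.IsLift ht.sub₁ ht.sub₂ t' := by
  obtain ⟨t', ht'⟩ := ht.isEmb_inc.exists_factor t (fun s x => by
    by_cases hx : Q.A.IsCon x
    · obtain ⟨c, rfl⟩ := hx
      exact ⟨(H.obj (ht.sub₁.A, ht.sub₂.A)).con s c, by rw [Hom.map_con, Hom.map_con]⟩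
    · obtain ⟨y, hy⟩ := h.exists_map_eq ht.inc₁.f ht.inc₂.f (Hom.onNC t ⟨x, hx⟩)
        (fun a ha => by
          obtain ⟨⟨s', y⟩, hy⟩ := exists_onLetter_subι (T := supp (h.ext₁ α.A β.A) t)
            (y := ⟨s, a⟩) ⟨⟨s, x, hx⟩, congrArg (Option.map (Sigma.mk s)) ha⟩
          obtain rfl : s' = s := congrArg Sigma.fst hy
          exact ⟨y, sigma_mk_injective hy⟩)
        (fun a ha => by
          obtain ⟨⟨s', y⟩, hy⟩ := exists_onLetter_subι (T := supp (h.ext₂ α.A β.A) t)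
            (y := ⟨s, a⟩) ⟨⟨s, x, hx⟩, congrArg (Option.map (Sigma.mk s)) ha⟩
          obtain rfl : s' = s := congrArg Sigma.fst hy
          exact ⟨y, sigma_mk_injective hy⟩)
      exact ⟨y.1, congrArg Subtype.val hy⟩)
  exact ⟨t', ht', IsLift.of_comp_map (isEmb_subHom _) (isEmb_subHom _) (by rwa [ht'])⟩

/-- The maps between the subcoalgebras of components that are induced by a commutative square of
lifts. -/
theorem IsLift.exists_sub_map {P : (Ek (L.E C₃) D₃ k).Coalgebra} {t : P.A ⟶ H.obj (α.A, β.A)}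
    {t' : Q.A ⟶ H.obj (α'.A, β'.A)} (ht : h.IsLift α β t) (ht' : h.IsLift α' β' t') (e : P ⟶ Q)
    (f : α ⟶ α') (g : β ⟶ β') (hc : t ≫ H.map (Prod.mkHom f.f g.f) = e.f ≫ t') :
    (∃ u : ht.sub₁ ⟶ ht'.sub₁, u ≫ ht'.inc₁ = ht.inc₁ ≫ f) ∧
      ∃ v : ht.sub₂ ⟶ ht'.sub₂, v ≫ ht'.inc₂ = ht.inc₂ ≫ g := by
  have hx : ∀ x : P.A.Letter, Hom.onLetter (H.map (Prod.mkHom f.f g.f)) (Hom.onLetter t x) =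
      Hom.onLetter t' (Hom.onLetter e.f x) := by
    intro x
    exact congrArg (fun r : P.A ⟶ H.obj (α'.A, β'.A) => Hom.onLetter r x) hc
  constructor
  · apply exists_sub_factor
    intro y
    obtain ⟨x, hy⟩ := onLetter_subι_mem y
    refine ⟨Hom.onLetter e.f x, ?_⟩
    rw [← hx, extLetter_onLetter (h.ext₁_map f.f g.f), hy]
    rfl
  · apply exists_sub_factor
    intro y
    obtain ⟨x, hy⟩ := onLetter_subι_mem y
    refine ⟨Hom.onLetter e.f x, ?_⟩
    rw [← hx, extLetter_onLetter (h.ext₂_map f.f g.f), hy]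
    rfl

variable (h)

/-- The Kleisli law of a functor that behaves like a twisted sum is smooth. -/
theorem isSmooth_kappa : (h.kappa k).IsSmooth (ekPathData _ _ k) (ekPathData _ _ k)
    (ekPathData _ _ k) where
  isKleisliLaw := h.isKleisliLaw_kappa
  hasEqualizer _ _ := hasEqualizer_coalg _ _
  smooth {α α' β β'} f g hf hg s t hs ht l hl := by
    have hsι := isEmb_fork_ι s hs
    have htι := isEmb_fork_ι t ht
    have lift_s : ∀ {P} (e : P ⟶ s.pt), h.IsLift α β (ofCofree (e ≫ s.ι)) := fun e =>
      (h.isLift_iff _).mpr (by rw [Category.assoc, Category.assoc, s.condition])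
    have lift_t : ∀ {P} (e : P ⟶ t.pt), h.IsLift α' β' (ofCofree (e ≫ t.ι)) := fun e =>
      (h.isLift_iff _).mpr (by rw [Category.assoc, Category.assoc, t.condition])
    have of_l : ∀ {P} (e : P ⟶ s.pt), ofCofree ((e ≫ l) ≫ t.ι) =
        ofCofree (e ≫ s.ι) ≫ H.map (Prod.mkHom f.f g.f) := fun e => by
      rw [← ofCofree_comp_map, Category.assoc, Category.assoc, hl]
    have map_map : ∀ {A A' A'' B B' B''} (a : A ⟶ A') (a' : A' ⟶ A'') (b : B ⟶ B')
        (b' : B' ⟶ B''), H.map (Prod.mkHom a b) ≫ H.map (Prod.mkHom a' b') =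
          H.map (Prod.mkHom (a ≫ a') (b ≫ b')) := fun _ _ _ _ => (H.map_comp _ _).symm
    constructor
    · intro P e hP he
      have hes : IsStrong (ofCofree (e ≫ s.ι)) :=
        (isEmb_iff_isStrong hP _).mp (IsEmb.comp he hsι)
      obtain ⟨x, hL, hx⟩ : ∃ x, h.IsLift α β x ∧ ofCofree (e ≫ s.ι) = x := ⟨_, lift_s e, rfl⟩
      -- `x` factors as a strong homomorphism `r` followed by the value of `H` at path embeddings into
      -- `α` and `β`, whose composites with `f` and `g` are embeddings
      obtain ⟨r, hr, -⟩ := hL.exists_factor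
      rw [hx, ← hr] at hes
      have h₁ : IsEmb (hL.inc₁.f ≫ f.f) := hf.1 hL.inc₁ (hL.extracts₁.path hP) (isEmb_subHom _)
      have h₂ : IsEmb (hL.inc₂.f ≫ g.f) := hg.1 hL.inc₂ (hL.extracts₂.path hP) (isEmb_subHom _)
      have hstr : IsStrong (ofCofree ((e ≫ l) ≫ t.ι)) := by
        rw [of_l, hx]
        have e1 := congrArg (· ≫ H.map (Prod.mkHom f.f g.f)) hr
        simp only [Category.assoc, map_map] at e1
        rw [← e1]
        exact hes.of_comp.comp (h.isEmb_map h₁ h₂).2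
      exact IsEmb.of_comp (g := t.ι.f) ((isEmb_iff_isStrong hP _).mpr hstr)
    · intro P Q e p q hP hQ he hp hq hc
      obtain ⟨x, hLP, hx⟩ : ∃ x, h.IsLift α β x ∧ ofCofree (p ≫ s.ι) = x := ⟨_, lift_s p, rfl⟩
      obtain ⟨y, hLQ, hy⟩ : ∃ y, h.IsLift α' β' y ∧ ofCofree (q ≫ t.ι) = y := ⟨_, lift_t q, rfl⟩
      have hsq : x ≫ H.map (Prod.mkHom f.f g.f) = e.f ≫ y := by
        rw [← hx, ← hy, ← of_l, hc, Category.assoc, ofCofree_comp]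
      obtain ⟨rP, hrP, -⟩ := hLP.exists_factor
      obtain ⟨rQ, hrQ, hrQL⟩ := hLQ.exists_factor
      obtain ⟨⟨u, hu⟩, ⟨v, hv⟩⟩ := hLP.exists_sub_map hLQ e f g hsq
      have hP₁ := hLP.extracts₁.path hP
      have hP₂ := hLP.extracts₂.path hP
      -- the induced maps of components are embeddings, since `f` and `g` are pathwise-embeddings
      have hue : IsEmb u.f := by
        have h₁ : IsEmb (hLP.inc₁ ≫ f).f := hf.1 hLP.inc₁ hP₁ (isEmb_subHom _)
        rw [← hu] at h₁
        exact IsEmb.of_comp (g := hLQ.inc₁.f) h₁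
      have hve : IsEmb v.f := by
        have h₁ : IsEmb (hLP.inc₂ ≫ g).f := hg.1 hLP.inc₂ hP₂ (isEmb_subHom _)
        rw [← hv] at h₁
        exact IsEmb.of_comp (g := hLQ.inc₂.f) h₁
      -- openness of `f` and `g` gives diagonals for the squares of components; their image under `H`,
      -- composed with the factor `rQ` of `y`, is the diagonal for the given square
      obtain ⟨d₁, hd₁, hd₁'⟩ := hf.2 u hLP.inc₁ hLQ.inc₁ hP₁ (hLQ.extracts₁.path hQ) hue
        (isEmb_subHom _) (isEmb_subHom _) hu.symm
      obtain ⟨d₂, hd₂, hd₂'⟩ := hg.2 v hLP.inc₂ hLQ.inc₂ hP₂ (hLQ.extracts₂.path hQ) hve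
        (isEmb_subHom _) (isEmb_subHom _) hv.symm
      replace hu := congrArg Comonad.Coalgebra.Hom.f hu
      replace hv := congrArg Comonad.Coalgebra.Hom.f hv
      replace hd₁ := congrArg Comonad.Coalgebra.Hom.f hd₁
      replace hd₂ := congrArg Comonad.Coalgebra.Hom.f hd₂
      replace hd₁' := congrArg Comonad.Coalgebra.Hom.f hd₁'
      replace hd₂' := congrArg Comonad.Coalgebra.Hom.f hd₂'
      rw [Comonad.Coalgebra.comp_f] at hd₁ hd₂ hd₁' hd₂'
      rw [Comonad.Coalgebra.comp_f, Comonad.Coalgebra.comp_f] at hu hv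
      have hr : rP ≫ H.map (Prod.mkHom u.f v.f) = e.f ≫ rQ := by
        apply hLQ.isEmb_inc.cancel
        rw [Category.assoc, map_map, hu, hv, ← map_map, ← Category.assoc, hrP, Category.assoc,
          hrQ, hsq]
      have hd : h.IsLift α β (rQ ≫ H.map (Prod.mkHom d₁.f d₂.f)) := hrQL.comp_map d₁ d₂
      obtain ⟨m, hm⟩ : ∃ m : Q ⟶ s.pt,
          ofCofree (m ≫ s.ι) = rQ ≫ H.map (Prod.mkHom d₁.f d₂.f) := by
        obtain ⟨hs⟩ := hs
        have hd' : toCofree (rQ ≫ H.map (Prod.mkHom d₁.f d₂.f)) ≫ (h.kappa k).liftLeft α β =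
            toCofree (rQ ≫ H.map (Prod.mkHom d₁.f d₂.f)) ≫ (h.kappa k).liftRight α β := by
          rw [← isLift_iff, ofCofree_toCofree]
          exact hd
        exact ⟨Limits.Fork.IsLimit.lift hs _ hd', by
          rw [Limits.Fork.IsLimit.lift_ι', ofCofree_toCofree]⟩
      have h1 : (e ≫ m) ≫ s.ι = p ≫ s.ι := by
        apply ofCofree_injective
        rw [Category.assoc, ofCofree_comp, hm, hx, ← Category.assoc, ← hr, Category.assoc,
          map_map, hd₁, hd₂, hrP]
      have h2 : (m ≫ l) ≫ t.ι = q ≫ t.ι := by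
        apply ofCofree_injective
        rw [of_l, hm, hy, Category.assoc, map_map, hd₁', hd₂', hrQ]
      exact ⟨m, Comonad.Coalgebra.Hom.ext (hsι.cancel (congrArg Comonad.Coalgebra.Hom.f h1)),
        Comonad.Coalgebra.Hom.ext (htι.cancel (congrArg Comonad.Coalgebra.Hom.f h2))⟩

end SumLike

/-! ### Gluing -/

namespace Glue

variable {N : Type u} {C₁ C₂ : Set N} {X Y : Type u} {c₁ : C₁ → X} {c₂ : C₂ → Y}

/-- Predicates on the two components that agree on shared constants descend to the quotient. -/
theorem lift_pred (p : X → Prop) (q : Y → Prop)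
    (h : ∀ c (h₁ : c ∈ C₁) (h₂ : c ∈ C₂), p (c₁ ⟨c, h₁⟩) ↔ q (c₂ ⟨c, h₂⟩)) :
    ∃ r : Glue c₁ c₂ → Prop, (∀ a, r (inc₁ a) ↔ p a) ∧ ∀ b, r (inc₂ b) ↔ q b :=
  ⟨Quot.lift (Sum.elim p q) (by
    rintro _ _ ⟨c, h₁, h₂⟩
    exact propext (h c h₁ h₂)), fun _ => Iff.rfl, fun _ => Iff.rfl⟩

/-- An element which interprets no constant is identified with no other element. -/
theorem inc₁_eq_inc₁_of_nc {a a' : X} (ha' : ¬ ∃ c, c₁ c = a')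
    (h : (inc₁ a : Glue c₁ c₂) = inc₁ a') : a = a' := by
  obtain ⟨r, h₁, -⟩ := lift_pred (c₁ := c₁) (c₂ := c₂) (· = a') (fun _ => False)
    (fun c h₁ _ => ⟨fun h => ha' ⟨_, h⟩, False.elim⟩)
  rw [← h₁, h, h₁]

theorem inc₂_eq_inc₂_of_nc {b b' : Y} (hb' : ¬ ∃ c, c₂ c = b')
    (h : (inc₂ b : Glue c₁ c₂) = inc₂ b') : b = b' := by
  obtain ⟨r, -, h₂⟩ := lift_pred (c₁ := c₁) (c₂ := c₂) (fun _ => False) (· = b')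
    (fun c _ h₂ => ⟨False.elim, fun h => hb' ⟨_, h⟩⟩)
  rw [← h₂, h, h₂]

theorem inc₁_ne_inc₂_of_nc {a : X} {b : Y} (ha : ¬ ∃ c, c₁ c = a) :
    (inc₁ a : Glue c₁ c₂) ≠ inc₂ b := by
  intro h
  obtain ⟨r, h₁, h₂⟩ := lift_pred (c₁ := c₁) (c₂ := c₂) (· = a) (fun _ => False)
    (fun c h₁ _ => ⟨fun h => ha ⟨_, h⟩, False.elim⟩)
  rw [← h₂ b, ← h, h₁]

theorem inc₁_ne_inc₂_of_nc' {a : X} {b : Y} (hb : ¬ ∃ c, c₂ c = b) :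
    (inc₁ a : Glue c₁ c₂) ≠ inc₂ b := by
  intro h
  obtain ⟨r, h₁, h₂⟩ := lift_pred (c₁ := c₁) (c₂ := c₂) (fun _ => False) (· = b)
    (fun c _ h₂ => ⟨False.elim, fun h => hb ⟨_, h⟩⟩)
  rw [← h₁ a, h, h₂]

/-- Shared constants are interpreted by elements which interpret no other constant. -/
def Apart (c₁ : C₁ → X) (c₂ : C₂ → Y) : Prop :=
  (∀ c d : C₁, c.1 ∈ C₂ → c₁ c = c₁ d → c = d) ∧ ∀ c d : C₂, c.1 ∈ C₁ → c₂ c = c₂ d → c = d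

/-- If shared constants are apart, a constant is glued just to its own interpretations. -/
theorem Apart.exists_pred (h : Apart c₁ c₂) (c : N) : ∃ r : Glue c₁ c₂ → Prop,
    (∀ a, r (inc₁ a) ↔ ∃ hc : c ∈ C₁, c₁ ⟨c, hc⟩ = a) ∧
      ∀ b, r (inc₂ b) ↔ ∃ hc : c ∈ C₂, c₂ ⟨c, hc⟩ = b := by
  apply lift_pred
  intro d h₁ h₂
  constructor
  · rintro ⟨hc, hd⟩
    obtain rfl : d = c := congrArg Subtype.val (h.1 ⟨d, h₁⟩ ⟨c, hc⟩ h₂ hd.symm)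
    exact ⟨h₂, rfl⟩
  · rintro ⟨hc, hd⟩
    obtain rfl : d = c := congrArg Subtype.val (h.2 ⟨d, h₂⟩ ⟨c, hc⟩ h₁ hd.symm)
    exact ⟨h₁, rfl⟩

theorem Apart.inc₁_eq_con (h : Apart c₁ c₂) {a : X} {c : ↥(C₁ ∪ C₂)} :
    inc₁ a = con c₁ c₂ c ↔ ∃ hc : c.1 ∈ C₁, c₁ ⟨c.1, hc⟩ = a := by
  obtain ⟨r, h₁, h₂⟩ := h.exists_pred c.1
  constructor
  · intro he
    rw [← h₁, he]
    obtain ⟨c, hc | hc⟩ := c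
    · rw [con_left c hc, h₁]
      exact ⟨hc, rfl⟩
    · rw [con_right c hc, h₂]
      exact ⟨hc, rfl⟩
  · rintro ⟨hc, rfl⟩
    exact (con_left c.1 hc).symm

theorem Apart.inc₂_eq_con (h : Apart c₁ c₂) {b : Y} {c : ↥(C₁ ∪ C₂)} :
    inc₂ b = con c₁ c₂ c ↔ ∃ hc : c.1 ∈ C₂, c₂ ⟨c.1, hc⟩ = b := by
  obtain ⟨r, h₁, h₂⟩ := h.exists_pred c.1
  constructor
  · intro he
    rw [← h₂, he]
    obtain ⟨c, hc | hc⟩ := c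
    · rw [con_left c hc, h₁]
      exact ⟨hc, rfl⟩
    · rw [con_right c hc, h₂]
      exact ⟨hc, rfl⟩
  · rintro ⟨hc, rfl⟩
    exact (con_right c.1 hc).symm

/-- If shared constants are apart in the second pair of interpretations, constants that it glues are
glued by every pair of interpretations with at least the same equalities. -/
theorem con_eq_of_apart {X' Y' : Type u} {c₁' : C₁ → X'} {c₂' : C₂ → Y'} (h' : Apart c₁' c₂')
    (hf : ∀ c d, c₁' c = c₁' d → c₁ c = c₁ d) (hg : ∀ c d, c₂' c = c₂' d → c₂ c = c₂ d)
    {c d : ↥(C₁ ∪ C₂)} (h : con c₁' c₂' c = con c₁' c₂' d) : con c₁ c₂ c = con c₁ c₂ d := by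
  obtain ⟨c, hc | hc⟩ := c
  · rw [con_left c hc, h'.inc₁_eq_con] at h
    obtain ⟨hd, h⟩ := h
    exact (con_left c hc).trans ((congrArg inc₁ (hf _ _ h.symm)).trans (con_left d.1 hd).symm)
  · rw [con_right c hc, h'.inc₂_eq_con] at h
    obtain ⟨hd, h⟩ := h
    exact (con_right c hc).trans ((congrArg inc₂ (hg _ _ h.symm)).trans (con_right d.1 hd).symm)

end Glue

/-! ### The twisted sum of structures with separated shared constants -/

namespace TwistedSum

variable {L : RSig.{u}} {N : Type u} {C₁ C₂ : Set N}

section Join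

variable {D₁ : ∀ s, Set ((L.E C₁).Con s)} {D₂ : ∀ s, Set ((L.E C₂).Con s)}

variable (A : MStr (L.E C₁) D₁) (B : MStr (L.E C₂) D₂)

/-- The non-constant elements of the twisted sum, from those of the components. -/
def join : ∀ s, SortSum A.NC B.NC s → (obj A B).NC s
  | .fst, .inl a => ⟨incA A B a.1, fun h => a.2 (isCon_incA.mp h)⟩
  | .fst, .inr b => ⟨incB A B b.1, fun h => b.2 (isCon_incB.mp h)⟩
  | .snd, (a, b) => ⟨(a.1, b.1), fun ⟨c, _⟩ => c.elim⟩

theorem join_bijective (s : Sort2) : Function.Bijective (join A B s) := by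
  rcases s with _ | _
  · constructor
    · rintro (a | b) (a' | b') h
      · exact congrArg Sum.inl (Subtype.ext
          (Glue.inc₁_eq_inc₁_of_nc (C₁ := C₁) (C₂ := C₂) a'.2 (congrArg Subtype.val h)))
      · exact absurd (congrArg Subtype.val h)
          (Glue.inc₁_ne_inc₂_of_nc (C₁ := C₁) (C₂ := C₂) a.2)
      · exact absurd (congrArg Subtype.val h).symm
          (Glue.inc₁_ne_inc₂_of_nc (C₁ := C₁) (C₂ := C₂) a'.2)
      · exact congrArg Sum.inr (Subtype.ext
          (Glue.inc₂_eq_inc₂_of_nc (C₁ := C₁) (C₂ := C₂) b'.2 (congrArg Subtype.val h)))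
    · rintro ⟨x, hx⟩
      obtain ⟨a, rfl⟩ | ⟨b, rfl⟩ := exists_inc x
      · exact ⟨.inl ⟨a, fun h => hx (isCon_incA.mpr h)⟩, rfl⟩
      · exact ⟨.inr ⟨b, fun h => hx (isCon_incB.mpr h)⟩, rfl⟩
  · constructor
    · rintro ⟨a, b⟩ ⟨a', b'⟩ h
      have h' := congrArg Subtype.val h
      exact Prod.ext (Subtype.ext (congrArg Prod.fst h')) (Subtype.ext (congrArg Prod.snd h'))
    · rintro x
      exact ⟨(fstSet x, sndSet x), rfl⟩

/-- The components of the non-constant elements of the twisted sum. -/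
noncomputable def split (s : Sort2) : (obj A B).NC s ≃ SortSum A.NC B.NC s :=
  (Equiv.ofBijective _ (join_bijective A B s)).symm

theorem split_join {s : Sort2} (z : SortSum A.NC B.NC s) : split A B s (join A B s z) = z :=
  (Equiv.ofBijective _ (join_bijective A B s)).symm_apply_apply z

/-- The elements of `A` that an element of the twisted sum comes from. -/
def match₁ : ∀ s, (obj A B).carrier s → A.carrier s → Prop
  | .fst => fun x a => incA A B a = x
  | .snd => fun x a => a = x.1

/-- The elements of `B` that an element of the twisted sum comes from. -/
def match₂ : ∀ s, (obj A B).carrier s → B.carrier s → Prop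
  | .fst => fun x b => incB A B b = x
  | .snd => fun x b => b = x.2

variable {A B}

theorem match₁_join {s : Sort2} (z : SortSum A.NC B.NC s) (a : A.carrier s) :
    match₁ A B s (join A B s z).1 a ↔ ∃ a', SortSum.pr₁ z = some a' ∧ a'.1 = a := by
  rcases s with _ | _
  · rcases z with a' | b
    · constructor
      · exact fun h => ⟨a', rfl, (Glue.inc₁_eq_inc₁_of_nc (C₁ := C₁) (C₂ := C₂) a'.2 h).symm⟩
      · rintro ⟨a', ha', rfl⟩
        obtain rfl := Option.some_injective _ ha'
        rfl
    · constructor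
      · exact fun h => absurd h (Glue.inc₁_ne_inc₂_of_nc' (C₁ := C₁) (C₂ := C₂) b.2)
      · rintro ⟨a', ha', -⟩
        cases ha'
  · obtain ⟨a', b⟩ := z
    constructor
    · exact fun h => ⟨a', rfl, h.symm⟩
    · rintro ⟨a', ha', rfl⟩
      obtain rfl := Option.some_injective _ ha'
      rfl

theorem match₁_iff {s : Sort2} (x : (obj A B).NC s) (a : A.carrier s) :
    match₁ A B s x.1 a ↔ ∃ a', SortSum.pr₁ (split A B s x) = some a' ∧ a'.1 = a := by
  obtain ⟨z, rfl⟩ := (join_bijective A B s).2 x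
  rw [split_join]
  exact match₁_join z a

theorem match₂_join {s : Sort2} (z : SortSum A.NC B.NC s) (b : B.carrier s) :
    match₂ A B s (join A B s z).1 b ↔ ∃ b', SortSum.pr₂ z = some b' ∧ b'.1 = b := by
  rcases s with _ | _
  · rcases z with a | b'
    · constructor
      · exact fun h => absurd h.symm (Glue.inc₁_ne_inc₂_of_nc (C₁ := C₁) (C₂ := C₂) a.2)
      · rintro ⟨b', hb', -⟩
        cases hb'
    · constructor
      · exact fun h => ⟨b', rfl, (Glue.inc₂_eq_inc₂_of_nc (C₁ := C₁) (C₂ := C₂) b'.2 h).symm⟩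
      · rintro ⟨b', hb', rfl⟩
        obtain rfl := Option.some_injective _ hb'
        rfl
  · obtain ⟨a, b'⟩ := z
    constructor
    · exact fun h => ⟨b', rfl, h.symm⟩
    · rintro ⟨b', hb', rfl⟩
      obtain rfl := Option.some_injective _ hb'
      rfl

theorem match₂_iff {s : Sort2} (x : (obj A B).NC s) (b : B.carrier s) :
    match₂ A B s x.1 b ↔ ∃ b', SortSum.pr₂ (split A B s x) = some b' ∧ b'.1 = b := by
  obtain ⟨z, rfl⟩ := (join_bijective A B s).2 x
  rw [split_join]
  exact match₂_join z b

theorem rel_iff (R : (L.E ↥(C₁ ∪ C₂)).Rel) (x : ∀ i, (obj A B).carrier ((L.E ↥(C₁ ∪ C₂)).sort R i)) :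
    (obj A B).rel R x ↔ (∃ a, A.rel R a ∧ ∀ i, match₁ A B _ (x i) (a i)) ∨
      ∃ b, B.rel R b ∧ ∀ i, match₂ A B _ (x i) (b i) := by
  rcases R with R | _ | _
  · exact Iff.rfl
  · exact Iff.rfl
  · constructor
    · rintro (⟨a, ha, h₀, h₁⟩ | ⟨b, hb, h₀, h₁⟩)
      · exact Or.inl ⟨a, ha, fun i => match i with | 0 => h₀ | 1 => h₁⟩
      · exact Or.inr ⟨b, hb, fun i => match i with | 0 => h₀ | 1 => h₁⟩
    · rintro (⟨a, ha, h⟩ | ⟨b, hb, h⟩)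
      · exact Or.inl ⟨a, ha, h 0, h 1⟩
      · exact Or.inr ⟨b, hb, h 0, h 1⟩

theorem onNC_map_join {A' : MStr (L.E C₁) D₁} {B' : MStr (L.E C₂) D₂} (f : A ⟶ A') (g : B ⟶ B')
    {s : Sort2} (z : SortSum A.NC B.NC s) :
    Hom.onNC ((functor L C₁ C₂ D₁ D₂).map (Prod.mkHom f g)) (join A B s z) =
      join A' B' s (SortSum.map (Hom.onNC f) (Hom.onNC g) z) := by
  rcases s with _ | _
  · rcases z with a | b <;> rfl
  · rfl

end Join

theorem apart (A : MStr (L.E C₁) (shared₁ C₁ C₂)) (B : MStr (L.E C₂) (shared₂ C₁ C₂)) :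
    Glue.Apart (C₁ := C₁) (C₂ := C₂) (A.con .fst) (B.con .fst) :=
  ⟨fun c d hc h => A.apart .fst c hc d h, fun c d hc h => B.apart .fst c hc d h⟩

variable (L C₁ C₂) in
/-- On structures with separated shared constants, constants match just themselves. -/
noncomputable def sumLike : SumLike (functor L C₁ C₂ (shared₁ C₁ C₂) (shared₂ C₁ C₂)) where
  split A B s := split A B s
  split_map {A A' B B'} f g s x := by
    obtain ⟨z, rfl⟩ := (join_bijective A B s).2 x
    exact ((congrArg (split A' B' s) (onNC_map_join f g z)).trans (split_join A' B' _)).trans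
      (congrArg _ (split_join A B z).symm)
  match₁ A B s := match₁ A B s
  match₂ A B s := match₂ A B s
  rel_iff A B R x := rel_iff R x
  match₁_nc _ _ _ x a := match₁_iff x a
  match₂_nc _ _ _ x b := match₂_iff x b
  conMatch₁ _ _
    | .fst => fun c c' => c'.1 = c.1
    | .snd => fun _ _ => True
  conMatch₂ _ _
    | .fst => fun c c' => c'.1 = c.1
    | .snd => fun _ _ => True
  match₁_con A B s c a := by
    rcases s with _ | _
    · refine ((apart A B).inc₁_eq_con (a := a) (c := c)).trans ?_
      constructor
      · exact fun ⟨hc, h⟩ => ⟨⟨c.1, hc⟩, h, rfl⟩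
      · rintro ⟨⟨c', hc⟩, h, rfl⟩
        exact ⟨hc, h⟩
    · exact c.elim
  match₂_con A B s c b := by
    rcases s with _ | _
    · refine ((apart A B).inc₂_eq_con (b := b) (c := c)).trans ?_
      constructor
      · exact fun ⟨hc, h⟩ => ⟨⟨c.1, hc⟩, h, rfl⟩
      · rintro ⟨⟨c', hc⟩, h, rfl⟩
        exact ⟨hc, h⟩
    · exact c.elim
  conMatch₁_ek _ _ _ s _ _ h := by
    rcases s with _ | _ <;> exact h
  conMatch₂_ek _ _ _ s _ _ h := by
    rcases s with _ | _ <;> exact h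
  conMatch₁_emb _ _ _ _ s _ _ h := by
    rcases s with _ | _ <;> exact h
  conMatch₂_emb _ _ _ _ s _ _ h := by
    rcases s with _ | _ <;> exact h
  con_emb {A A' B B'} f g hf hg s c d h := by
    rcases s with _ | _
    · refine Glue.con_eq_of_apart (C₁ := C₁) (C₂ := C₂) (apart A' B') (fun c d h => hf.1 .fst ?_)
        (fun c d h => hg.1 .fst ?_) h
      · exact (f.map_con .fst c).trans (h.trans (f.map_con .fst d).symm)
      · exact (g.map_con .fst c).trans (h.trans (g.map_con .fst d).symm)
    · exact c.elim

section Kappa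

variable (A : MStr (L.E C₁) (shared₁ C₁ C₂)) (B : MStr (L.E C₂) (shared₂ C₁ C₂)) {k : ℕ}

theorem split_of_left (x : (obj A B).NC .fst) (h : ∃ a, incA A B a = x.1) :
    split A B .fst x = Sum.inl (left x h) :=
  (congrArg (split A B .fst) (Subtype.ext h.choose_spec.symm :
    x = join A B .fst (Sum.inl (left x h)))).trans (split_join A B _)

theorem split_of_right (x : (obj A B).NC .fst) (h : ∃ b, incB A B b = x.1) :
    split A B .fst x = Sum.inr (right x h) :=
  (congrArg (split A B .fst) (Subtype.ext h.choose_spec.symm :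
    x = join A B .fst (Sum.inr (right x h)))).trans (split_join A B _)

theorem split_snd (x : (obj A B).NC .snd) : split A B .snd x = (fstSet x, sndSet x) :=
  split_join A B (s := .snd) (fstSet x, sndSet x)

theorem extLetter₁_eq (x : (obj A B).Letter) :
    extLetter₁ x = extLetter ((sumLike L C₁ C₂).ext₁ A B) x := by
  obtain ⟨_ | _, x⟩ := x
  · show _ = Option.map _ (SortSum.pr₁ (split A B .fst x))
    by_cases h : ∃ a, incA A B a = x.1
    · rw [split_of_left A B x h, extLetter₁, dif_pos h]
      rfl
    · rw [split_of_right A B x ((exists_inc x.1).resolve_left h), extLetter₁, dif_neg h]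
      rfl
  · exact congrArg (fun z => Option.map (Sigma.mk Sort2.snd) (SortSum.pr₁ z)) (split_snd A B x).symm

theorem extLetter₂_eq (x : (obj A B).Letter) :
    extLetter₂ x = extLetter ((sumLike L C₁ C₂).ext₂ A B) x := by
  obtain ⟨_ | _, x⟩ := x
  · show _ = Option.map _ (SortSum.pr₂ (split A B .fst x))
    by_cases h : ∃ b, incB A B b = x.1
    · rw [split_of_right A B x h, extLetter₂, dif_pos h]
      rfl
    · rw [split_of_left A B x ((exists_inc x.1).resolve_right h), extLetter₂, dif_neg h]
      rfl
  · exact congrArg (fun z => Option.map (Sigma.mk Sort2.snd) (SortSum.pr₂ z)) (split_snd A B x).symm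

theorem ext₁_eq {s : Sort2} (w : (obj A B).Word k s) (a : A.NC s) :
    ext₁ w a = extWord ((sumLike L C₁ C₂).ext₁ A B) w a := by
  refine Word.ext ?_ rfl
  exact congrArg (fun p => List.filterMap p w.init) (funext (extLetter₁_eq A B))

theorem ext₂_eq {s : Sort2} (w : (obj A B).Word k s) (b : B.NC s) :
    ext₂ w b = extWord ((sumLike L C₁ C₂).ext₂ A B) w b := by
  refine Word.ext ?_ rfl
  exact congrArg (fun p => List.filterMap p w.init) (funext (extLetter₂_eq A B))

theorem kappaFun_eq (s : Sort2) (x : ((obj A B).ek k).carrier s) :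
    (sumLike L C₁ C₂).kappaFun A B k s x = kappa A B k s x := by
  rcases s with _ | _ <;> rcases x with c | w
  · rfl
  · show (join (A.ek k) (B.ek k) .fst (SortSum.map _ _ (split A B .fst w.last))).1 = _
    by_cases h : ∃ a, incA A B a = w.last.1
    · rw [split_of_left A B w.last h, kappa, dif_pos h, ext₁_eq]
      rfl
    · rw [split_of_right A B w.last ((exists_inc w.last.1).resolve_left h), kappa, dif_neg h,
        ext₂_eq]
      rfl
  · exact c.elim
  · show (join (A.ek k) (B.ek k) .snd (SortSum.map
      (fun a => (extWord ((sumLike L C₁ C₂).ext₁ A B) w a).nc)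
      (fun b => (extWord ((sumLike L C₁ C₂).ext₂ A B) w b).nc) (split A B .snd w.last))).1 = _
    rw [split_snd, kappa, ext₁_eq, ext₂_eq]
    rfl

end Kappa

/-! ### The comparison with the standard model of the parallel sum -/

section Theta

variable (A : Str L C₁) (B : Str L C₂)

/-- The comparison map, as a homomorphism. -/
def thetaHom : obj A.E B.E ⟶ (oplus A B).E where
  toFun := theta A B
  map_con s c := by
    rcases s with _ | _
    · rfl
    · exact c.elim
  map_rel R x h := by
    rcases R with R | _ | _
    · exact h
    · rcases h with ⟨a, ha, hx⟩ | ⟨b, hb, hx⟩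
      · exact (hx 0).symm.trans ((congrArg Glue.inc₁ ha).trans (hx 1))
      · exact (hx 0).symm.trans ((congrArg Glue.inc₂ hb).trans (hx 1))
    · rcases h with ⟨a, ha, h₀, h₁⟩ | ⟨b, hb, h₀, h₁⟩
      · exact Or.inl ⟨a 0, h₁ ▸ ha, h₀⟩
      · exact Or.inr ⟨b 0, h₁ ▸ hb, h₀⟩
  map_nc s x hx := by
    rcases s with _ | _
    · exact hx
    · exact fun ⟨c, _⟩ => c.elim

/-- The equality symbol is reflected because `I` holds of every element and itself in the standard
models, so that it relates every element of the twisted sum to itself. -/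
theorem isStrong_thetaHom : IsStrong (thetaHom A B) := by
  intro R x h
  rcases R with R | _ | _
  · exact h
  · have h' : (show Glue A.con B.con from x 0) = x 1 := h
    obtain ⟨a, ha⟩ | ⟨b, hb⟩ := Glue.exists_inc (show Glue A.con B.con from x 0)
    · exact Or.inl ⟨fun _ => a, rfl, fun i => match i with | 0 => ha | 1 => ha.trans h'⟩
    · exact Or.inr ⟨fun _ => b, rfl, fun i => match i with | 0 => hb | 1 => hb.trans h'⟩
  · rcases h with ⟨a, ha, hx⟩ | ⟨b, hb, hx⟩
    · exact Or.inl ⟨fun i => match i with | 0 => a | 1 => (x 1).1, ha, hx, rfl⟩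
    · exact Or.inr ⟨fun i => match i with | 0 => b | 1 => (x 1).2, hb, hx, rfl⟩

theorem _root_.Glue.image_union_image_preimage {X Y : Type u} {c₁ : C₁ → X} {c₂ : C₂ → Y}
    (M : Set (Glue c₁ c₂)) :
    Glue.inc₁ '' (Glue.inc₁ ⁻¹' M) ∪ Glue.inc₂ '' (Glue.inc₂ ⁻¹' M) = M := by
  ext x
  constructor
  · rintro (⟨a, ha, rfl⟩ | ⟨b, hb, rfl⟩)
    · exact ha
    · exact hb
  · intro hx
    obtain ⟨a, rfl⟩ | ⟨b, rfl⟩ := Glue.exists_inc x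
    · exact Or.inl ⟨a, hx, rfl⟩
    · exact Or.inr ⟨b, hx, rfl⟩

theorem surjective_thetaHom (s : Sort2) : Function.Surjective ((thetaHom A B).toFun s) := by
  rcases s with _ | _
  · exact fun x => ⟨x, rfl⟩
  · exact fun M => ⟨(Glue.inc₁ ⁻¹' (show Set (Glue A.con B.con) from M),
      Glue.inc₂ ⁻¹' (show Set (Glue A.con B.con) from M)), Glue.image_union_image_preimage _⟩

end Theta

end TwistedSum

/-! ### The saturated sum of arbitrary structures -/

namespace SatSum

variable {L : RSig.{u}} {N : Type u} {C₁ C₂ : Set N}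

section Defs

variable {D₁ : ∀ s, Set ((L.E C₁).Con s)} {D₂ : ∀ s, Set ((L.E C₂).Con s)}

/-- A pair of elements of the first sort, as a tuple for the equality symbol. -/
def pair {C : Type u} {D : ∀ s, Set ((L.E C).Con s)} {A : MStr (L.E C) D} (x y : A.carrier .fst) :
    ∀ i, A.carrier ((L.E C).sort .eq i) :=
  fun i => if (show Fin 2 from i) = 0 then x else y

theorem map_pair {C : Type u} {D : ∀ s, Set ((L.E C).Con s)} {A A' : MStr (L.E C) D} (f : A ⟶ A')
    (x y : A.carrier .fst) :
    (fun i => f.toFun _ (pair x y i)) = pair (f.toFun .fst x) (f.toFun .fst y) := by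
  funext i
  exact apply_ite (f.toFun .fst) _ _ _

variable (A : MStr (L.E C₁) D₁) (B : MStr (L.E C₂) D₂)

/-- Two constants are linked in one step if their interpretations in one of the two structures are
related by the symbol for equality. -/
inductive Step : ↥(C₁ ∪ C₂) → ↥(C₁ ∪ C₂) → Prop
  | left (c d : C₁) (h : A.rel .eq (pair (A.con .fst c) (A.con .fst d))) :
    Step ⟨c.1, Or.inl c.2⟩ ⟨d.1, Or.inl d.2⟩
  | right (c d : C₂) (h : B.rel .eq (pair (B.con .fst c) (B.con .fst d))) :
    Step ⟨c.1, Or.inr c.2⟩ ⟨d.1, Or.inr d.2⟩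

/-- The equivalence relation on constants generated by the symbol for equality. -/
def Linked : ↥(C₁ ∪ C₂) → ↥(C₁ ∪ C₂) → Prop := Relation.EqvGen (Step A B)

/-- The first sort consists of the constant symbols and of the non-constant elements of the two
components. -/
def Car : Sort2 → Type u
  | .fst => ↥(C₁ ∪ C₂) ⊕ (A.NC .fst ⊕ B.NC .fst)
  | .snd => A.carrier .snd × B.carrier .snd

/-- The elements of `A` that an element of the saturated sum matches. -/
def match₁ : ∀ s, Car A B s → A.carrier s → Prop
  | .fst, .inl c => fun a => ∃ c' : C₁, A.con .fst c' = a ∧ Linked A B c ⟨c'.1, Or.inl c'.2⟩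
  | .fst, .inr (.inl a') => fun a => a'.1 = a
  | .fst, .inr (.inr _) => fun _ => False
  | .snd, x => fun a => x.1 = a

/-- The elements of `B` that an element of the saturated sum matches. -/
def match₂ : ∀ s, Car A B s → B.carrier s → Prop
  | .fst, .inl c => fun b => ∃ c' : C₂, B.con .fst c' = b ∧ Linked A B c ⟨c'.1, Or.inr c'.2⟩
  | .fst, .inr (.inl _) => fun _ => False
  | .fst, .inr (.inr b') => fun b => b'.1 = b
  | .snd, x => fun b => x.2 = b

/-- The saturated sum. Its constants are all distinct; relations are closed under replacing a
constant by a linked one. -/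
def obj : MStr (L.E ↥(C₁ ∪ C₂)) (fun _ => ∅) where
  carrier := Car A B
  con
    | .fst => Sum.inl
    | .snd => PEmpty.elim
  rel R x := (∃ a, A.rel R a ∧ ∀ i, match₁ A B _ (x i) (a i)) ∨
    ∃ b, B.rel R b ∧ ∀ i, match₂ A B _ (x i) (b i)
  apart _ _ h := h.elim

variable {A B} {A' : MStr (L.E C₁) D₁} {B' : MStr (L.E C₂) D₂}

theorem Linked.map (f : A ⟶ A') (g : B ⟶ B') {c d : ↥(C₁ ∪ C₂)} (h : Linked A B c d) :
    Linked A' B' c d := by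
  refine Relation.EqvGen.mono (fun c d h => ?_) _ _ h
  rcases h with ⟨c, d, h⟩ | ⟨c, d, h⟩
  · refine .left c d ?_
    have := f.map_rel _ _ h
    rwa [map_pair, f.map_con, f.map_con] at this
  · refine .right c d ?_
    have := g.map_rel _ _ h
    rwa [map_pair, g.map_con, g.map_con] at this

theorem Linked.of_emb {f : A ⟶ A'} {g : B ⟶ B'} (hf : IsEmb f) (hg : IsEmb g) {c d : ↥(C₁ ∪ C₂)}
    (h : Linked A' B' c d) : Linked A B c d := by
  refine Relation.EqvGen.mono (fun c d h => ?_) _ _ h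
  rcases h with ⟨c, d, h⟩ | ⟨c, d, h⟩
  · refine .left c d (hf.2 _ _ ?_)
    rwa [map_pair, f.map_con, f.map_con]
  · refine .right c d (hg.2 _ _ ?_)
    rwa [map_pair, g.map_con, g.map_con]

theorem rel_pair_ek {C : Type u} {D : ∀ s, Set ((L.E C).Con s)} {A : MStr (L.E C) D} (k : ℕ)
    {c d : C} (h : A.rel .eq (pair (A.con .fst c) (A.con .fst d))) :
    (A.ek k).rel .eq (pair ((A.ek k).con .fst c) ((A.ek k).con .fst d)) := by
  refine ⟨fun i j => ?_, ?_⟩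
  · have : ∀ i, ∃ c', pair ((A.ek k).con .fst c) ((A.ek k).con .fst d) i = Sum.inl c' := by
      intro i
      unfold pair
      split
      · exact ⟨c, rfl⟩
      · exact ⟨d, rfl⟩
    obtain ⟨c', hc'⟩ := this i
    rw [hc']
    trivial
  · refine (congrArg (A.rel .eq) ?_).mpr h
    exact map_pair (ekε k A) _ _

theorem Linked.ek (k : ℕ) {c d : ↥(C₁ ∪ C₂)} (h : Linked A B c d) :
    Linked (A.ek k) (B.ek k) c d := by
  refine Relation.EqvGen.mono (fun c d h => ?_) _ _ h
  rcases h with ⟨c, d, h⟩ | ⟨c, d, h⟩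
  · exact .left c d (rel_pair_ek k h)
  · exact .right c d (rel_pair_ek k h)

/-- The action of the saturated sum on elements. -/
def mapFun (f : A ⟶ A') (g : B ⟶ B') : ∀ s, Car A B s → Car A' B' s
  | .fst => Sum.map id (Sum.map (Hom.onNC f) (Hom.onNC g))
  | .snd => Prod.map (f.toFun .snd) (g.toFun .snd)

theorem match₁_mapFun (f : A ⟶ A') (g : B ⟶ B') {s : Sort2} {x : Car A B s} {a : A.carrier s}
    (h : match₁ A B s x a) : match₁ A' B' s (mapFun f g s x) (f.toFun s a) := by
  rcases s with _ | _
  · rcases x with c | a' | b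
    · obtain ⟨c', rfl, hc⟩ := h
      exact ⟨c', (f.map_con .fst c').symm, hc.map f g⟩
    · exact congrArg (f.toFun .fst) h
    · exact h
  · exact congrArg (f.toFun .snd) h

theorem match₂_mapFun (f : A ⟶ A') (g : B ⟶ B') {s : Sort2} {x : Car A B s} {b : B.carrier s}
    (h : match₂ A B s x b) : match₂ A' B' s (mapFun f g s x) (g.toFun s b) := by
  rcases s with _ | _
  · rcases x with c | a | b'
    · obtain ⟨c', rfl, hc⟩ := h
      exact ⟨c', (g.map_con .fst c').symm, hc.map f g⟩
    · exact h
    · exact congrArg (g.toFun .fst) h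
  · exact congrArg (g.toFun .snd) h

variable (L C₁ C₂ D₁ D₂) in
/-- The saturated sum, as a functor. -/
def functor : MStr (L.E C₁) D₁ × MStr (L.E C₂) D₂ ⥤ MStr (L.E ↥(C₁ ∪ C₂)) (fun _ => ∅) where
  obj P := obj P.1 P.2
  map f :=
    { toFun := mapFun f.1 f.2
      map_con := by
        rintro (_ | _) c
        · rfl
        · exact c.elim
      map_rel := by
        rintro R x (⟨a, ha, hx⟩ | ⟨b, hb, hx⟩)
        · exact Or.inl ⟨_, f.1.map_rel R a ha, fun i => match₁_mapFun f.1 f.2 (hx i)⟩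
        · exact Or.inr ⟨_, f.2.map_rel R b hb, fun i => match₂_mapFun f.1 f.2 (hx i)⟩
      map_nc := by
        rintro (_ | _) x hx
        · rcases x with c | a | b
          · exact absurd ⟨c, rfl⟩ hx
          · rintro ⟨c, hc⟩
            cases hc
          · rintro ⟨c, hc⟩
            cases hc
        · exact fun ⟨c, _⟩ => c.elim }
  map_id P := by
    ext (_ | _) x
    · rcases x with c | a | b <;> rfl
    · rfl
  map_comp f g := by
    ext (_ | _) x
    · rcases x with c | a | b <;> rfl
    · rfl

variable (A B)

/-- The non-constant elements of the saturated sum, from those of the components. -/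
def join : ∀ s, SortSum A.NC B.NC s → (obj A B).NC s
  | .fst => fun z => ⟨Sum.inr z, fun ⟨_, hc⟩ => Sum.inl_ne_inr hc⟩
  | .snd => fun z => ⟨(z.1.1, z.2.1), fun ⟨c, _⟩ => c.elim⟩

theorem join_bijective (s : Sort2) : Function.Bijective (join A B s) := by
  rcases s with _ | _
  · constructor
    · exact fun z z' h => Sum.inr_injective (congrArg Subtype.val h)
    · rintro ⟨c | z, hx⟩
      · exact absurd ⟨c, rfl⟩ hx
      · exact ⟨z, rfl⟩
  · constructor
    · rintro ⟨a, b⟩ ⟨a', b'⟩ h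
      have h' := congrArg Subtype.val h
      exact Prod.ext (Subtype.ext (congrArg Prod.fst h')) (Subtype.ext (congrArg Prod.snd h'))
    · rintro ⟨x, hx⟩
      exact ⟨(⟨x.1, fun ⟨c, _⟩ => c.elim⟩, ⟨x.2, fun ⟨c, _⟩ => c.elim⟩), rfl⟩

/-- The components of the non-constant elements of the saturated sum. -/
noncomputable def split (s : Sort2) : (obj A B).NC s ≃ SortSum A.NC B.NC s :=
  (Equiv.ofBijective _ (join_bijective A B s)).symm

theorem split_join {s : Sort2} (z : SortSum A.NC B.NC s) : split A B s (join A B s z) = z :=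
  (Equiv.ofBijective _ (join_bijective A B s)).symm_apply_apply z

variable {A B}

theorem onNC_map_join (f : A ⟶ A') (g : B ⟶ B') {s : Sort2} (z : SortSum A.NC B.NC s) :
    Hom.onNC ((functor L C₁ C₂ D₁ D₂).map (Prod.mkHom f g)) (join A B s z) =
      join A' B' s (SortSum.map (Hom.onNC f) (Hom.onNC g) z) := by
  rcases s with _ | _ <;> rfl

theorem match₁_iff {s : Sort2} (x : (obj A B).NC s) (a : A.carrier s) :
    match₁ A B s x.1 a ↔ ∃ a', SortSum.pr₁ (split A B s x) = some a' ∧ a'.1 = a := by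
  obtain ⟨z, rfl⟩ := (join_bijective A B s).2 x
  rw [split_join]
  have key : ∀ a' : A.NC s, a'.1 = a ↔ ∃ a'', some a' = some a'' ∧ a''.1 = a := fun a' =>
    ⟨fun h => ⟨a', rfl, h⟩, fun ⟨_, h, h'⟩ => Option.some_injective _ h ▸ h'⟩
  rcases s with _ | _
  · rcases z with a' | b
    · exact key a'
    · exact ⟨False.elim, fun ⟨_, h, _⟩ => Option.some_ne_none _ h.symm⟩
  · exact key z.1

theorem match₂_iff {s : Sort2} (x : (obj A B).NC s) (b : B.carrier s) :
    match₂ A B s x.1 b ↔ ∃ b', SortSum.pr₂ (split A B s x) = some b' ∧ b'.1 = b := by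
  obtain ⟨z, rfl⟩ := (join_bijective A B s).2 x
  rw [split_join]
  have key : ∀ b' : B.NC s, b'.1 = b ↔ ∃ b'', some b' = some b'' ∧ b''.1 = b := fun b' =>
    ⟨fun h => ⟨b', rfl, h⟩, fun ⟨_, h, h'⟩ => Option.some_injective _ h ▸ h'⟩
  rcases s with _ | _
  · rcases z with a | b'
    · exact ⟨False.elim, fun ⟨_, h, _⟩ => Option.some_ne_none _ h.symm⟩
    · exact key b'
  · exact key z.2

variable (L C₁ C₂ D₁ D₂) in
/-- In the saturated sum, constants match the linked constants. -/
noncomputable def sumLike : SumLike (functor L C₁ C₂ D₁ D₂) where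
  split A B s := split A B s
  split_map {A A' B B'} f g s x := by
    obtain ⟨z, rfl⟩ := (join_bijective A B s).2 x
    exact ((congrArg (split A' B' s) (onNC_map_join f g z)).trans (split_join A' B' _)).trans
      (congrArg _ (split_join A B z).symm)
  match₁ A B s := match₁ A B s
  match₂ A B s := match₂ A B s
  rel_iff _ _ _ _ := Iff.rfl
  match₁_nc _ _ _ x a := match₁_iff x a
  match₂_nc _ _ _ x b := match₂_iff x b
  conMatch₁ A B
    | .fst => fun c c' => Linked A B c ⟨c'.1, Or.inl c'.2⟩
    | .snd => fun _ _ => True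
  conMatch₂ A B
    | .fst => fun c c' => Linked A B c ⟨c'.1, Or.inr c'.2⟩
    | .snd => fun _ _ => True
  match₁_con A B s c a := by
    rcases s with _ | _
    · exact Iff.rfl
    · exact c.elim
  match₂_con A B s c b := by
    rcases s with _ | _
    · exact Iff.rfl
    · exact c.elim
  conMatch₁_ek k _ _ s _ _ h := by
    rcases s with _ | _
    · exact Linked.ek k h
    · exact h
  conMatch₂_ek k _ _ s _ _ h := by
    rcases s with _ | _
    · exact Linked.ek k h
    · exact h
  conMatch₁_emb _ _ hf hg s _ _ h := by
    rcases s with _ | _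
    · exact Linked.of_emb hf hg h
    · exact h
  conMatch₂_emb _ _ hf hg s _ _ h := by
    rcases s with _ | _
    · exact Linked.of_emb hf hg h
    · exact h
  con_emb _ _ _ _ s c d h := by
    rcases s with _ | _
    · exact congrArg Sum.inl (Sum.inl_injective h)
    · exact c.elim

end Defs

section Theta

variable (A : Str L C₁) (B : Str L C₂)

/-- The comparison map from the saturated sum of the standard models to the standard model of the
parallel sum, on elements. -/
noncomputable def theta : ∀ s, Car A.E B.E s → (oplus A B).E.carrier s
  | .fst => Sum.elim (Glue.con A.con B.con)
      (Sum.elim (fun a => Glue.inc₁ (show A.carrier from a.1))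
        (fun b => Glue.inc₂ (show B.carrier from b.1)))
  | .snd => fun x => (Glue.inc₁ '' (show Set A.carrier from x.1) ∪
      Glue.inc₂ '' (show Set B.carrier from x.2) : Set (Glue A.con B.con))

variable {A B}

theorem Linked.con_eq {c d : ↥(C₁ ∪ C₂)} (h : Linked A.E B.E c d) :
    Glue.con A.con B.con c = Glue.con A.con B.con d := by
  induction h with
  | rel c d h =>
    rcases h with ⟨c, d, h⟩ | ⟨c, d, h⟩
    · have h' : A.con c = A.con d := h
      rw [Glue.con_left c.1 c.2, Glue.con_left d.1 d.2, h']
    · have h' : B.con c = B.con d := h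
      rw [Glue.con_right c.1 c.2, Glue.con_right d.1 d.2, h']
  | refl => rfl
  | symm _ _ _ ih => exact ih.symm
  | trans _ _ _ _ _ ih₁ ih₂ => exact ih₁.trans ih₂

/-- The elements that are glued to a constant interpret a linked constant. -/
theorem exists_pred_linked (A : Str L C₁) (B : Str L C₂) (c : ↥(C₁ ∪ C₂)) :
    ∃ r : Glue A.con B.con → Prop,
      (∀ a, r (Glue.inc₁ a) ↔ ∃ c' : C₁, A.con c' = a ∧ Linked A.E B.E c ⟨c'.1, Or.inl c'.2⟩) ∧
      ∀ b, r (Glue.inc₂ b) ↔ ∃ c' : C₂, B.con c' = b ∧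
        Linked A.E B.E c ⟨c'.1, Or.inr c'.2⟩ := by
  apply Glue.lift_pred
  intro d h₁ h₂
  constructor
  · rintro ⟨c', hc', h⟩
    exact ⟨⟨d, h₂⟩, rfl, h.trans _ _ _ (.rel _ _ (.left c' ⟨d, h₁⟩ hc'))⟩
  · rintro ⟨c', hc', h⟩
    exact ⟨⟨d, h₁⟩, rfl, h.trans _ _ _ (.rel _ _ (.right c' ⟨d, h₂⟩ hc'))⟩

theorem match₁_iff_theta (x : Car A.E B.E .fst) (a : A.carrier) :
    match₁ A.E B.E .fst x a ↔ Glue.inc₁ a = theta A B .fst x := by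
  rcases x with c | a' | b
  · constructor
    · rintro ⟨c', rfl, h⟩
      exact (Glue.con_left c'.1 c'.2).symm.trans h.con_eq.symm
    · intro h
      obtain ⟨r, h₁, h₂⟩ := exists_pred_linked A B c
      refine (h₁ a).mp ?_
      rw [h]
      show r (Glue.con A.con B.con c)
      obtain ⟨c, hc | hc⟩ := c
      · rw [Glue.con_left c hc, h₁]
        exact ⟨_, rfl, .refl _⟩
      · rw [Glue.con_right c hc, h₂]
        exact ⟨_, rfl, .refl _⟩
  · exact ⟨fun h => congrArg Glue.inc₁ h.symm, fun h => (Glue.inc₁_eq_inc₁_of_nc a'.2 h).symm⟩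
  · exact ⟨False.elim, Glue.inc₁_ne_inc₂_of_nc' b.2⟩

theorem match₂_iff_theta (x : Car A.E B.E .fst) (b : B.carrier) :
    match₂ A.E B.E .fst x b ↔ Glue.inc₂ b = theta A B .fst x := by
  rcases x with c | a | b'
  · constructor
    · rintro ⟨c', rfl, h⟩
      exact (Glue.con_right c'.1 c'.2).symm.trans h.con_eq.symm
    · intro h
      obtain ⟨r, h₁, h₂⟩ := exists_pred_linked A B c
      refine (h₂ b).mp ?_
      rw [h]
      show r (Glue.con A.con B.con c)
      obtain ⟨c, hc | hc⟩ := c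
      · rw [Glue.con_left c hc, h₁]
        exact ⟨_, rfl, .refl _⟩
      · rw [Glue.con_right c hc, h₂]
        exact ⟨_, rfl, .refl _⟩
  · exact ⟨False.elim, fun h => Glue.inc₁_ne_inc₂_of_nc a.2 h.symm⟩
  · exact ⟨fun h => congrArg Glue.inc₂ h.symm, fun h => (Glue.inc₂_eq_inc₂_of_nc b'.2 h).symm⟩

/-- Relations of the saturated sum of standard models are exactly those of the parallel sum. -/
theorem rel_iff_theta (R : (L.E ↥(C₁ ∪ C₂)).Rel)
    (x : ∀ i, Car A.E B.E ((L.E ↥(C₁ ∪ C₂)).sort R i)) :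
    (obj A.E B.E).rel R x ↔ (oplus A B).E.rel R (fun i => theta A B _ (x i)) := by
  rcases R with R | _ | _
  · exact or_congr (exists_congr fun a => and_congr Iff.rfl
      (forall_congr' fun i => match₁_iff_theta (x i) (a i)))
      (exists_congr fun b => and_congr Iff.rfl
      (forall_congr' fun i => match₂_iff_theta (x i) (b i)))
  · constructor
    · rintro (⟨a, ha, hx⟩ | ⟨b, hb, hx⟩)
      · exact ((match₁_iff_theta _ _).mp (hx 0)).symm.trans
          ((congrArg Glue.inc₁ ha).trans ((match₁_iff_theta _ _).mp (hx 1)))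
      · exact ((match₂_iff_theta _ _).mp (hx 0)).symm.trans
          ((congrArg Glue.inc₂ hb).trans ((match₂_iff_theta _ _).mp (hx 1)))
    · intro h
      have h' : theta A B .fst (x 0) = theta A B .fst (x 1) := h
      obtain ⟨a, ha⟩ | ⟨b, hb⟩ := Glue.exists_inc (theta A B .fst (x 0))
      · exact Or.inl ⟨fun _ => a, rfl, fun i => match i with
          | 0 => (match₁_iff_theta _ _).mpr ha
          | 1 => (match₁_iff_theta _ _).mpr (ha.trans h')⟩
      · exact Or.inr ⟨fun _ => b, rfl, fun i => match i with
          | 0 => (match₂_iff_theta _ _).mpr hb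
          | 1 => (match₂_iff_theta _ _).mpr (hb.trans h')⟩
  · constructor
    · rintro (⟨a, ha, hx⟩ | ⟨b, hb, hx⟩)
      · have h1 : (x 1).1 = a 1 := hx 1
        exact Or.inl ⟨a 0, h1 ▸ ha, (match₁_iff_theta _ _).mp (hx 0)⟩
      · have h1 : (x 1).2 = b 1 := hx 1
        exact Or.inr ⟨b 0, h1 ▸ hb, (match₂_iff_theta _ _).mp (hx 0)⟩
    · rintro (⟨a, ha, hx⟩ | ⟨b, hb, hx⟩)
      · exact Or.inl ⟨fun i => match i with | 0 => a | 1 => (x 1).1, ha, fun i => match i with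
          | 0 => (match₁_iff_theta _ _).mpr hx
          | 1 => rfl⟩
      · exact Or.inr ⟨fun i => match i with | 0 => b | 1 => (x 1).2, hb, fun i => match i with
          | 0 => (match₂_iff_theta _ _).mpr hx
          | 1 => rfl⟩

variable (A B)

/-- The comparison map, as a homomorphism. -/
noncomputable def thetaHom : obj A.E B.E ⟶ (oplus A B).E where
  toFun := theta A B
  map_con s c := by
    rcases s with _ | _
    · rfl
    · exact c.elim
  map_rel R x h := (rel_iff_theta R x).mp h
  map_nc s x hx := by
    rcases s with _ | _
    · rcases x with c | a | b
      · exact absurd ⟨c, rfl⟩ hx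
      · exact fun h => a.2 (Glue.isCon_inc₁.mp h)
      · exact fun h => b.2 (Glue.isCon_inc₂.mp h)
    · exact fun ⟨c, _⟩ => c.elim

theorem isStrong_thetaHom : IsStrong (thetaHom A B) := fun R x h => (rel_iff_theta R x).mpr h

theorem surjective_thetaHom (s : Sort2) : Function.Surjective ((thetaHom A B).toFun s) := by
  rcases s with _ | _
  · intro x
    obtain ⟨a, rfl⟩ | ⟨b, rfl⟩ := Glue.exists_inc (show Glue A.con B.con from x)
    · by_cases ha : ∃ c, A.con c = a
      · obtain ⟨c, rfl⟩ := ha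
        exact ⟨Sum.inl ⟨c.1, Or.inl c.2⟩, Glue.con_left c.1 c.2⟩
      · exact ⟨Sum.inr (Sum.inl ⟨a, ha⟩), rfl⟩
    · by_cases hb : ∃ c, B.con c = b
      · obtain ⟨c, rfl⟩ := hb
        exact ⟨Sum.inl ⟨c.1, Or.inr c.2⟩, Glue.con_right c.1 c.2⟩
      · exact ⟨Sum.inr (Sum.inr ⟨b, hb⟩), rfl⟩
  · exact fun M => ⟨(Glue.inc₁ ⁻¹' (show Set (Glue A.con B.con) from M),
      Glue.inc₂ ⁻¹' (show Set (Glue A.con B.con) from M)), Glue.image_union_image_preimage _⟩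

end Theta

end SatSum

/-- The parallel sum is smooth for monadic second-order logic. -/
theorem isMSOEkSmooth_oplus (L : RSig.{u}) {N : Type u} (C₁ C₂ : Set N) (k : ℕ) :
    IsMSOEkSmooth k (oplus : Str L C₁ → Str L C₂ → Str L ↥(C₁ ∪ C₂)) :=
  ⟨SatSum.functor L C₁ C₂ _ _, SatSum.thetaHom, (SatSum.sumLike L C₁ C₂ _ _).kappa k,
    (SatSum.sumLike L C₁ C₂ _ _).isSmooth_kappa,
    fun A B => isOpenPathwiseEmb_cofree_map _ (SatSum.isStrong_thetaHom A B)
      (SatSum.surjective_thetaHom A B)⟩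

/-! ### Decomposition of monadic second-order formulas over the parallel sum -/

namespace MSO

/-- A structure with assignments of `n` first-order and `m` set variables. -/
structure Interp (L : RSig.{u}) (C : Type u) (n m : ℕ) where
  str : Str L C
  v : Fin n → str.carrier
  V : Fin m → Set str.carrier

namespace Interp

variable {L : RSig.{u}} {C : Type u} {n m : ℕ}

/-- The formula `φ` holds under the given assignments. -/
def Holds (I : Interp L C n m) (φ : MSO L C n m) : Prop := φ.Sat I.str I.v I.V

/-- The value of a term. -/
def val (I : Interp L C n m) (t : Fin n ⊕ C) : I.str.carrier := Sum.elim I.v I.str.con t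

/-- Assign an element to an additional first-order variable. -/
def cons (I : Interp L C n m) (a : I.str.carrier) : Interp L C (n + 1) m :=
  ⟨I.str, Fin.cons a I.v, I.V⟩

/-- Assign a set to an additional set variable. -/
def consSet (I : Interp L C n m) (M : Set I.str.carrier) : Interp L C n (m + 1) :=
  ⟨I.str, I.v, Fin.cons M I.V⟩

end Interp

section Dec

variable {L : RSig.{u}} {C₁ C₂ : Type u} {n₁ n₂ m₁ m₂ k k' : ℕ}

/-- A property of pairs of interpretations is decomposable in rank `k` if it is a finite
disjunction of conjunctions of a formula about the first and a formula about the second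
interpretation, both of rank at most `k`. -/
def Dec (k : ℕ) (P : Interp L C₁ n₁ m₁ → Interp L C₂ n₂ m₂ → Prop) : Prop :=
  ∃ l : List (MSO L C₁ n₁ m₁ × MSO L C₂ n₂ m₂), (∀ p ∈ l, p.1.rank ≤ k ∧ p.2.rank ≤ k) ∧
    ∀ I J, P I J ↔ ∃ p ∈ l, I.Holds p.1 ∧ J.Holds p.2

namespace Dec

variable {P P' : Interp L C₁ n₁ m₁ → Interp L C₂ n₂ m₂ → Prop}

theorem congr (h : Dec k P) (h' : ∀ I J, P' I J ↔ P I J) : Dec k P' := by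
  obtain ⟨l, hl, hP⟩ := h
  exact ⟨l, hl, fun I J => (h' I J).trans (hP I J)⟩

theorem mono (h : Dec k P) (hk : k ≤ k') : Dec k' P := by
  obtain ⟨l, hl, hP⟩ := h
  exact ⟨l, fun p hp => ⟨(hl p hp).1.trans hk, (hl p hp).2.trans hk⟩, hP⟩

theorem left {φ : MSO L C₁ n₁ m₁} (h : φ.rank ≤ k) :
    Dec k (fun I (_ : Interp L C₂ n₂ m₂) => I.Holds φ) := by
  refine ⟨[(φ, neg falsum)], ?_, fun I J => ?_⟩
  · simp [h, rank]
  · simp [Interp.Holds, Sat]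

theorem right {φ : MSO L C₂ n₂ m₂} (h : φ.rank ≤ k) :
    Dec k (fun (_ : Interp L C₁ n₁ m₁) J => J.Holds φ) := by
  refine ⟨[(neg falsum, φ)], ?_, fun I J => ?_⟩
  · simp [h, rank]
  · simp [Interp.Holds, Sat]

theorem false : Dec k (fun (_ : Interp L C₁ n₁ m₁) (_ : Interp L C₂ n₂ m₂) => False) :=
  ⟨[], by simp, by simp⟩

theorem true : Dec k (fun (_ : Interp L C₁ n₁ m₁) (_ : Interp L C₂ n₂ m₂) => True) :=
  (left (φ := neg falsum) (by simp [rank])).congr fun I J => by simp [Interp.Holds, Sat]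

theorem const (p : Prop) :
    Dec k (fun (_ : Interp L C₁ n₁ m₁) (_ : Interp L C₂ n₂ m₂) => p) := by
  by_cases hp : p
  · exact true.congr fun _ _ => iff_true_intro hp
  · exact false.congr fun _ _ => iff_false_intro hp

theorem or (h : Dec k P) (h' : Dec k P') : Dec k (fun I J => P I J ∨ P' I J) := by
  obtain ⟨l, hl, hP⟩ := h
  obtain ⟨l', hl', hP'⟩ := h'
  refine ⟨l ++ l', fun p hp => ?_, fun I J => ?_⟩
  · exact (List.mem_append.mp hp).elim (hl p) (hl' p)
  · refine (or_congr (hP I J) (hP' I J)).trans ?_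
    simp only [List.mem_append, or_and_right, exists_or]

theorem and (h : Dec k P) (h' : Dec k P') : Dec k (fun I J => P I J ∧ P' I J) := by
  obtain ⟨l, hl, hP⟩ := h
  obtain ⟨l', hl', hP'⟩ := h'
  refine ⟨(l ×ˢ l').map fun p => (p.1.1.and p.2.1, p.1.2.and p.2.2), fun p hp => ?_,
    fun I J => ?_⟩
  · obtain ⟨⟨q, q'⟩, hq, rfl⟩ := List.mem_map.mp hp
    obtain ⟨hq, hq'⟩ := List.mem_product.mp hq
    exact ⟨max_le (hl q hq).1 (hl' q' hq').1, max_le (hl q hq).2 (hl' q' hq').2⟩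
  · refine (and_congr (hP I J) (hP' I J)).trans ?_
    constructor
    · rintro ⟨⟨q, hq, h₁, h₂⟩, ⟨q', hq', h₁', h₂'⟩⟩
      exact ⟨_, List.mem_map.mpr ⟨(q, q'), List.mem_product.mpr ⟨hq, hq'⟩, rfl⟩, ⟨h₁, h₁'⟩,
        ⟨h₂, h₂'⟩⟩
    · rintro ⟨p, hp, h₁, h₂⟩
      obtain ⟨⟨q, q'⟩, hq, rfl⟩ := List.mem_map.mp hp
      obtain ⟨hq, hq'⟩ := List.mem_product.mp hq
      exact ⟨⟨q, hq, h₁.1, h₂.1⟩, ⟨q', hq', h₁.2, h₂.2⟩⟩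

theorem not (h : Dec k P) : Dec k (fun I J => ¬ P I J) := by
  obtain ⟨l, hl, hP⟩ := h
  suffices Dec k (fun I J => ¬ ∃ p ∈ l, I.Holds p.1 ∧ J.Holds p.2) from
    this.congr fun I J => not_congr (hP I J)
  clear hP
  induction l with
  | nil => exact true.congr fun I J => by simp
  | cons p l ih =>
    obtain ⟨h₁, h₂⟩ := hl p List.mem_cons_self
    have h₁' : Dec k (fun I (_ : Interp L C₂ n₂ m₂) => I.Holds p.1.neg) := left h₁
    have h₂' : Dec k (fun (_ : Interp L C₁ n₁ m₁) J => J.Holds p.2.neg) := right h₂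
    refine ((h₁'.or h₂').and (ih fun q hq => hl q (List.mem_cons_of_mem p hq))).congr
      fun I J => ?_
    simp only [List.exists_mem_cons_iff, not_or, Interp.Holds, Sat, not_and_or]

theorem iff (h : Dec k P) (h' : Dec k P') : Dec k (fun I J => P I J ↔ P' I J) :=
  ((h.and h').or (h.not.and h'.not)).congr fun I J => by tauto

theorem exists_mem {ι : Type*} {s : Set ι} (hs : s.Finite)
    {P : ι → Interp L C₁ n₁ m₁ → Interp L C₂ n₂ m₂ → Prop} (h : ∀ i ∈ s, Dec k (P i)) :
    Dec k (fun I J => ∃ i ∈ s, P i I J) := by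
  induction s, hs using Set.Finite.induction_on with
  | empty => exact false.congr fun I J => by simp
  | insert _ _ ih =>
    refine ((h _ (Set.mem_insert _ _)).or (ih fun i hi => h i (Set.mem_insert_of_mem _ hi))).congr
      fun I J => ?_
    simp only [Set.mem_insert_iff, exists_eq_or_imp]

theorem forall_finite {ι : Type*} [Finite ι]
    {P : ι → Interp L C₁ n₁ m₁ → Interp L C₂ n₂ m₂ → Prop} (h : ∀ i, Dec k (P i)) :
    Dec k (fun I J => ∀ i, P i I J) :=
  (exists_mem Set.finite_univ fun i _ => (h i).not).not.congr fun I J => by simp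

/-- Boolean combinations of finitely many decomposable properties are decomposable. -/
theorem bool {ι : Type*} [Finite ι] {P : ι → Interp L C₁ n₁ m₁ → Interp L C₂ n₂ m₂ → Prop}
    (h : ∀ i, Dec k (P i)) (F : (ι → Prop) → Prop) : Dec k (fun I J => F fun i => P i I J) := by
  -- `F` is the disjunction of the truth assignments that satisfy it
  have := exists_mem (Set.toFinite {Q : ι → Prop | F Q}) (k := k)
    (P := fun Q I J => ∀ i, P i I J ↔ Q i) fun Q _ => forall_finite fun i => (h i).iff (const _)
  refine this.congr fun I J => ⟨fun hF => ⟨_, hF, fun _ => Iff.rfl⟩, ?_⟩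
  rintro ⟨Q, hQ, hi⟩
  rwa [funext fun i => propext (hi i)]

/-- Quantification over the first interpretation passes to the first conjuncts. -/
theorem exists_left {P : Interp L C₁ (n₁ + 1) m₁ → Interp L C₂ n₂ m₂ → Prop} (h : Dec k P) :
    Dec (k + 1) (fun I J => ∃ a, P (I.cons a) J) := by
  obtain ⟨l, hl, hP⟩ := h
  refine ⟨l.map fun p => (p.1.ex, p.2), fun p hp => ?_, fun I J => ?_⟩
  · obtain ⟨q, hq, rfl⟩ := List.mem_map.mp hp
    exact ⟨Nat.succ_le_succ (hl q hq).1, (hl q hq).2.trans k.le_succ⟩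
  · constructor
    · rintro ⟨a, h⟩
      obtain ⟨q, hq, h₁, h₂⟩ := (hP _ _).mp h
      exact ⟨_, List.mem_map.mpr ⟨q, hq, rfl⟩, ⟨a, h₁⟩, h₂⟩
    · rintro ⟨p, hp, h₁, h₂⟩
      obtain ⟨q, hq, rfl⟩ := List.mem_map.mp hp
      obtain ⟨a, h₁⟩ := h₁
      exact ⟨a, (hP _ _).mpr ⟨q, hq, h₁, h₂⟩⟩

theorem exists_right {P : Interp L C₁ n₁ m₁ → Interp L C₂ (n₂ + 1) m₂ → Prop} (h : Dec k P) :
    Dec (k + 1) (fun I J => ∃ b, P I (J.cons b)) := by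
  obtain ⟨l, hl, hP⟩ := h
  refine ⟨l.map fun p => (p.1, p.2.ex), fun p hp => ?_, fun I J => ?_⟩
  · obtain ⟨q, hq, rfl⟩ := List.mem_map.mp hp
    exact ⟨(hl q hq).1.trans k.le_succ, Nat.succ_le_succ (hl q hq).2⟩
  · constructor
    · rintro ⟨b, h⟩
      obtain ⟨q, hq, h₁, h₂⟩ := (hP _ _).mp h
      exact ⟨_, List.mem_map.mpr ⟨q, hq, rfl⟩, h₁, ⟨b, h₂⟩⟩
    · rintro ⟨p, hp, h₁, h₂⟩
      obtain ⟨q, hq, rfl⟩ := List.mem_map.mp hp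
      obtain ⟨b, h₂⟩ := h₂
      exact ⟨b, (hP _ _).mpr ⟨q, hq, h₁, h₂⟩⟩

theorem exists_sets {P : Interp L C₁ n₁ (m₁ + 1) → Interp L C₂ n₂ (m₂ + 1) → Prop}
    (h : Dec k P) : Dec (k + 1) (fun I J => ∃ M M', P (I.consSet M) (J.consSet M')) := by
  obtain ⟨l, hl, hP⟩ := h
  refine ⟨l.map fun p => (p.1.exSet, p.2.exSet), fun p hp => ?_, fun I J => ?_⟩
  · obtain ⟨q, hq, rfl⟩ := List.mem_map.mp hp
    exact ⟨Nat.succ_le_succ (hl q hq).1, Nat.succ_le_succ (hl q hq).2⟩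
  · constructor
    · rintro ⟨M, M', h⟩
      obtain ⟨q, hq, h₁, h₂⟩ := (hP _ _).mp h
      exact ⟨_, List.mem_map.mpr ⟨q, hq, rfl⟩, ⟨M, h₁⟩, ⟨M', h₂⟩⟩
    · rintro ⟨p, hp, h₁, h₂⟩
      obtain ⟨q, hq, rfl⟩ := List.mem_map.mp hp
      obtain ⟨M, h₁⟩ := h₁
      obtain ⟨M', h₂⟩ := h₂
      exact ⟨M, M', (hP _ _).mpr ⟨q, hq, h₁, h₂⟩⟩

end Dec

end Dec

section Oplus

variable {L : RSig.{u}} {N : Type u} {C₁ C₂ : Set N} {n n₁ n₂ m k : ℕ}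

/-- The value in the parallel sum of a term of the first or of the second component. -/
def gval (I : Interp L C₁ n₁ m) (J : Interp L C₂ n₂ m) :
    (Fin n₁ ⊕ C₁) ⊕ (Fin n₂ ⊕ C₂) → Glue I.str.con J.str.con :=
  Sum.elim (fun t => Glue.inc₁ (I.val t)) (fun t => Glue.inc₂ (J.val t))

variable (C₁ C₂ n₁ n₂) in
/-- The shared constants, as terms of the first and of the second component. -/
def sharedTerms : Set ((Fin n₁ ⊕ C₁) ⊕ (Fin n₂ ⊕ C₂)) :=
  {u | ∃ c ∈ C₁ ∩ C₂, (∃ h, u = .inl (.inr ⟨c, h⟩)) ∨ ∃ h, u = .inr (.inr ⟨c, h⟩)}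

theorem finite_sharedTerms (h : (C₁ ∩ C₂).Finite) : (sharedTerms C₁ C₂ n₁ n₂).Finite := by
  have := h.to_subtype
  refine ((Set.finite_range fun c : ↥(C₁ ∩ C₂) =>
    (Sum.inl (Sum.inr ⟨c.1, c.2.1⟩) : (Fin n₁ ⊕ C₁) ⊕ (Fin n₂ ⊕ C₂))).union
    (Set.finite_range fun c : ↥(C₁ ∩ C₂) =>
    (Sum.inr (Sum.inr ⟨c.1, c.2.2⟩) : (Fin n₁ ⊕ C₁) ⊕ (Fin n₂ ⊕ C₂)))).subset ?_
  rintro _ ⟨c, hc, ⟨_, rfl⟩ | ⟨_, rfl⟩⟩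
  · exact Or.inl ⟨⟨c, hc⟩, rfl⟩
  · exact Or.inr ⟨⟨c, hc⟩, rfl⟩

/-- Terms have immediately equal values if they are terms of the same component with the same
value there, or if they are the two terms for a shared constant. The last case is recorded in one
direction only, as just the generated equivalence relation is of interest. -/
def TermStep (I : Interp L C₁ n₁ m) (J : Interp L C₂ n₂ m) :
    (Fin n₁ ⊕ C₁) ⊕ (Fin n₂ ⊕ C₂) → (Fin n₁ ⊕ C₁) ⊕ (Fin n₂ ⊕ C₂) → Prop
  | .inl t, .inl t' => I.val t = I.val t'
  | .inr t, .inr t' => J.val t = J.val t'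
  | .inl t, .inr t' => ∃ c h h', t = .inr ⟨c, h⟩ ∧ t' = .inr ⟨c, h'⟩
  | .inr _, .inl _ => False

theorem gval_eq_of_termStep {I : Interp L C₁ n₁ m} {J : Interp L C₂ n₂ m}
    {u u' : (Fin n₁ ⊕ C₁) ⊕ (Fin n₂ ⊕ C₂)} (h : TermStep I J u u') : gval I J u = gval I J u' := by
  rcases u with t | t <;> rcases u' with t' | t'
  · exact congrArg Glue.inc₁ h
  · obtain ⟨c, h₁, h₂, rfl, rfl⟩ := h
    exact Glue.glue c h₁ h₂
  · exact h.elim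
  · exact congrArg Glue.inc₂ h

/-- Equality in the parallel sum of the values of two terms in a set of terms that contains the
shared constants is generated by the immediate equalities between terms of the set. -/
theorem gval_eq_iff {U : Set ((Fin n₁ ⊕ C₁) ⊕ (Fin n₂ ⊕ C₂))} (hU : sharedTerms C₁ C₂ n₁ n₂ ⊆ U)
    (I : Interp L C₁ n₁ m) (J : Interp L C₂ n₂ m) (u u' : U) :
    gval I J u.1 = gval I J u'.1 ↔
      Relation.EqvGen (fun v v' : U => TermStep I J v.1 v'.1) u u' := by
  constructor
  · intro h
    -- being the value of a term equivalent to `u` is compatible with the gluing, hence a predicate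
    -- on the parallel sum
    obtain ⟨r, h₁, h₂⟩ := Glue.lift_pred (c₁ := I.str.con) (c₂ := J.str.con)
      (fun a => ∃ t, ∃ ht : Sum.inl t ∈ U, I.val t = a ∧
        Relation.EqvGen (fun v v' : U => TermStep I J v.1 v'.1) u ⟨_, ht⟩)
      (fun b => ∃ t, ∃ ht : Sum.inr t ∈ U, J.val t = b ∧
        Relation.EqvGen (fun v v' : U => TermStep I J v.1 v'.1) u ⟨_, ht⟩) (by
        intro c h₁ h₂
        have hc₁ := hU (show Sum.inl (Sum.inr ⟨c, h₁⟩) ∈ sharedTerms C₁ C₂ n₁ n₂ from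
          ⟨c, ⟨h₁, h₂⟩, Or.inl ⟨h₁, rfl⟩⟩)
        have hc₂ := hU (show Sum.inr (Sum.inr ⟨c, h₂⟩) ∈ sharedTerms C₁ C₂ n₁ n₂ from
          ⟨c, ⟨h₁, h₂⟩, Or.inr ⟨h₂, rfl⟩⟩)
        have hcc : Relation.EqvGen (fun v v' : U => TermStep I J v.1 v'.1) ⟨_, hc₁⟩ ⟨_, hc₂⟩ :=
          .rel _ _ ⟨c, h₁, h₂, rfl, rfl⟩
        constructor
        · rintro ⟨t, ht, htc, hut⟩
          have hs : Relation.EqvGen (fun v v' : U => TermStep I J v.1 v'.1) ⟨_, ht⟩ ⟨_, hc₁⟩ :=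
            .rel _ _ htc
          exact ⟨_, hc₂, rfl, (hut.trans _ _ _ hs).trans _ _ _ hcc⟩
        · rintro ⟨t, ht, htc, hut⟩
          have hs : Relation.EqvGen (fun v v' : U => TermStep I J v.1 v'.1) ⟨_, ht⟩ ⟨_, hc₂⟩ :=
            .rel _ _ htc
          exact ⟨_, hc₁, rfl, (hut.trans _ _ _ hs).trans _ _ _ (hcc.symm _ _)⟩)
    have hu : r (gval I J u.1) := by
      obtain ⟨t | t, ht⟩ := u
      · exact (h₁ _).mpr ⟨t, ht, rfl, .refl _⟩
      · exact (h₂ _).mpr ⟨t, ht, rfl, .refl _⟩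
    rw [h] at hu
    obtain ⟨t' | t', ht'⟩ := u'
    · obtain ⟨t, ht, he, hut⟩ := (h₁ _).mp hu
      have hs : Relation.EqvGen (fun v v' : U => TermStep I J v.1 v'.1) ⟨_, ht⟩ ⟨_, ht'⟩ :=
        .rel _ _ he
      exact hut.trans _ _ _ hs
    · obtain ⟨t, ht, he, hut⟩ := (h₂ _).mp hu
      have hs : Relation.EqvGen (fun v v' : U => TermStep I J v.1 v'.1) ⟨_, ht⟩ ⟨_, ht'⟩ :=
        .rel _ _ he
      exact hut.trans _ _ _ hs
  · intro h
    induction h with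
    | rel _ _ h => exact gval_eq_of_termStep h
    | refl => rfl
    | symm _ _ _ ih => exact ih.symm
    | trans _ _ _ _ _ ih₁ ih₂ => exact ih₁.trans ih₂

theorem dec_termStep (u u' : (Fin n₁ ⊕ C₁) ⊕ (Fin n₂ ⊕ C₂)) :
    Dec k (fun (I : Interp L C₁ n₁ m) (J : Interp L C₂ n₂ m) => TermStep I J u u') := by
  rcases u with t | t <;> rcases u' with t' | t'
  · exact Dec.left (φ := eq t t') (Nat.zero_le _)
  · exact Dec.const _
  · exact Dec.const _
  · exact Dec.right (φ := eq t t') (Nat.zero_le _)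

/-- With finitely many shared constants, the equality of the values of two terms is a Boolean
combination of finitely many atomic formulas about the components. -/
theorem dec_gval_eq (hS : (C₁ ∩ C₂).Finite) (u u' : (Fin n₁ ⊕ C₁) ⊕ (Fin n₂ ⊕ C₂)) :
    Dec k (fun (I : Interp L C₁ n₁ m) (J : Interp L C₂ n₂ m) => gval I J u = gval I J u') := by
  let U := insert u (insert u' (sharedTerms C₁ C₂ n₁ n₂))
  have hU : sharedTerms C₁ C₂ n₁ n₂ ⊆ U := fun _ h => Or.inr (Or.inr h)
  have : Finite U := ((finite_sharedTerms hS).insert _).insert _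
  have h := Dec.bool (k := k) (ι := U × U) (fun i => dec_termStep (L := L) (m := m) i.1.1 i.2.1)
    (fun r => Relation.EqvGen (fun v v' => r (v, v')) ⟨u, Or.inl rfl⟩ ⟨u', Or.inr (Or.inl rfl)⟩)
  exact h.congr fun I J => gval_eq_iff hU I J ⟨u, Or.inl rfl⟩ ⟨u', Or.inr (Or.inl rfl)⟩

/-- The elements of the components that are glued to the value of a term `u` are values of `u` or
of shared constants. -/
theorem exists_term (I : Interp L C₁ n₁ m) (J : Interp L C₂ n₂ m)
    (u : (Fin n₁ ⊕ C₁) ⊕ (Fin n₂ ⊕ C₂)) :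
    (∀ a, Glue.inc₁ a = gval I J u →
      ∃ t, Sum.inl t ∈ insert u (sharedTerms C₁ C₂ n₁ n₂) ∧ I.val t = a) ∧
    ∀ b, Glue.inc₂ b = gval I J u →
      ∃ t, Sum.inr t ∈ insert u (sharedTerms C₁ C₂ n₁ n₂) ∧ J.val t = b := by
  obtain ⟨r, h₁, h₂⟩ := Glue.lift_pred (c₁ := I.str.con) (c₂ := J.str.con)
    (fun a => ∃ t, Sum.inl t ∈ insert u (sharedTerms C₁ C₂ n₁ n₂) ∧ I.val t = a)
    (fun b => ∃ t, Sum.inr t ∈ insert u (sharedTerms C₁ C₂ n₁ n₂) ∧ J.val t = b)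
    (fun c h₁ h₂ => iff_of_true
      ⟨.inr ⟨c, h₁⟩, Or.inr ⟨c, ⟨h₁, h₂⟩, Or.inl ⟨h₁, rfl⟩⟩, rfl⟩
      ⟨.inr ⟨c, h₂⟩, Or.inr ⟨c, ⟨h₁, h₂⟩, Or.inr ⟨h₂, rfl⟩⟩, rfl⟩)
  have hu : r (gval I J u) := by
    rcases u with t | t
    · exact (h₁ _).mpr ⟨t, Or.inl rfl, rfl⟩
    · exact (h₂ _).mpr ⟨t, Or.inl rfl, rfl⟩
  exact ⟨fun a ha => (h₁ a).mp (ha ▸ hu), fun b hb => (h₂ b).mp (hb ▸ hu)⟩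

theorem dec_mem (hS : (C₁ ∩ C₂).Finite) (u : (Fin n₁ ⊕ C₁) ⊕ (Fin n₂ ⊕ C₂)) (X : Fin m) :
    Dec k (fun (I : Interp L C₁ n₁ m) (J : Interp L C₂ n₂ m) =>
      gval I J u ∈ Glue.inc₁ '' I.V X ∪ Glue.inc₂ '' J.V X) := by
  have hf := (finite_sharedTerms (n₁ := n₁) (n₂ := n₂) hS).insert u
  have h₁ := Dec.exists_mem (k := k) (hf.preimage Sum.inl_injective.injOn)
    (P := fun t (I : Interp L C₁ n₁ m) (J : Interp L C₂ n₂ m) =>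
      I.Holds (mem t X) ∧ gval I J (.inl t) = gval I J u)
    fun t _ => (Dec.left (Nat.zero_le _)).and (dec_gval_eq hS _ _)
  have h₂ := Dec.exists_mem (k := k) (hf.preimage Sum.inr_injective.injOn)
    (P := fun t (I : Interp L C₁ n₁ m) (J : Interp L C₂ n₂ m) =>
      J.Holds (mem t X) ∧ gval I J (.inr t) = gval I J u)
    fun t _ => (Dec.right (Nat.zero_le _)).and (dec_gval_eq hS _ _)
  refine (h₁.or h₂).congr fun I J => or_congr ?_ ?_
  · constructor
    · rintro ⟨a, ha, he⟩
      obtain ⟨t, ht, rfl⟩ := (exists_term I J u).1 a he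
      exact ⟨t, ht, ha, he⟩
    · rintro ⟨t, -, ha, he⟩
      exact ⟨I.val t, ha, he⟩
  · constructor
    · rintro ⟨b, hb, he⟩
      obtain ⟨t, ht, rfl⟩ := (exists_term I J u).2 b he
      exact ⟨t, ht, hb, he⟩
    · rintro ⟨t, -, hb, he⟩
      exact ⟨J.val t, hb, he⟩

theorem dec_rel (hS : (C₁ ∩ C₂).Finite) (R : L.Rel)
    (u : Fin (L.ar R) → (Fin n₁ ⊕ C₁) ⊕ (Fin n₂ ⊕ C₂)) :
    Dec k (fun (I : Interp L C₁ n₁ m) (J : Interp L C₂ n₂ m) =>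
      (oplus I.str J.str).rel R (fun i => gval I J (u i))) := by
  have hf := fun i => (finite_sharedTerms (n₁ := n₁) (n₂ := n₂) hS).insert (u i)
  have h₁ := Dec.exists_mem (k := k)
    (Set.Finite.pi' fun i => (hf i).preimage Sum.inl_injective.injOn)
    (P := fun t (I : Interp L C₁ n₁ m) (J : Interp L C₂ n₂ m) =>
      I.Holds (rel R t) ∧ ∀ i, gval I J (.inl (t i)) = gval I J (u i))
    fun t _ => (Dec.left (Nat.zero_le _)).and (Dec.forall_finite fun i => dec_gval_eq hS _ _)
  have h₂ := Dec.exists_mem (k := k)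
    (Set.Finite.pi' fun i => (hf i).preimage Sum.inr_injective.injOn)
    (P := fun t (I : Interp L C₁ n₁ m) (J : Interp L C₂ n₂ m) =>
      J.Holds (rel R t) ∧ ∀ i, gval I J (.inr (t i)) = gval I J (u i))
    fun t _ => (Dec.right (Nat.zero_le _)).and (Dec.forall_finite fun i => dec_gval_eq hS _ _)
  refine (h₁.or h₂).congr fun I J => or_congr ?_ ?_
  · constructor
    · rintro ⟨a, ha, he⟩
      choose t ht hta using fun i => (exists_term I J (u i)).1 (a i) (he i)
      obtain rfl : (fun i => I.val (t i)) = a := funext hta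
      exact ⟨t, ht, ha, he⟩
    · rintro ⟨t, -, ha, he⟩
      exact ⟨fun i => I.val (t i), ha, he⟩
  · constructor
    · rintro ⟨b, hb, he⟩
      choose t ht htb using fun i => (exists_term I J (u i)).2 (b i) (he i)
      obtain rfl : (fun i => J.val (t i)) = b := funext htb
      exact ⟨t, ht, hb, he⟩
    · rintro ⟨t, -, hb, he⟩
      exact ⟨fun i => J.val (t i), hb, he⟩

/-- The assignment in the parallel sum where `τ i` tells from which component, and from which
variable of it, the variable `i` takes its value. -/
def gv (τ : Fin n → Fin n₁ ⊕ Fin n₂) (I : Interp L C₁ n₁ m) (J : Interp L C₂ n₂ m) (i : Fin n) :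
    (oplus I.str J.str).carrier :=
  gval I J (Sum.map Sum.inl Sum.inl (τ i))

/-- The assignment of set variables in the parallel sum. -/
def gV (I : Interp L C₁ n₁ m) (J : Interp L C₂ n₂ m) (X : Fin m) :
    Set (oplus I.str J.str).carrier :=
  (Glue.inc₁ '' I.V X ∪ Glue.inc₂ '' J.V X : Set (Glue I.str.con J.str.con))

open Classical in
/-- A term of a component with the same value as a given term of the parallel sum. -/
noncomputable def place (τ : Fin n → Fin n₁ ⊕ Fin n₂) :
    Fin n ⊕ ↥(C₁ ∪ C₂) → (Fin n₁ ⊕ C₁) ⊕ (Fin n₂ ⊕ C₂)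
  | .inl i => Sum.map Sum.inl Sum.inl (τ i)
  | .inr c => if h : c.1 ∈ C₁ then .inl (.inr ⟨c.1, h⟩) else
      .inr (.inr ⟨c.1, c.2.resolve_left h⟩)

theorem gval_place (τ : Fin n → Fin n₁ ⊕ Fin n₂) (I : Interp L C₁ n₁ m) (J : Interp L C₂ n₂ m)
    (t : Fin n ⊕ ↥(C₁ ∪ C₂)) :
    Sum.elim (gv τ I J) (oplus I.str J.str).con t = gval I J (place τ t) := by
  rcases t with i | c
  · rfl
  · show Glue.con I.str.con J.str.con c = _
    by_cases h : c.1 ∈ C₁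
    · rw [place, dif_pos h]
      exact Glue.con_left c.1 h
    · rw [place, dif_neg h]
      exact Glue.con_right c.1 (c.2.resolve_left h)

theorem cons_gv_left (τ : Fin n → Fin n₁ ⊕ Fin n₂) (I : Interp L C₁ n₁ m)
    (J : Interp L C₂ n₂ m) (a : I.str.carrier) :
    (Fin.cons (Glue.inc₁ a : Glue I.str.con J.str.con) (gv τ I J) :
      Fin (n + 1) → (oplus I.str J.str).carrier) =
    gv (Fin.cons (.inl 0) fun i => Sum.map Fin.succ id (τ i)) (I.cons a) J := by
  funext i
  refine Fin.cases rfl (fun i => ?_) i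
  show gval I J (Sum.map Sum.inl Sum.inl (τ i)) =
    gval (I.cons a) J (Sum.map Sum.inl Sum.inl (Sum.map Fin.succ id (τ i)))
  rcases τ i with j | j <;> rfl

theorem cons_gv_right (τ : Fin n → Fin n₁ ⊕ Fin n₂) (I : Interp L C₁ n₁ m)
    (J : Interp L C₂ n₂ m) (b : J.str.carrier) :
    (Fin.cons (Glue.inc₂ b : Glue I.str.con J.str.con) (gv τ I J) :
      Fin (n + 1) → (oplus I.str J.str).carrier) =
    gv (Fin.cons (.inr 0) fun i => Sum.map id Fin.succ (τ i)) I (J.cons b) := by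
  funext i
  refine Fin.cases rfl (fun i => ?_) i
  show gval I J (Sum.map Sum.inl Sum.inl (τ i)) =
    gval I (J.cons b) (Sum.map Sum.inl Sum.inl (Sum.map id Fin.succ (τ i)))
  rcases τ i with j | j <;> rfl

theorem cons_gV (I : Interp L C₁ n₁ m) (J : Interp L C₂ n₂ m) (M : Set I.str.carrier)
    (M' : Set J.str.carrier) :
    (Fin.cons (Glue.inc₁ '' M ∪ Glue.inc₂ '' M' : Set (Glue I.str.con J.str.con)) (gV I J) :
      Fin (m + 1) → Set (oplus I.str J.str).carrier) = gV (I.consSet M) (J.consSet M') := by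
  funext X
  refine Fin.cases rfl (fun X => ?_) X
  rfl

/-- Satisfaction in the parallel sum is decomposable without increase of the rank, if there are
only finitely many shared constants. -/
theorem dec_sat (hS : (C₁ ∩ C₂).Finite) {n m : ℕ} (φ : MSO L ↥(C₁ ∪ C₂) n m) :
    ∀ {n₁ n₂ : ℕ} (τ : Fin n → Fin n₁ ⊕ Fin n₂),
      Dec φ.rank (fun (I : Interp L C₁ n₁ m) (J : Interp L C₂ n₂ m) =>
        φ.Sat (oplus I.str J.str) (gv τ I J) (gV I J)) := by
  induction φ with
  | falsum => exact fun _ => Dec.false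
  | eq t t' =>
    refine fun τ => (dec_gval_eq hS (place τ t) (place τ t')).congr fun I J => ?_
    simp only [Sat, gval_place]
    rfl
  | mem t X =>
    refine fun τ => (dec_mem hS (place τ t) X).congr fun I J => ?_
    simp only [Sat, gval_place]
    rfl
  | rel R t =>
    refine fun τ => (dec_rel hS R fun i => place τ (t i)).congr fun I J => ?_
    simp only [Sat, gval_place]
  | neg φ ih => exact fun τ => (ih τ).not
  | and φ ψ ihφ ihψ =>
    exact fun τ => ((ihφ τ).mono (le_max_left _ _)).and ((ihψ τ).mono (le_max_right _ _))
  | ex φ ih =>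
    refine fun τ => ((ih _).exists_left.or (ih _).exists_right).congr (P := fun I J =>
      (∃ a, φ.Sat _ (gv (Fin.cons (.inl 0) fun i => Sum.map Fin.succ id (τ i)) (I.cons a) J)
        (gV (I.cons a) J)) ∨
      ∃ b, φ.Sat _ (gv (Fin.cons (.inr 0) fun i => Sum.map id Fin.succ (τ i)) I (J.cons b))
        (gV I (J.cons b))) fun I J => ?_
    constructor
    · rintro ⟨x, hx⟩
      obtain ⟨a, rfl⟩ | ⟨b, rfl⟩ := Glue.exists_inc (show Glue I.str.con J.str.con from x)
      · rw [cons_gv_left] at hx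
        exact Or.inl ⟨a, hx⟩
      · rw [cons_gv_right] at hx
        exact Or.inr ⟨b, hx⟩
    · rintro (⟨a, h⟩ | ⟨b, h⟩)
      · rw [← cons_gv_left] at h
        exact ⟨_, h⟩
      · rw [← cons_gv_right] at h
        exact ⟨_, h⟩
  | exSet φ ih =>
    refine fun τ => (ih τ).exists_sets.congr fun I J => ?_
    constructor
    · rintro ⟨M, hM⟩
      have hM' := Glue.image_union_image_preimage (show Set (Glue I.str.con J.str.con) from M)
      rw [← hM', cons_gV] at hM
      exact ⟨_, _, hM⟩
    · rintro ⟨M, M', h⟩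
      rw [← cons_gV] at h
      exact ⟨_, h⟩

end Oplus

end MSO

/-- The parallel sum along finitely many shared constants preserves equivalence for monadic
second-order logic. -/
theorem MSOEquiv.oplus {L : RSig.{u}} {N : Type u} {C₁ C₂ : Set N} {k : ℕ}
    (hS : (C₁ ∩ C₂).Finite) {A A' : Str L C₁} {B B' : Str L C₂} (hA : MSOEquiv k A A')
    (hB : MSOEquiv k B B') : MSOEquiv k (oplus A B) (oplus A' B') := by
  intro φ hφ
  obtain ⟨l, hl, hP⟩ := MSO.dec_sat hS φ (n₁ := 0) (n₂ := 0) Fin.elim0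
  have key : ∀ (A : Str L C₁) (B : Str L C₂), φ.Sat (_root_.oplus A B) Fin.elim0 Fin.elim0 ↔
      ∃ p ∈ l, p.1.Sat A Fin.elim0 Fin.elim0 ∧ p.2.Sat B Fin.elim0 Fin.elim0 := by
    intro A B
    refine (iff_of_eq (congrArg₂ (MSO.Sat (_root_.oplus A B) φ) (Subsingleton.elim _ _)
      (Subsingleton.elim _ _))).trans (hP ⟨A, Fin.elim0, Fin.elim0⟩ ⟨B, Fin.elim0, Fin.elim0⟩)
  rw [key, key]
  refine exists_congr fun p => and_congr_right fun hp => and_congr (hA _ ?_) (hB _ ?_)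
  · exact (hl p hp).1.trans hφ
  · exact (hl p hp).2.trans hφ

theorem mainTheorem7 (L : RSig.{u}) {N : Type u} (C₁ C₂ : Set N) (k : ℕ) (hk : 0 < k) :
    (∃ κ : KleisliTrans
        (MStr.Ek (L.E C₁) (TwistedSum.shared₁ C₁ C₂) k)
        (MStr.Ek (L.E C₂) (TwistedSum.shared₂ C₁ C₂) k)
        (MStr.Ek (L.E ↥(C₁ ∪ C₂)) (fun _ => ∅) k)
        (TwistedSum.functor L C₁ C₂ (TwistedSum.shared₁ C₁ C₂) (TwistedSum.shared₂ C₁ C₂)),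
      (∀ A B s x, (κ.at A B).toFun s x = TwistedSum.kappa A B k s x) ∧
      κ.IsSmooth (MStr.ekPathData _ _ k) (MStr.ekPathData _ _ k) (MStr.ekPathData _ _ k)) ∧
    (∀ (A : Str L C₁) (B : Str L C₂),
      ∃ θ : TwistedSum.obj A.E B.E ⟶ (oplus A B).E,
        (∀ s x, θ.toFun s x = TwistedSum.theta A B s x) ∧
        (MStr.ekPathData _ _ k).IsOpenPathwiseEmb
          ((MStr.Ek (L.E ↥(C₁ ∪ C₂)) (fun _ => ∅) k).cofree.map θ)) ∧
    IsMSOEkSmooth k (oplus : Str L C₁ → Str L C₂ → Str L ↥(C₁ ∪ C₂)) ∧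
    ((C₁ ∩ C₂).Finite → ∀ (A A' : Str L C₁) (B B' : Str L C₂),
      MSOEquiv k A A' → MSOEquiv k B B' → MSOEquiv k (oplus A B) (oplus A' B')) := by
  refine ⟨⟨(TwistedSum.sumLike L C₁ C₂).kappa k, fun A B => TwistedSum.kappaFun_eq A B,
    (TwistedSum.sumLike L C₁ C₂).isSmooth_kappa⟩, fun A B => ⟨TwistedSum.thetaHom A B,
      fun _ _ => rfl, isOpenPathwiseEmb_cofree_map _ (TwistedSum.isStrong_thetaHom A B)
      (TwistedSum.surjective_thetaHom A B)⟩, isMSOEkSmooth_oplus L C₁ C₂ k,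
    fun hS A A' B B' hA hB => hA.oplus hS hB⟩
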